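/- **Setting.** Let $g>0$, $\vartheta\ge 0$, $h_-<0<h_+$, $\mu_\pm>0$, $\varsigma_\pm>0$. Let $P_\pm\in C^4(0,\infty)$ be positive and strictly increasing, and let $\bar\rho_+\in W^{3,\infty}(0,h_+)$, $\bar\rho_-\in W^{3,\infty}(h_-,0)$ have positive infimum and satisfy $(P_\pm(\bar\rho_\pm))'=-g\bar\rho_\pm$, $P_+(\bar\rho_+(0))=P_-(\bar\rho_-(0))$ and $[\![\bar\rho]\!]:=\bar\rho_+(0)-\bar\rho_-(0)>0$. Write $\bar\rho,\mu,\varsigma,P'(\bar\rho)$ for the functions of $y_3$ equal to the $+$ quantities for $y_3>0$ and to the $-$ quantities for $y_3<0$; $[\![\cdot]\!]$ is the jump (upper minus lower trace) at $y_3=0$. Put $\Omega=\mathbb R^2\times((h_-,0)\cup(0,h_+))$, $y_{\rm h}=(y_1,y_2)$, $|\xi|_{\rm c}=\sqrt{g[\![\bar\rho]\!]/\vartheta}$ if $\vartheta>0$ and $|\xi|_{\rm c}=\infty$ if $\vartheta=0$. Let $\|\cdot\|_k$ be the norm of $W^{k,2}(\Omega)$ and $|\cdot|_0$ the $L^2(\mathbb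 R^2)$ norm of the trace on $\{y_3=0\}$. For $\xi\in\mathbb R^2$ and $\varphi,\theta,\psi\in H^1_0(h_-,h_+)$ let $\mathcal J=\int_{h_-}^{h_+}\bar\rho(\varphi^2+\theta^2+\psi^2)\,dy_3$, $$E=\int_{h_-}^{h_+}\big(2g\bar\rho(\xi_1\varphi+\xi_2\theta)\psi-P'(\bar\rho)\bar\rho(\xi_1\varphi+\xi_2\theta+\psi')^2\big)dy_3-\vartheta|\xi|^2\psi(0)^2,$$ $$D=\int_{h_-}^{h_+}\Big(\varsigma(\xi_1\varphi+\xi_2\theta+\psi')^2+\mu\big((\xi_2\varphi-\xi_1\theta)^2+(\varphi'-\xi_1\psi)^2+(\theta'-\xi_2\psi)^2+(\xi_1\varphi+\xi_2\theta-\psi')^2+\tfrac13(\xi_1\varphi+\xi_2\theta+\psi')^2\big)\Big)dy_3,$$ and $F(\cdot;s)=E-sD$. For $0<|\xi|<|\xi|_{\rm c}$ there is exactly one $s>0$ with $s^2=\sup_{\mathcal J=1}F(\cdot;s)$; call it $\lambda(\xi)$. A growing mode at $\xi$ is a triple $(\varphi,\theta,\psi)$ with $\mathcal J=1$ that maximizes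 $F(\cdot;\lambda(\xi))$ over $\{\mathcal J=1\}$. **Proposition.** (1) $\Lambda:=\sup_{0<|\xi|<|\xi|_{\rm c}}\lambda(\xi)<\infty$, and there is $\xi^1$ with $0<|\xi^1|<|\xi|_{\rm c}$ and $\lambda(\xi^1)\in(2\Lambda/3,\Lambda]$. Let $\xi^1$ be any such frequency and $c_7:=\lambda(\xi^1)>0$. A growing mode at $\xi^1$ exists. Let $(\varphi,\theta,\psi)$ be any growing mode at $\xi^1$. (2) Put $\xi^2=-\xi^1$, $w(\xi^1,y_3)=(-i\varphi,-i\theta,\psi)^\top$, $w(\xi^2,y_3)=(-i\varphi,-i\theta,-\psi)^\top$, and $$\tilde u^0(y)=\sum_{j=1}^2(-1)^{j-1}w(\xi^j,y_3)e^{i y_{\rm h}\cdot\xi^j},\qquad \tilde\eta^0=\tilde u^0/c_7 .$$ Then $\tilde u^0$ is real, and $(\eta,u)=e^{c_7t}(\tilde\eta^0,\tilde u^0)$, $t\ge0$, is a solution with initial data $(\tilde\eta^0,\tilde u^0)$ of the linearized horizontally periodic Rayleigh–Taylor problem $$\eta_t=u,\qquad \bar\rho u_t=g\bar\rho(\operatorname{div}\eta\,\mathbf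 e^3-\nabla\eta_3)+\operatorname{div}\Upsilon(\eta,u)\quad\text{in }\Omega,$$ $$[\![\eta]\!]=[\![u]\!]=0,\quad [\![\Upsilon(\eta,u)\mathbf e^3]\!]=-\vartheta(\partial_1^2+\partial_2^2)\eta_3\,\mathbf e^3\ \text{ on }\{y_3=0\},\qquad \eta=u=0\ \text{ on }\{y_3=h_\pm\},$$ where $\Upsilon(\eta,u)=P'(\bar\rho)\bar\rho\operatorname{div}\eta\,\mathbb I+\mu(\nabla u+\nabla u^\top)+(\varsigma-\tfrac23\mu)\operatorname{div}u\,\mathbb I$. It is $2\pi L_k$-periodic in $y_k$, with $L_k=1/|\xi^1_k|$ if $\xi^1_k\ne0$ and $L_k=1$ if $\xi^1_k=0$ ($k=1,2$). At each time it is in $H^4$ of the period cell of $\Omega$; it satisfies the equations classically, being continuous on $\mathbb R^2\times[h_-,h_+]$, $C^2$ in $\Omega$ and $C^2$ along $\{y_3=0\}$. (3) There are constants $b_3,b_4,b_5,b_6>0$ such that the following holds for every $\chi\in C^\infty(\mathbb R)$ with $0\le\chi\le1$, $\chi(r)=1$ for $|r|\le1$ and $\chi(r)=0$ for $|r|\ge2$.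 For real $n\ge1$ put $\chi_n(r)=1$ if $|r|\le n-1$, $\chi_n(r)=\chi(|r|-n+2)$ if $n-1<|r|<n$, $\chi_n(r)=0$ if $|r|\ge n$, and $\chi_{n,n}(y)=\chi_n(y_1)\chi_n(y_2)$. Then $\chi_{n,n}\tilde u^0\in W^{4,2}(\Omega)$; there is a constant $b_2\ge0$ with $$\frac1n\sum_{\beta_1+\beta_2+\beta_3\le4,\ \beta_1+\beta_2\ge1}\big\|\partial_1^{\beta_1}\partial_2^{\beta_2}\chi_{n,n}\;\partial_3^{\beta_3}\tilde u^0\big\|_0^2\le b_2\qquad\text{for all }n\ge1,$$ all the products in the sum being in $L^2(\Omega)$; and, as $n\to\infty$, $$\frac{\|\chi_{n,n}\tilde u^0\|_4}{n}\to b_3,\quad \frac{\|\chi_{n,n}(\tilde u^0_1,\tilde u^0_2)\|_0}{n}\to b_4,\quad \frac{\|\chi_{n,n}\tilde u^0_3\|_0}{n}\to b_5,\quad \frac{|\chi_{n,n}\tilde u^0_3|_0}{n}\to b_6 .$$ -/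

import Mathlib

open Set Filter Topology MeasureTheory
open scoped ContDiff

noncomputable section

/-! ## Partial derivatives, weak derivatives, Sobolev spaces and norms on subsets of `ℝ³` -/

/-- Points `y = (y₁, y₂, y₃)` of `ℝ³`, with coordinates `y 0`, `y 1`, `y 2`. -/
abbrev Pt := Fin 3 → ℝ

/-- Real vector fields on `ℝ³`. -/
abbrev VField := Pt → Fin 3 → ℝ

/-- The classical partial derivative `∂ᵢ f`. -/
def pd (i : Fin 3) (f : Pt → ℝ) : Pt → ℝ := fun y => lineDeriv ℝ f y (Pi.single i 1)

/-- The classical partial derivative `∂₁^{α₁} ∂₂^{α₂} ∂₃^{α₃} f`. -/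
def multiDeriv (α : Fin 3 → ℕ) (f : Pt → ℝ) : Pt → ℝ :=
  (pd 0)^[α 0] ((pd 1)^[α 1] ((pd 2)^[α 2] f))

/-- `g` is a weak derivative `∂^α f` on the open set `U`. -/
def HasWeakDeriv (U : Set Pt) (α : Fin 3 → ℕ) (f g : Pt → ℝ) : Prop :=
  LocallyIntegrableOn f U ∧ LocallyIntegrableOn g U ∧
    ∀ φ : Pt → ℝ, ContDiff ℝ ∞ φ → HasCompactSupport φ → tsupport φ ⊆ U →
      ∫ y in U, f y * multiDeriv α φ y = (-1) ^ (∑ i, α i) * ∫ y in U, g y * φ y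

open Classical in
/-- The weak derivative `∂^α f` on `U` (unique up to null sets; `0` if there is none). -/
def weakDeriv (U : Set Pt) (α : Fin 3 → ℕ) (f : Pt → ℝ) : Pt → ℝ :=
  if h : ∃ g, HasWeakDeriv U α f g then h.choose else 0

/-- The multi-indices of order at most `k`. -/
def multiIdx (k : ℕ) : Finset (Fin 3 → ℕ) :=
  (Fintype.piFinset fun _ => Finset.range (k + 1)).filter fun α => ∑ i, α i ≤ k

/-- On `U`, all weak derivatives of `f` of order at most `k` exist and are square integrable
over `V`. For `V = U` this is membership in `W^{k,2}(U)`; for horizontally periodic `f` on a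
slab `U` and a period cell `V` it is membership in `W^{k,2}` of the periodic slab. -/
def MemH (k : ℕ) (U V : Set Pt) (f : Pt → ℝ) : Prop :=
  ∀ α ∈ multiIdx k, ∃ g, HasWeakDeriv U α f g ∧ MemLp g 2 (volume.restrict V)

/-- The norm of `W^{k,2}(U)` of a vector-valued function. -/
def hNorm {ι : Type} [Fintype ι] (k : ℕ) (U : Set Pt) (f : Pt → ι → ℝ) : ℝ :=
  Real.sqrt (∑ i, ∑ α ∈ multiIdx k, ∫ y in U, (weakDeriv U α (fun z => f z i) y) ^ 2)

/-- The norm of `L²(U)` of a vector-valued function. -/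
def l2Norm {E ι : Type} [MeasureSpace E] [Fintype ι] (U : Set E) (f : E → ι → ℝ) : ℝ :=
  Real.sqrt (∫ y in U, ∑ i, (f y i) ^ 2)

/-- `H₀¹(a,b)` in one dimension, through the continuous representative: absolutely continuous
on `[a,b]`, square integrable derivative, zero boundary values. -/
def MemH10 (a b : ℝ) (f : ℝ → ℝ) : Prop :=
  AbsolutelyContinuousOnInterval f a b ∧ MemLp (deriv f) 2 (volume.restrict (Ioo a b)) ∧
    f a = 0 ∧ f b = 0

/-- `W^{3,∞}(a,b)`, through the representative extended continuously to `[a,b]`: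
twice continuously differentiable on `[a,b]` with Lipschitz second derivative. -/
def MemW3Inf (a b : ℝ) (f : ℝ → ℝ) : Prop :=
  ContDiffOn ℝ 2 f (Icc a b) ∧
    ∃ K, LipschitzOnWith K (iteratedDerivWithin 2 f (Icc a b)) (Icc a b)

/-! ## The stratified equilibrium -/

/-- The physical data: gravity `g`, surface tension `ϑ`, slab heights `hm < 0 < hp`, shear
viscosities `μ`, bulk viscosities `ς`, pressure laws `P` and density profiles `ρ` of the
upper (`p`) and of the lower (`m`) fluid. -/
structure RTData where
  g : ℝ
  ϑ : ℝ
  hm : ℝ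
  hp : ℝ
  μp : ℝ
  μm : ℝ
  ςp : ℝ
  ςm : ℝ
  Pp : ℝ → ℝ
  Pm : ℝ → ℝ
  ρp : ℝ → ℝ
  ρm : ℝ → ℝ

namespace RTData

variable (p : RTData)

/-- The standing assumptions. -/
structure Valid : Prop where
  g_pos : 0 < p.g
  ϑ_nonneg : 0 ≤ p.ϑ
  hm_neg : p.hm < 0
  hp_pos : 0 < p.hp
  μp_pos : 0 < p.μp
  μm_pos : 0 < p.μm
  ςp_pos : 0 < p.ςp
  ςm_pos : 0 < p.ςm
  Pp_smooth : ContDiffOn ℝ 4 p.Pp (Ioi 0)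
  Pm_smooth : ContDiffOn ℝ 4 p.Pm (Ioi 0)
  Pp_pos : ∀ τ, 0 < τ → 0 < p.Pp τ
  Pm_pos : ∀ τ, 0 < τ → 0 < p.Pm τ
  Pp_mono : StrictMonoOn p.Pp (Ioi 0)
  Pm_mono : StrictMonoOn p.Pm (Ioi 0)
  ρp_smooth : MemW3Inf 0 p.hp p.ρp
  ρm_smooth : MemW3Inf p.hm 0 p.ρm
  /-- non-vacuum -/
  ρp_lower : ∃ c > 0, ∀ y ∈ Ioo 0 p.hp, c ≤ p.ρp y
  ρm_lower : ∃ c > 0, ∀ y ∈ Ioo p.hm 0, c ≤ p.ρm y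
  /-- hydrostatic relations -/
  hydro_p : ∀ y ∈ Ioo 0 p.hp, HasDerivAt (fun s => p.Pp (p.ρp s)) (-(p.ρp y * p.g)) y
  hydro_m : ∀ y ∈ Ioo p.hm 0, HasDerivAt (fun s => p.Pm (p.ρm s)) (-(p.ρm y * p.g)) y
  pressure_jump : p.Pp (p.ρp 0) = p.Pm (p.ρm 0)
  /-- the heavier fluid is on top -/
  density_jump : 0 < p.ρp 0 - p.ρm 0

/-- The equilibrium density `ρ̄`. -/
def rho (s : ℝ) : ℝ := if 0 < s then p.ρp s else p.ρm s

/-- `P'(ρ̄)`. -/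
def dP (s : ℝ) : ℝ := if 0 < s then deriv p.Pp (p.ρp s) else deriv p.Pm (p.ρm s)

/-- The shear viscosity `μ`. -/
def mu (s : ℝ) : ℝ := if 0 < s then p.μp else p.μm

/-- The bulk viscosity `ς`. -/
def bulk (s : ℝ) : ℝ := if 0 < s then p.ςp else p.ςm

/-- The critical frequency: `(g⟦ρ̄⟧/ϑ)^{1/2}` if `ϑ > 0`, and `∞` if `ϑ = 0`. -/
def critFreq : EReal :=
  if 0 < p.ϑ then ((Real.sqrt (p.g * (p.ρp 0 - p.ρm 0) / p.ϑ) : ℝ) : EReal) else ⊤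

/-- The frequencies `ξ` with `0 < |ξ| < |ξ|_c`. -/
def subcritical : Set (EuclideanSpace ℝ (Fin 2)) :=
  {ξ | 0 < ‖ξ‖ ∧ ((‖ξ‖ : ℝ) : EReal) < p.critFreq}

/-! ## The variational problem for the growth rate -/

/-- `𝒥(φ,θ,ψ)`. -/
def J (φ θ ψ : ℝ → ℝ) : ℝ :=
  ∫ s in p.hm..p.hp, p.rho s * (φ s ^ 2 + θ s ^ 2 + ψ s ^ 2)

/-- `E(φ,θ,ψ)` at frequency `ξ`. -/
def E (ξ : EuclideanSpace ℝ (Fin 2)) (φ θ ψ : ℝ → ℝ) : ℝ :=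
  (∫ s in p.hm..p.hp, (2 * p.g * p.rho s * (ξ 0 * φ s + ξ 1 * θ s) * ψ s
      - p.dP s * p.rho s * (ξ 0 * φ s + ξ 1 * θ s + deriv ψ s) ^ 2))
    - p.ϑ * ‖ξ‖ ^ 2 * ψ 0 ^ 2

/-- `D(φ,θ,ψ)` at frequency `ξ`. -/
def D (ξ : EuclideanSpace ℝ (Fin 2)) (φ θ ψ : ℝ → ℝ) : ℝ :=
  (∫ s in p.hm..p.hp, p.bulk s * (ξ 0 * φ s + ξ 1 * θ s + deriv ψ s) ^ 2)
    + ∫ s in p.hm..p.hp, p.mu s * ((ξ 1 * φ s - ξ 0 * θ s) ^ 2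
        + (deriv φ s - ξ 0 * ψ s) ^ 2 + (deriv θ s - ξ 1 * ψ s) ^ 2
        + (ξ 0 * φ s + ξ 1 * θ s - deriv ψ s) ^ 2
        + (ξ 0 * φ s + ξ 1 * θ s + deriv ψ s) ^ 2 / 3)

/-- `F(φ,θ,ψ;s) = E(φ,θ,ψ) - s D(φ,θ,ψ)` at frequency `ξ`. -/
def F (ξ : EuclideanSpace ℝ (Fin 2)) (s : ℝ) (φ θ ψ : ℝ → ℝ) : ℝ :=
  p.E ξ φ θ ψ - s * p.D ξ φ θ ψ

/-- The constraint set: `φ, θ, ψ ∈ H₀¹(h₋,h₊)` with `𝒥(φ,θ,ψ) = 1`. -/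
def Constraint (φ θ ψ : ℝ → ℝ) : Prop :=
  MemH10 p.hm p.hp φ ∧ MemH10 p.hm p.hp θ ∧ MemH10 p.hm p.hp ψ ∧ p.J φ θ ψ = 1

/-- `s > 0` is a growth rate at `ξ`: it solves `s² = α(ξ,s)`, where `α(ξ,s)` is the supremum
of `F(·;s)` over the constraint set. -/
def IsGrowthRate (ξ : EuclideanSpace ℝ (Fin 2)) (s : ℝ) : Prop :=
  0 < s ∧ IsLUB {a | ∃ φ θ ψ, p.Constraint φ θ ψ ∧ a = p.F ξ s φ θ ψ} (s ^ 2)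

/-- The growth rate `λ(ξ)`: the number `s > 0` with `s² = α(ξ,s)`. -/
def lam (ξ : EuclideanSpace ℝ (Fin 2)) : ℝ := Classical.epsilon (p.IsGrowthRate ξ)

/-- `Λ`, the supremum of the growth rates over all subcritical frequencies. -/
def supRate : ℝ := sSup (p.lam '' p.subcritical)

/-- `(φ,θ,ψ)` is a growing mode at `ξ`: a maximizer of `F(·;λ(ξ))` over the constraint set. -/
def IsMode (ξ : EuclideanSpace ℝ (Fin 2)) (φ θ ψ : ℝ → ℝ) : Prop :=
  p.Constraint φ θ ψ ∧
    ∀ φ' θ' ψ', p.Constraint φ' θ' ψ' → p.F ξ (p.lam ξ) φ' θ' ψ' ≤ p.F ξ (p.lam ξ) φ θ ψ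

/-! ## The linearized horizontally periodic problem -/

/-- `Ω₊`. -/
def upper : Set Pt := {y | y 2 ∈ Ioo 0 p.hp}

/-- `Ω₋`. -/
def lower : Set Pt := {y | y 2 ∈ Ioo p.hm 0}

/-- `Ω = Ω₊ ∪ Ω₋`. -/
def dom : Set Pt := p.upper ∪ p.lower

/-- The closed slab `ℝ² × [h₋,h₊]`. -/
def closedSlab : Set Pt := {y | y 2 ∈ Icc p.hm p.hp}

/-- A period cell of `Ω` for the horizontal periods `2πL₁`, `2πL₂`. -/
def cell (L₁ L₂ : ℝ) : Set Pt :=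
  {y | y ∈ p.dom ∧ y 0 ∈ Ioo 0 (2 * Real.pi * L₁) ∧ y 1 ∈ Ioo 0 (2 * Real.pi * L₂)}

/-- `div v`. -/
def dv (v : VField) (y : Pt) : ℝ := ∑ j, pd j (fun z => v z j) y

/-- The entries of `Υ(η,u) = P'(ρ̄) ρ̄ div η I + μ (∇u + ∇uᵀ) + (ς - 2μ/3) div u I`. -/
def Ups (η u : VField) (i j : Fin 3) (y : Pt) : ℝ :=
  p.mu (y 2) * (pd j (fun z => u z i) y + pd i (fun z => u z j) y) +
    if i = j then p.dP (y 2) * p.rho (y 2) * dv η y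
      + (p.bulk (y 2) - 2 * p.mu (y 2) / 3) * dv u y else 0

/-- Spatial regularity of a (classical) horizontally periodic solution at a fixed time:
`2πL₁, 2πL₂`-periodic, in `H⁴` of the periodic slab with the interface removed, continuous on
the closed slab (so there is no jump at the interface `{y₃ = 0}`), zero on `{y₃ = h₊}` and on
`{y₃ = h₋}`, of class `C²` off the interface and along it. -/
structure PeriodicRegular (L₁ L₂ : ℝ) (v : VField) : Prop where
  periodic₁ : ∀ y, v (y + Pi.single 0 (2 * Real.pi * L₁)) = v y
  periodic₂ : ∀ y, v (y + Pi.single 1 (2 * Real.pi * L₂)) = v y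
  memH4 : ∀ i, MemH 4 p.dom (p.cell L₁ L₂) (fun y => v y i)
  continuousOn : ContinuousOn v p.closedSlab
  boundary : ∀ y : Pt, y 2 = p.hm ∨ y 2 = p.hp → v y = 0
  contDiffOn : ContDiffOn ℝ 2 v p.dom
  interface : ContDiff ℝ 2 (fun q : ℝ × ℝ => v ![q.1, q.2, 0])

/-- `(η,u)` is a classical solution on `t ≥ 0` of the linearized horizontally periodic
Rayleigh–Taylor problem with initial data `(η⁰,u⁰)`:
`η_t = u` and `ρ̄ u_t = g ρ̄ (div η e³ - ∇η₃) + div Υ(η,u)` off the interface,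
`⟦η⟧ = ⟦u⟧ = 0` and `⟦Υ(η,u) e³⟧ = -ϑ Δ_h η₃ e³` on the interface, and `η = u = 0` at
`y₃ = h₊` and at `y₃ = h₋`. -/
structure IsPeriodicSolution (L₁ L₂ : ℝ) (η₀ u₀ : VField) (η u : ℝ → VField) : Prop where
  regular_η : ∀ t, 0 ≤ t → p.PeriodicRegular L₁ L₂ (η t)
  regular_u : ∀ t, 0 ≤ t → p.PeriodicRegular L₁ L₂ (u t)
  kinematic : ∀ t, 0 ≤ t → ∀ y ∈ p.dom,
    HasDerivWithinAt (fun s => η s y) (u t y) (Ici 0) t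
  differentiable_Ups : ∀ t, 0 ≤ t → ∀ i j, DifferentiableOn ℝ (p.Ups (η t) (u t) i j) p.dom
  momentum : ∀ t, 0 ≤ t → ∀ y ∈ p.dom, ∃ a : Fin 3 → ℝ,
    HasDerivWithinAt (fun s => u s y) a (Ici 0) t ∧
    ∀ i, p.rho (y 2) * a i =
      p.g * p.rho (y 2) * ((if i = 2 then dv (η t) y else 0) - pd i (fun z => η t z 2) y)
        + ∑ j, pd j (p.Ups (η t) (u t) i j) y
  stress_jump : ∀ t, 0 ≤ t → ∀ y : Pt, y 2 = 0 → ∃ a b : Fin 3 → ℝ,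
    Tendsto (fun z i => p.Ups (η t) (u t) i 2 z) (𝓝[p.upper] y) (𝓝 a) ∧
    Tendsto (fun z i => p.Ups (η t) (u t) i 2 z) (𝓝[p.lower] y) (𝓝 b) ∧
    ∀ i, a i - b i = if i = 2 then
      -p.ϑ * (pd 0 (pd 0 fun z => η t z 2) y + pd 1 (pd 1 fun z => η t z 2) y) else 0
  initial_η : ∀ y ∈ p.closedSlab, η 0 y = η₀ y
  initial_u : ∀ y ∈ p.closedSlab, u 0 y = u₀ y

end RTData

/-! ## The combined mode and the cut-off functions -/

/-- `w(y₃) = -iφ(y₃) e¹ - iθ(y₃) e² + ψ(y₃) e³`. -/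
def modeProfile (φ θ ψ : ℝ → ℝ) (s : ℝ) : Fin 3 → ℂ :=
  ![-(Complex.I * φ s), -(Complex.I * θ s), ψ s]

/-- `exp(i y_h · ξ)`. -/
def planeWave (ξ : EuclideanSpace ℝ (Fin 2)) (y : Pt) : ℂ :=
  Complex.exp (Complex.I * ((y 0 * ξ 0 + y 1 * ξ 1 : ℝ) : ℂ))

/-- The combination of the modes `(φ,θ,ψ)` at `ξ` and `(φ,θ,-ψ)` at `-ξ`, as a complex field:
`w(ξ,y₃) exp(i y_h · ξ) - w(-ξ,y₃) exp(-i y_h · ξ)`. -/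
def uTildeC (ξ : EuclideanSpace ℝ (Fin 2)) (φ θ ψ : ℝ → ℝ) (y : Pt) (i : Fin 3) : ℂ :=
  modeProfile φ θ ψ (y 2) i * planeWave ξ y
    - modeProfile φ θ (fun s => -ψ s) (y 2) i * planeWave (-ξ) y

/-- The real part of the combined mode (the combined mode itself, once it is known to be
real). -/
def uTilde (ξ : EuclideanSpace ℝ (Fin 2)) (φ θ ψ : ℝ → ℝ) : VField :=
  fun y i => (uTildeC ξ φ θ ψ y i).re

/-- The horizontal period lengths: `1/|ξ_k|` if `ξ_k ≠ 0`, and `1` otherwise. -/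
def periodLen (ξ : EuclideanSpace ℝ (Fin 2)) (k : Fin 2) : ℝ :=
  if ξ k ≠ 0 then 1 / |ξ k| else 1

/-- The profile `χ` of the cut-off functions. -/
structure IsCutoff (χ : ℝ → ℝ) : Prop where
  smooth : ContDiff ℝ ∞ χ
  nonneg : ∀ r, 0 ≤ χ r
  le_one : ∀ r, χ r ≤ 1
  eq_one : ∀ r, |r| ≤ 1 → χ r = 1
  eq_zero : ∀ r, 2 ≤ |r| → χ r = 0

/-- `χ_n(r)`: equal to `1` for `|r| ≤ n - 1`, to `χ(|r| - n + 2)` for `n - 1 < |r| < n`, and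
to `0` for `|r| ≥ n`. -/
def cut (χ : ℝ → ℝ) (n r : ℝ) : ℝ :=
  if |r| ≤ n - 1 then 1 else if |r| < n then χ (|r| - n + 2) else 0

/-- `χ_{n,n}(y) = χ_n(y₁) χ_n(y₂)`. -/
def cut2 (χ : ℝ → ℝ) (n : ℝ) (y : Pt) : ℝ := cut χ n (y 0) * cut χ n (y 1)

end

/-!
At a fixed subcritical frequency everything rests on one identity. Completing the square in the
divergence and using the hydrostatic relation on each side of the interface gives
`E = (g⟦ρ⟧ - ϑ|ξ|²) ψ(0)² - ∫ P'(ρ) ρ (ξ₁φ + ξ₂θ + ψ' - gψ/P'(ρ))²`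
(`RTData.energy_identity`). A field whose square vanishes and whose trace does not has positive
energy (`Valid.exists_energy_pos`); conversely `E` is at most a multiple of `ψ(0)²`, which the trace
inequality absorbs into the dissipation, so that `F(·;s) ≤ C/s` on the constraint set with a `C` that
does not depend on the frequency (`exists_F_upper`). Hence `F(·;s)` exceeds `s²` somewhere for small
`s` and nowhere for large `s`, and the supremum of the `s` of the first kind is the growth rate; as
`s ↦ sup F(·;s) - s²` is strictly decreasing, it is the only one. The bound `s² ≤ C/s` makes the
growth rates bounded. A Korn type inequality shows that `K𝒥 - F(·;s)` is coercive on `H₀¹` for large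
`K`, and the direct method (`exists_minimizer`) gives growing modes. The identity also shows that the
trace `ψ(0)` of a growing mode does not vanish, and `(φ, θ)` does not vanish because gravity, which
is the only destabilizing term of `E`, acts through `ξ₁φ + ξ₂θ`.

A growing mode satisfies the Euler–Lagrange equation of `F(·;λ) - λ²𝒥`. The lemma of du Bois-Reymond
with a point source at the interface (`du_bois_reymond`) turns its weak form into absolutely
continuous fluxes that jump by `ϑ|ξ|²ψ(0)` in the normal component. Displacements and fluxes solve a
linear first-order system whose coefficients are of class `C^{2,1}` on each side, so that the mode is
of class `C^{3,1}` up to the boundary on each side (`Valid.mode_regular`). The combined mode is the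
real field `2φ sin(y_h · ξ)`, `2θ sin(y_h · ξ)`, `2ψ cos(y_h · ξ)` (`uTilde_eq`); for fields of this
form the linearized problem reduces to the mode equations (`Valid.isPeriodicSolution`).

For the cut-off estimates each component is a product `G(y_h) f(y₃)` with `G` smooth and `f` of class
`C^{3,1}` on each side. Such a product has weak derivatives of order four, `f'''` being Lipschitz, and
they are the obvious products (`SideSmooth.hasWeakDeriv`). Multiplied by the cut-off functions, the
horizontal factors and their derivatives form what is called a plateau family below: they are bounded
uniformly in `n`, equal a plane wave `c sin(y_h · ξ + δ)` on the square `|y₁|, |y₂| < n - 1`, and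
vanish outside of `[-n, n]²`. The frame in between has area at most `8n` and is negligible after
division by `n²`, while the mean value of `sin²` is `1/2`; therefore the squared norms, divided by
`n²`, converge to `2c² ∫ v²`, with `v` the vertical factor, whatever the profile of the cut-off
(`Plateau.tendsto_integral`). Where a derivative falls on the cut-off function one has `c = 0`, only
the frame contributes, and the squared norm is of order `n`.
-/


noncomputable section

/-! ### Square integrable functions and `H₀¹` on an interval -/

theorem intervalIntegral_eq_setIntegral_Ioo {a b : ℝ} (hab : a ≤ b) (f : ℝ → ℝ) :
    ∫ x in a..b, f x = ∫ x in Ioo a b, f x := by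
  rw [intervalIntegral.integral_of_le hab, integral_Ioc_eq_integral_Ioo]

theorem intervalIntegrable_iff_Ioo {a b : ℝ} (hab : a ≤ b) {f : ℝ → ℝ} :
    IntervalIntegrable f volume a b ↔ IntegrableOn f (Ioo a b) :=
  intervalIntegrable_iff_integrableOn_Ioo_of_le hab

theorem MeasureTheory.MemLp.integrableOn_Ioo {a b : ℝ} {f : ℝ → ℝ}
    (hf : MemLp f 2 (volume.restrict (Ioo a b))) : IntegrableOn f (Ioo a b) :=
  hf.integrable (by norm_num)

theorem integral_add_mul_add_mul {α : Type*} [MeasurableSpace α] {μ : Measure α} {f g h : α → ℝ}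
    (hf : Integrable f μ) (hg : Integrable g μ) (hh : Integrable h μ) (s t : ℝ) :
    ∫ x, (f x + s * g x + t * h x) ∂μ = ∫ x, f x ∂μ + s * ∫ x, g x ∂μ + t * ∫ x, h x ∂μ := by
  have h1 : Integrable (fun x => s * g x) μ := hg.const_mul s
  have h2 : Integrable (fun x => f x + s * g x) μ := hf.add h1
  rw [integral_add h2 (hh.const_mul t), integral_add hf h1, integral_const_mul, integral_const_mul]

/-- The Cauchy–Schwarz inequality `(∫_a^b f)² ≤ (b - a) ∫_a^b f²`. -/
theorem sq_setIntegral_le {a b : ℝ} (hab : a ≤ b) {f : ℝ → ℝ}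
    (hf : MemLp f 2 (volume.restrict (Ioo a b))) :
    (∫ x in Ioo a b, f x) ^ 2 ≤ (b - a) * ∫ x in Ioo a b, f x ^ 2 := by
  rcases hab.eq_or_lt with rfl | hlt
  · simp
  set I := ∫ x in Ioo a b, f x
  have h1 := hf.integrableOn_Ioo
  have h2 := hf.integrable_sq
  have key : 0 ≤ ∫ x in Ioo a b, ((b - a) * f x - I) ^ 2 := integral_nonneg fun _ => sq_nonneg _
  have : ∫ x in Ioo a b, ((b - a) * f x - I) ^ 2
      = (b - a) ^ 2 * (∫ x in Ioo a b, f x ^ 2) - 2 * (b - a) * I * I + I ^ 2 * (b - a) := by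
    have e : ∀ x, ((b - a) * f x - I) ^ 2
      = I ^ 2 + (-(2 * (b - a) * I)) * f x + (b - a) ^ 2 * f x ^ 2 := fun x => by ring
    simp_rw [e]
    rw [integral_add_mul_add_mul (integrable_const _) h1 h2]
    simp [hab]; ring
  rw [this] at key
  have hpos : 0 < b - a := by linarith
  have : 0 ≤ (b - a) * ((b - a) * (∫ x in Ioo a b, f x ^ 2) - I ^ 2) := by nlinarith
  have := nonneg_of_mul_nonneg_right this hpos
  linarith

theorem memLp_two_mono {a b c d : ℝ} {f : ℝ → ℝ} (hf : MemLp f 2 (volume.restrict (Ioo a b)))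
    (h : Ioo c d ⊆ Ioo a b) : MemLp f 2 (volume.restrict (Ioo c d)) :=
  hf.mono_measure (Measure.restrict_mono h le_rfl)

theorem norm_toLp_sq {α : Type*} [MeasurableSpace α] {μ : Measure α} {f : α → ℝ}
    (hf : MemLp f 2 μ) : ‖hf.toLp f‖ ^ 2 = ∫ x, f x ^ 2 ∂μ := by
  rw [← real_inner_self_eq_norm_sq, L2.inner_def]
  refine integral_congr_ae ?_
  filter_upwards [hf.coeFn_toLp] with x hx
  simp [hx, sq]

/-- Completeness of `L²`, stated with integrals. -/
theorem exists_limit_of_cauchy_sq {α : Type*} [MeasurableSpace α] {μ : Measure α} {f : ℕ → α → ℝ}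
    (hf : ∀ n, MemLp (f n) 2 μ)
    (hc : ∀ ε > 0, ∃ N, ∀ m ≥ N, ∀ n ≥ N, ∫ x, (f m x - f n x) ^ 2 ∂μ < ε) :
    ∃ g, MemLp g 2 μ ∧ Tendsto (fun n => ∫ x, (f n x - g x) ^ 2 ∂μ) atTop (𝓝 0) := by
  let F : ℕ → Lp ℝ 2 μ := fun n => (hf n).toLp (f n)
  have hF : CauchySeq F := by
    rw [Metric.cauchySeq_iff]
    intro ε hε
    obtain ⟨N, hN⟩ := hc (ε ^ 2) (by positivity)
    refine ⟨N, fun m hm n hn => ?_⟩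
    rw [dist_eq_norm, ← MemLp.toLp_sub]
    refine lt_of_pow_lt_pow_left₀ 2 hε.le ?_
    rw [norm_toLp_sq]
    exact hN m hm n hn
  obtain ⟨G, hG⟩ := cauchySeq_tendsto_of_complete hF
  refine ⟨G, Lp.memLp G, ?_⟩
  have h1 : Tendsto (fun n => ‖F n - G‖ ^ 2) atTop (𝓝 0) := by
    have := (tendsto_iff_norm_sub_tendsto_zero.1 hG).pow 2
    simpa using this
  refine h1.congr fun n => ?_
  have : F n - G = ((hf n).sub (Lp.memLp G)).toLp (f n - (G : α → ℝ)) := by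
    rw [MemLp.toLp_sub (hf n) (Lp.memLp G), Lp.toLp_coeFn]
  rw [this, norm_toLp_sq]
  simp

namespace MemH10

variable {a b : ℝ} {f g : ℝ → ℝ}

theorem continuousOn (hab : a ≤ b) (hf : MemH10 a b f) : ContinuousOn f (Icc a b) := by
  simpa [uIcc_of_le hab] using hf.1.continuousOn

theorem memLp (hab : a ≤ b) (hf : MemH10 a b f) : MemLp f 2 (volume.restrict (Ioo a b)) := by
  obtain ⟨C, hC⟩ := hf.1.exists_bound
  refine MemLp.of_bound (C := C) (((hf.continuousOn hab).mono
    Ioo_subset_Icc_self).aestronglyMeasurable measurableSet_Ioo) ?_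
  filter_upwards [ae_restrict_mem measurableSet_Ioo] with x hx
  exact hC x (by rw [uIcc_of_le hab]; exact Ioo_subset_Icc_self hx)

theorem ae_differentiableAt (hf : MemH10 a b f) :
    ∀ᵐ x ∂volume.restrict (Ioo a b), DifferentiableAt ℝ f x := by
  rw [ae_restrict_iff' measurableSet_Ioo]
  filter_upwards [hf.1.ae_differentiableAt] with x hx h
  exact hx (Icc_subset_uIcc (Ioo_subset_Icc_self h))

theorem deriv_add_mul (hf : MemH10 a b f) (hg : MemH10 a b g) (t : ℝ) :
    deriv (fun x => f x + t * g x) =ᵐ[volume.restrict (Ioo a b)]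
      fun x => deriv f x + t * deriv g x := by
  filter_upwards [hf.ae_differentiableAt, hg.ae_differentiableAt] with x hx hy
  exact (hx.hasDerivAt.add (hy.hasDerivAt.const_mul t)).deriv

theorem add_mul (hf : MemH10 a b f) (hg : MemH10 a b g) (t : ℝ) :
    MemH10 a b (fun x => f x + t * g x) := by
  refine ⟨hf.1.add (hg.1.const_mul t), ?_, ?_, ?_⟩
  · exact (memLp_congr_ae (hf.deriv_add_mul hg t)).2 (hf.2.1.add (hg.2.1.const_mul t))
  · simp [hf.2.2.1, hg.2.2.1]
  · simp [hf.2.2.2, hg.2.2.2]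

theorem eq_integral (hab : a ≤ b) (hf : MemH10 a b f) {x y : ℝ} (hx : x ∈ Icc a b)
    (hy : y ∈ Icc a b) : f y - f x = ∫ t in x..y, deriv f t :=
  ((hf.1.mono (by rw [uIcc_of_le hab]; exact uIcc_subset_Icc hx hy)).integral_deriv_eq_sub).symm

theorem sq_sub_le (hab : a ≤ b) (hf : MemH10 a b f) {x y : ℝ} (hx : x ∈ Icc a b)
    (hy : y ∈ Icc a b) : (f y - f x) ^ 2 ≤ |y - x| * ∫ t in Ioo a b, deriv f t ^ 2 := by
  wlog hxy : x ≤ y generalizing x y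
  · have := this hy hx (by linarith)
    rw [abs_sub_comm]; nlinarith
  rw [hf.eq_integral hab hx hy, intervalIntegral_eq_setIntegral_Ioo hxy, abs_of_nonneg (by linarith)]
  have hs : Ioo x y ⊆ Ioo a b := Ioo_subset_Ioo hx.1 hy.2
  refine (sq_setIntegral_le hxy (memLp_two_mono hf.2.1 hs)).trans ?_
  have := setIntegral_mono_set (s := Ioo x y) (t := Ioo a b) (μ := volume)
    (f := fun t => deriv f t ^ 2) hf.2.1.integrable_sq
    (Eventually.of_forall fun _ => sq_nonneg _) (LE.le.eventuallyLE hs)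
  exact mul_le_mul_of_nonneg_left this (by linarith)

theorem sq_le (hab : a ≤ b) (hf : MemH10 a b f) {x : ℝ} (hx : x ∈ Icc a b) :
    f x ^ 2 ≤ (b - a) * ∫ t in Ioo a b, deriv f t ^ 2 := by
  have h := hf.sq_sub_le hab (left_mem_Icc.2 hab) hx
  rw [hf.2.2.1, sub_zero, abs_of_nonneg (by linarith [hx.1])] at h
  refine h.trans (mul_le_mul_of_nonneg_right (by linarith [hx.2])
    (integral_nonneg fun _ => sq_nonneg _))

/-- Primitives of square integrable functions of mean value zero are in `H₀¹`. -/
theorem of_primitive (hab : a ≤ b) (hg : MemLp g 2 (volume.restrict (Ioo a b)))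
    (h0 : ∫ x in a..b, g x = 0) :
    MemH10 a b (fun x => ∫ t in a..x, g t) ∧
      deriv (fun x => ∫ t in a..x, g t) =ᵐ[volume.restrict (Ioo a b)] g := by
  have hi : IntervalIntegrable g volume a b :=
    (intervalIntegrable_iff_Ioo hab).2 hg.integrableOn_Ioo
  have hd : deriv (fun x => ∫ t in a..x, g t) =ᵐ[volume.restrict (Ioo a b)] g := by
    refine (ae_restrict_iff' measurableSet_Ioo).2 ?_
    filter_upwards [hi.ae_hasDerivAt_integral] with x hx h
    exact (hx (Icc_subset_uIcc (Ioo_subset_Icc_self h)) a left_mem_uIcc).deriv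
  refine ⟨⟨hi.absolutelyContinuousOnInterval_intervalIntegral left_mem_uIcc,
    (memLp_congr_ae hd).2 hg, by simp, h0⟩, hd⟩

theorem zero : MemH10 a b (fun _ => 0) := by
  refine ⟨?_, by simp, rfl, rfl⟩
  exact (contDiffOn_const (n := 1)).absolutelyContinuousOnInterval

/-- Bounded sequences of `H₀¹` have uniformly Cauchy subsequences (Arzelà–Ascoli). -/
theorem exists_subseq_cauchy (hab : a ≤ b) {u : ℕ → ℝ → ℝ} (hu : ∀ n, MemH10 a b (u n)) {M : ℝ}
    (hM : ∀ n, ∫ t in Ioo a b, deriv (u n) t ^ 2 ≤ M) :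
    ∃ k : ℕ → ℕ, StrictMono k ∧ ∀ ε > 0, ∃ N, ∀ m ≥ N, ∀ n ≥ N, ∀ x ∈ Icc a b,
      |u (k m) x - u (k n) x| ≤ ε := by
  have hM0 : 0 ≤ M := (integral_nonneg fun _ => sq_nonneg _).trans (hM 0)
  -- the bound on the derivatives gives the Hölder modulus of continuity `√(M r)`
  let F : ℕ → BoundedContinuousFunction (Icc a b) ℝ := fun n =>
    BoundedContinuousFunction.mkOfCompact ⟨(Icc a b).domRestrict (u n), ((hu n).continuousOn hab).domRestrict⟩
  have hFx : ∀ n x, F n x = u n x := fun n x => rfl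
  have hcomp : IsCompact (closure (range F)) := by
    refine BoundedContinuousFunction.arzela_ascoli
      (Metric.closedBall 0 (Real.sqrt ((b - a) * M))) (isCompact_closedBall _ _) _ ?_ ?_
    · rintro _ x ⟨n, rfl⟩
      rw [mem_closedBall_zero_iff, hFx, Real.norm_eq_abs]
      refine Real.abs_le_sqrt (((hu n).sq_le hab x.2).trans ?_)
      exact mul_le_mul_of_nonneg_left (hM n) (by linarith)
    · refine Metric.equicontinuous_of_continuity_modulus (fun r => Real.sqrt (r * M)) ?_ _ ?_
      · have : Continuous fun r : ℝ => Real.sqrt (r * M) := by fun_prop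
        simpa using this.tendsto 0
      · rintro x y ⟨_, n, rfl⟩
        change dist (u n x) (u n y) ≤ _
        rw [Real.dist_eq]
        refine Real.abs_le_sqrt (((hu n).sq_sub_le hab y.2 x.2).trans ?_)
        rw [Subtype.dist_eq, Real.dist_eq]
        exact mul_le_mul_of_nonneg_left (hM n) (abs_nonneg _)
  obtain ⟨G, -, k, hk, hG⟩ := hcomp.tendsto_subseq (x := F) fun n => subset_closure (mem_range_self n)
  refine ⟨k, hk, fun ε hε => ?_⟩
  obtain ⟨N, hN⟩ := Metric.cauchySeq_iff.1 hG.cauchySeq ε hε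
  refine ⟨N, fun m hm n hn x hx => ?_⟩
  have := (BoundedContinuousFunction.dist_coe_le_dist (f := F (k m)) (g := F (k n)) ⟨x, hx⟩).trans
    (hN m hm n hn).le
  simpa [hFx, Real.dist_eq] using this

/-- Completeness of `H₀¹`. -/
theorem exists_limit (hab : a ≤ b) {u : ℕ → ℝ → ℝ} (hu : ∀ n, MemH10 a b (u n))
    (hc : ∀ ε > 0, ∃ N, ∀ m ≥ N, ∀ n ≥ N,
      ∫ x in Ioo a b, (deriv (u m) x - deriv (u n) x) ^ 2 < ε) :
    ∃ v, MemH10 a b v ∧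
      Tendsto (fun n => ∫ x in Ioo a b, (deriv (u n) x - deriv v x) ^ 2) atTop (𝓝 0) := by
  obtain ⟨g, hg, hlim⟩ := exists_limit_of_cauchy_sq (fun n => (hu n).2.1) hc
  have h0 : ∫ x in Ioo a b, g x = 0 := by
    have hle : ∀ n, (∫ x in Ioo a b, g x) ^ 2
        ≤ (b - a) * ∫ x in Ioo a b, (deriv (u n) x - g x) ^ 2 := by
      intro n
      have h := sq_setIntegral_le hab ((hu n).2.1.sub hg)
      have h1 : ∫ x in Ioo a b, (deriv (u n) - g) x = - ∫ x in Ioo a b, g x := by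
        have h2 := (hu n).eq_integral hab (left_mem_Icc.2 hab) (right_mem_Icc.2 hab)
        rw [(hu n).2.2.1, (hu n).2.2.2, intervalIntegral_eq_setIntegral_Ioo hab] at h2
        simp only [Pi.sub_apply]
        rw [integral_sub (hu n).2.1.integrableOn_Ioo hg.integrableOn_Ioo, ← h2]; ring
      rw [h1, neg_sq] at h
      exact h
    have h1 : Tendsto (fun n => (b - a) * ∫ x in Ioo a b, (deriv (u n) x - g x) ^ 2) atTop (𝓝 0) := by
      simpa using hlim.const_mul (b - a)
    have h2 := ge_of_tendsto' h1 hle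
    exact pow_eq_zero_iff (two_ne_zero) |>.1 (le_antisymm h2 (sq_nonneg _))
  obtain ⟨h1, h2⟩ := of_primitive hab hg (by rw [intervalIntegral_eq_setIntegral_Ioo hab, h0])
  refine ⟨_, h1, hlim.congr fun n => integral_congr_ae ?_⟩
  filter_upwards [h2] with x hx
  rw [hx]

end MemH10

/-! ### The equilibrium on each side of the interface -/

/-- What the hypotheses say about one of the two fluids, on the closed interval it occupies. The
hydrostatic relation is solved for `ρ'`, which forces `P'(ρ) > 0`. -/
structure SideFacts (g c d : ℝ) (P ρ : ℝ → ℝ) : Prop where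
  pos : ∀ y ∈ Icc c d, 0 < ρ y
  contDiffOn : ContDiffOn ℝ 2 ρ (Icc c d)
  dP_pos : ∀ y ∈ Icc c d, 0 < deriv P (ρ y)
  dP_continuousOn : ContinuousOn (fun y => deriv P (ρ y)) (Icc c d)
  hasDeriv : ∀ y ∈ Icc c d, HasDerivWithinAt ρ (-(g * ρ y) / deriv P (ρ y)) (Icc c d) y

/-- The hydrostatic relation reads `P'(ρ) ρ' = -gρ`. It extends to the end points by continuity, and it
rules out the zeros that `P'` might have although `P` is strictly increasing. -/
theorem sideFacts_of {g c d : ℝ} {P ρ : ℝ → ℝ} (hg : 0 < g) (hcd : c < d)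
    (hP : ContDiffOn ℝ 4 P (Ioi 0)) (hmono : StrictMonoOn P (Ioi 0)) (hρ : MemW3Inf c d ρ)
    (hlow : ∃ m > 0, ∀ y ∈ Ioo c d, m ≤ ρ y)
    (hyd : ∀ y ∈ Ioo c d, HasDerivAt (fun s => P (ρ s)) (-(ρ y * g)) y) :
    SideFacts g c d P ρ := by
  obtain ⟨m, hm, hlow⟩ := hlow
  have hcl : closure (Ioo c d) = Icc c d := closure_Ioo hcd.ne
  have hcont : ContinuousOn ρ (Icc c d) := hρ.1.continuousOn
  have hlow' : ∀ y ∈ Icc c d, m ≤ ρ y := by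
    intro y hy
    rw [← hcl] at hy hcont
    exact closure_minimal (s := Ioo c d) (t := closure (Ioo c d) ∩ ρ ⁻¹' Ici m)
      (fun z hz => ⟨subset_closure hz, hlow z hz⟩)
      (hcont.preimage_isClosed_of_isClosed isClosed_closure isClosed_Ici) hy |>.2
  have hpos : ∀ y ∈ Icc c d, 0 < ρ y := fun y hy => hm.trans_le (hlow' y hy)
  have hdPc : ContinuousOn (deriv P) (Ioi 0) :=
    hP.continuousOn_deriv_of_isOpen isOpen_Ioi (by norm_num)
  have hdPρ : ContinuousOn (fun y => deriv P (ρ y)) (Icc c d) :=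
    hdPc.comp hcont fun y hy => hpos y hy
  have hdiff : ∀ y ∈ Icc c d, HasDerivWithinAt ρ (derivWithin ρ (Icc c d) y) (Icc c d) y :=
    fun y hy => ((hρ.1.differentiableOn (by norm_num)) y hy).hasDerivWithinAt
  have hρ' : ContinuousOn (derivWithin ρ (Icc c d)) (Icc c d) :=
    hρ.1.continuousOn_derivWithin (uniqueDiffOn_Icc hcd) (by norm_num)
  have hnn : ∀ t, 0 < t → 0 ≤ deriv P t := by
    intro t ht
    rw [← derivWithin_of_isOpen isOpen_Ioi ht]
    exact hmono.monotoneOn.derivWithin_nonneg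
  have hrel : ∀ y ∈ Icc c d, deriv P (ρ y) * derivWithin ρ (Icc c d) y = -(ρ y * g) := by
    have hint : EqOn (fun y => deriv P (ρ y) * derivWithin ρ (Icc c d) y)
        (fun y => -(ρ y * g)) (Ioo c d) := by
      intro y hy
      have hy' := Ioo_subset_Icc_self hy
      have h1 : HasDerivAt ρ (derivWithin ρ (Icc c d) y) y :=
        (hdiff y hy').hasDerivAt (Icc_mem_nhds hy.1 hy.2)
      have h2 : HasDerivAt P (deriv P (ρ y)) (ρ y) :=
        ((hP.differentiableOn (by norm_num)).differentiableAt
          (Ioi_mem_nhds (hpos y hy'))).hasDerivAt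
      exact (h2.comp y h1).unique (hyd y hy)
    exact hint.of_subset_closure (hdPρ.mul hρ') (hcont.mul continuousOn_const).neg
      Ioo_subset_Icc_self hcl.symm.subset
  have hdPpos : ∀ y ∈ Icc c d, 0 < deriv P (ρ y) := by
    intro y hy
    refine lt_of_le_of_ne (hnn _ (hpos y hy)) fun h => ?_
    have := hrel y hy
    rw [← h, zero_mul] at this
    have := mul_pos (hpos y hy) hg
    linarith
  refine ⟨hpos, hρ.1, hdPpos, hdPρ, fun y hy => ?_⟩
  have : -(g * ρ y) / deriv P (ρ y) = derivWithin ρ (Icc c d) y := by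
    rw [div_eq_iff (hdPpos y hy).ne']
    linarith [hrel y hy]
  rw [this]; exact hdiff y hy

/-- Bounded measurable coefficients on `(a,b)`. -/
def IsCoef (a b : ℝ) (c : ℝ → ℝ) : Prop :=
  AEStronglyMeasurable c (volume.restrict (Ioo a b)) ∧ ∃ C, ∀ x ∈ Ioo a b, |c x| ≤ C

namespace IsCoef

variable {a b : ℝ} {c e f h : ℝ → ℝ}

theorem const (r : ℝ) : IsCoef a b fun _ => r := ⟨aestronglyMeasurable_const, |r|, fun _ _ => le_rfl⟩

theorem add (hc : IsCoef a b c) (he : IsCoef a b e) : IsCoef a b fun x => c x + e x := by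
  obtain ⟨C, hC⟩ := hc.2
  obtain ⟨D, hD⟩ := he.2
  exact ⟨hc.1.add he.1, C + D, fun x hx => (abs_add_le _ _).trans (add_le_add (hC x hx) (hD x hx))⟩

theorem mul (hc : IsCoef a b c) (he : IsCoef a b e) : IsCoef a b fun x => c x * e x := by
  obtain ⟨C, hC⟩ := hc.2
  obtain ⟨D, hD⟩ := he.2
  refine ⟨hc.1.mul he.1, C * D, fun x hx => ?_⟩
  rw [abs_mul]
  exact mul_le_mul (hC x hx) (hD x hx) (abs_nonneg _) ((abs_nonneg _).trans (hC x hx))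

theorem const_mul (r : ℝ) (hc : IsCoef a b c) : IsCoef a b fun x => r * c x := (const r).mul hc

theorem neg (hc : IsCoef a b c) : IsCoef a b fun x => -c x := by
  simpa using hc.const_mul (-1)

/-- Functions that are continuous up to the boundary on both sides of `0`. -/
theorem ite (hf : ContinuousOn f (Icc 0 b)) (hh : ContinuousOn h (Icc a 0)) :
    IsCoef a b fun s => if 0 < s then f s else h s := by
  constructor
  · have hu : Ioo a b ⊆ Ioo 0 b ∪ Ioc a 0 := fun x hx => by
      rcases lt_or_ge 0 x with h | h
      · exact Or.inl ⟨h, hx.2⟩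
      · exact Or.inr ⟨hx.1, h⟩
    refine AEStronglyMeasurable.mono_measure ?_ (Measure.restrict_mono hu le_rfl)
    rw [aestronglyMeasurable_union_iff]
    constructor
    · refine ContinuousOn.aestronglyMeasurable (ContinuousOn.congr (f := f)
        (hf.mono Ioo_subset_Icc_self) fun x hx => ?_) measurableSet_Ioo
      simp [hx.1]
    · refine ContinuousOn.aestronglyMeasurable (ContinuousOn.congr (f := h)
        (hh.mono Ioc_subset_Icc_self) fun x hx => ?_) measurableSet_Ioc
      simp [not_lt.2 hx.2]
  · obtain ⟨C, hC⟩ := isCompact_Icc.exists_bound_of_continuousOn hf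
    obtain ⟨D, hD⟩ := isCompact_Icc.exists_bound_of_continuousOn hh
    refine ⟨max C D, fun x hx => ?_⟩
    rcases lt_or_ge 0 x with h | h
    · simpa [h] using Or.inl (hC x ⟨h.le, hx.2.le⟩)
    · simpa [not_lt.2 h] using Or.inr (hD x ⟨hx.1.le, h⟩)

theorem integrable (hc : IsCoef a b c) (hf : MemLp f 2 (volume.restrict (Ioo a b)))
    (hh : MemLp h 2 (volume.restrict (Ioo a b))) :
    Integrable (fun x => c x * (f x * h x)) (volume.restrict (Ioo a b)) := by
  obtain ⟨C, hC⟩ := hc.2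
  exact Integrable.bdd_mul (c := C) (hf.integrable_mul hh) hc.1
    (ae_restrict_of_forall_mem measurableSet_Ioo hC)

end IsCoef

/-- A positive lower bound for functions that are continuous and positive up to the boundary on both
sides of `0`. -/
theorem exists_pos_lower_ite {a b : ℝ} {f h : ℝ → ℝ}
    (hf : ContinuousOn f (Icc 0 b)) (hh : ContinuousOn h (Icc a 0)) (hfp : ∀ x ∈ Icc 0 b, 0 < f x)
    (hhp : ∀ x ∈ Icc a 0, 0 < h x) :
    ∃ m > 0, ∀ s ∈ Icc a b, m ≤ if 0 < s then f s else h s := by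
  obtain ⟨m, hm, hm'⟩ := isCompact_Icc.exists_forall_le' hf hfp
  obtain ⟨k, hk, hk'⟩ := isCompact_Icc.exists_forall_le' hh hhp
  refine ⟨min m k, lt_min hm hk, fun s hs => ?_⟩
  split_ifs with h
  · exact (min_le_left _ _).trans (hm' s ⟨h.le, hs.2⟩)
  · exact (min_le_right _ _).trans (hk' s ⟨hs.1, not_lt.1 h⟩)

namespace RTData

variable {p : RTData}

namespace Valid

theorem upperFacts (hv : p.Valid) : SideFacts p.g 0 p.hp p.Pp p.ρp :=
  sideFacts_of hv.g_pos hv.hp_pos hv.Pp_smooth hv.Pp_mono hv.ρp_smooth hv.ρp_lower hv.hydro_p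

theorem lowerFacts (hv : p.Valid) : SideFacts p.g p.hm 0 p.Pm p.ρm :=
  sideFacts_of hv.g_pos hv.hm_neg hv.Pm_smooth hv.Pm_mono hv.ρm_smooth hv.ρm_lower hv.hydro_m

theorem lt (hv : p.Valid) : p.hm < p.hp := hv.hm_neg.trans hv.hp_pos

theorem zero_mem (hv : p.Valid) : (0 : ℝ) ∈ Icc p.hm p.hp := ⟨hv.hm_neg.le, hv.hp_pos.le⟩

theorem isCoef_rho (hv : p.Valid) : IsCoef p.hm p.hp p.rho :=
  IsCoef.ite hv.upperFacts.contDiffOn.continuousOn hv.lowerFacts.contDiffOn.continuousOn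

theorem isCoef_dP (hv : p.Valid) : IsCoef p.hm p.hp p.dP :=
  IsCoef.ite hv.upperFacts.dP_continuousOn hv.lowerFacts.dP_continuousOn

theorem isCoef_mu (_hv : p.Valid) : IsCoef p.hm p.hp p.mu :=
  IsCoef.ite continuousOn_const continuousOn_const

theorem isCoef_bulk (_hv : p.Valid) : IsCoef p.hm p.hp p.bulk :=
  IsCoef.ite continuousOn_const continuousOn_const

theorem rho_lower (hv : p.Valid) : ∃ m > 0, ∀ s ∈ Icc p.hm p.hp, m ≤ p.rho s :=
  exists_pos_lower_ite hv.upperFacts.contDiffOn.continuousOn hv.lowerFacts.contDiffOn.continuousOn hv.upperFacts.pos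
    hv.lowerFacts.pos

theorem rho_pos (hv : p.Valid) {s : ℝ} (hs : s ∈ Icc p.hm p.hp) : 0 < p.rho s := by
  obtain ⟨m, hm, h⟩ := hv.rho_lower
  exact hm.trans_le (h s hs)

theorem dP_pos (hv : p.Valid) {s : ℝ} (hs : s ∈ Icc p.hm p.hp) : 0 < p.dP s := by
  unfold dP
  split_ifs with h
  · exact hv.upperFacts.dP_pos s ⟨h.le, hs.2⟩
  · exact hv.lowerFacts.dP_pos s ⟨hs.1, not_lt.1 h⟩

theorem mu_pos (hv : p.Valid) (s : ℝ) : 0 < p.mu s := by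
  unfold mu; split_ifs; exacts [hv.μp_pos, hv.μm_pos]

theorem bulk_pos (hv : p.Valid) (s : ℝ) : 0 < p.bulk s := by
  unfold bulk; split_ifs; exacts [hv.ςp_pos, hv.ςm_pos]

theorem mu_lower (hv : p.Valid) : ∃ m > 0, ∀ s, m ≤ p.mu s := by
  refine ⟨min p.μp p.μm, lt_min hv.μp_pos hv.μm_pos, fun s => ?_⟩
  unfold mu; split_ifs; exacts [min_le_left _ _, min_le_right _ _]

end Valid

end RTData

/-! ### Quadratic forms on `H₀¹(a,b)³` -/

/-- Triples `u = (φ, θ, ψ)` of functions in `H₀¹(a,b)`. -/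
def H3 (a b : ℝ) (u : Fin 3 → ℝ → ℝ) : Prop := ∀ i, MemH10 a b (u i)

/-- The sum `u + t v`. -/
def addMul (u : Fin 3 → ℝ → ℝ) (t : ℝ) (v : Fin 3 → ℝ → ℝ) : Fin 3 → ℝ → ℝ :=
  fun i x => u i x + t * v i x

/-- The squared `H₀¹` norm `∫ |u'|²`. -/
def gradSq (a b : ℝ) (u : Fin 3 → ℝ → ℝ) : ℝ := ∑ i, ∫ x in Ioo a b, deriv (u i) x ^ 2

/-- The tangential part `ξ₁φ + ξ₂θ` of the divergence. -/
def tang (ξ : EuclideanSpace ℝ (Fin 2)) (u : Fin 3 → ℝ → ℝ) (x : ℝ) : ℝ :=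
  ξ 0 * u 0 x + ξ 1 * u 1 x

/-- The divergence `ξ₁φ + ξ₂θ + ψ'`. -/
def dvg (ξ : EuclideanSpace ℝ (Fin 2)) (u : Fin 3 → ℝ → ℝ) (x : ℝ) : ℝ :=
  tang ξ u x + deriv (u 2) x

/-- The coefficients of a quadratic form of the type of `E`, `D`, `F` and `𝒥`: `α` stands before the
gravity term, `β` before the square of the divergence, `γ` before the shear terms, `δ` before
`φ² + θ² + ψ²`, and `-κ` before `ψ(0)²`. -/
structure FormCoef where
  α : ℝ → ℝ
  β : ℝ → ℝ
  γ : ℝ → ℝ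
  δ : ℝ → ℝ
  κ : ℝ

namespace FormCoef

/-- The integrand of the symmetric bilinear form. -/
def integrand (q : FormCoef) (ξ : EuclideanSpace ℝ (Fin 2)) (u v : Fin 3 → ℝ → ℝ) (x : ℝ) : ℝ :=
  q.α x * (tang ξ u x * v 2 x) + q.α x * (u 2 x * tang ξ v x)
  + q.β x * (dvg ξ u x * dvg ξ v x)
  + q.γ x * ((ξ 1 * u 0 x - ξ 0 * u 1 x) * (ξ 1 * v 0 x - ξ 0 * v 1 x))
  + q.γ x * ((deriv (u 0) x - ξ 0 * u 2 x) * (deriv (v 0) x - ξ 0 * v 2 x))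
  + q.γ x * ((deriv (u 1) x - ξ 1 * u 2 x) * (deriv (v 1) x - ξ 1 * v 2 x))
  + q.γ x * ((tang ξ u x - deriv (u 2) x) * (tang ξ v x - deriv (v 2) x))
  + q.γ x * (dvg ξ u x * (dvg ξ v x / 3))
  + q.δ x * (u 0 x * v 0 x) + q.δ x * (u 1 x * v 1 x) + q.δ x * (u 2 x * v 2 x)

/-- The symmetric bilinear form on `(a,b)`. -/
def form (q : FormCoef) (a b : ℝ) (ξ : EuclideanSpace ℝ (Fin 2)) (u v : Fin 3 → ℝ → ℝ) : ℝ :=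
  (∫ x in Ioo a b, q.integrand ξ u v x) - q.κ * (u 2 0 * v 2 0)

/-- Boundedness and measurability of all coefficients. -/
structure Good (q : FormCoef) (a b : ℝ) : Prop where
  α : IsCoef a b q.α
  β : IsCoef a b q.β
  γ : IsCoef a b q.γ
  δ : IsCoef a b q.δ

/-- Linear combination of coefficients. -/
def comb (q : FormCoef) (t : ℝ) (r : FormCoef) : FormCoef :=
  ⟨fun x => q.α x + t * r.α x, fun x => q.β x + t * r.β x, fun x => q.γ x + t * r.γ x,
    fun x => q.δ x + t * r.δ x, q.κ + t * r.κ⟩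

end FormCoef

section

variable {a b : ℝ} {ξ : EuclideanSpace ℝ (Fin 2)} {u v w : Fin 3 → ℝ → ℝ} {q r : FormCoef}

theorem H3.addMul (hu : H3 a b u) (hv : H3 a b v) (t : ℝ) : H3 a b (addMul u t v) :=
  fun i => (hu i).add_mul (hv i) t

theorem H3.memLp_tang (hab : a ≤ b) (hu : H3 a b u) :
    MemLp (tang ξ u) 2 (volume.restrict (Ioo a b)) :=
  (((hu 0).memLp hab).const_mul (ξ 0)).add (((hu 1).memLp hab).const_mul (ξ 1))

theorem H3.memLp_dvg (hab : a ≤ b) (hu : H3 a b u) :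
    MemLp (dvg ξ u) 2 (volume.restrict (Ioo a b)) := (hu.memLp_tang hab).add (hu 2).2.1

namespace FormCoef

theorem Good.comb (hq : q.Good a b) (hr : r.Good a b) (t : ℝ) : (q.comb t r).Good a b :=
  ⟨hq.α.add (hr.α.const_mul t), hq.β.add (hr.β.const_mul t), hq.γ.add (hr.γ.const_mul t),
    hq.δ.add (hr.δ.const_mul t)⟩

theorem Good.integrable (hab : a ≤ b) (hq : q.Good a b) (hu : H3 a b u) (hv : H3 a b v) :
    Integrable (q.integrand ξ u v) (volume.restrict (Ioo a b)) := by
  have m : ∀ {w : Fin 3 → ℝ → ℝ}, H3 a b w → ∀ i, MemLp (w i) 2 (volume.restrict (Ioo a b)) :=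
    fun h i => (h i).memLp hab
  have hs : ∀ {w : Fin 3 → ℝ → ℝ}, H3 a b w →
      MemLp (fun x => ξ 1 * w 0 x - ξ 0 * w 1 x) 2 (volume.restrict (Ioo a b)) :=
    fun h => ((m h 0).const_mul _).sub ((m h 1).const_mul _)
  have h0 : ∀ {w : Fin 3 → ℝ → ℝ}, H3 a b w → ∀ (i : Fin 3) (t : ℝ),
      MemLp (fun x => deriv (w i) x - t * w 2 x) 2 (volume.restrict (Ioo a b)) :=
    fun h i t => (h i).2.1.sub ((m h 2).const_mul _)
  have h3 : ∀ {w : Fin 3 → ℝ → ℝ}, H3 a b w →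
      MemLp (fun x => tang ξ w x - deriv (w 2) x) 2 (volume.restrict (Ioo a b)) :=
    fun h => (h.memLp_tang hab).sub (h 2).2.1
  have h4 : MemLp (fun x => dvg ξ v x / 3) 2 (volume.restrict (Ioo a b)) := by
    simpa [div_eq_inv_mul] using (hv.memLp_dvg (ξ := ξ) hab).const_mul 3⁻¹
  exact (((((((((((hq.α.integrable (hu.memLp_tang hab) (m hv 2)).add
    (hq.α.integrable (m hu 2) (hv.memLp_tang hab)))).add
    (hq.β.integrable (hu.memLp_dvg hab) (hv.memLp_dvg hab))).add
    (hq.γ.integrable (hs hu) (hs hv))).add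
    (hq.γ.integrable (h0 hu 0 _) (h0 hv 0 _))).add
    (hq.γ.integrable (h0 hu 1 _) (h0 hv 1 _))).add
    (hq.γ.integrable (h3 hu) (h3 hv))).add
    (hq.γ.integrable (hu.memLp_dvg hab) h4)).add
    (hq.δ.integrable (m hu 0) (m hv 0))).add
    (hq.δ.integrable (m hu 1) (m hv 1))).add
    (hq.δ.integrable (m hu 2) (m hv 2))

theorem integrand_comm (x : ℝ) : q.integrand ξ u v x = q.integrand ξ v u x := by
  unfold integrand; ring

theorem form_comm : q.form a b ξ u v = q.form a b ξ v u := by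
  unfold form
  rw [mul_comm (u 2 0)]
  simp_rw [integrand_comm (u := u) (v := v)]

theorem Good.form_addMul (hab : a ≤ b) (hq : q.Good a b) (hu : H3 a b u) (hv : H3 a b v)
    (hw : H3 a b w) (t : ℝ) :
    q.form a b ξ (addMul u t v) w = q.form a b ξ u w + t * q.form a b ξ v w := by
  have e : q.integrand ξ (addMul u t v) w =ᵐ[volume.restrict (Ioo a b)]
      fun x => q.integrand ξ u w x + t * q.integrand ξ v w x := by
    filter_upwards [(hu 0).deriv_add_mul (hv 0) t, (hu 1).deriv_add_mul (hv 1) t,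
      (hu 2).deriv_add_mul (hv 2) t] with x h0 h1 h2
    change deriv (addMul u t v 0) x = _ at h0
    change deriv (addMul u t v 1) x = _ at h1
    change deriv (addMul u t v 2) x = _ at h2
    simp only [integrand, dvg, tang, h0, h1, h2]
    simp only [addMul]
    ring
  unfold form
  rw [integral_congr_ae e, integral_add (hq.integrable hab hu hw)
    ((hq.integrable hab hv hw).const_mul t), integral_const_mul]
  simp only [addMul]
  ring

theorem Good.form_self_addMul (hab : a ≤ b) (hq : q.Good a b) (hu : H3 a b u) (hv : H3 a b v)
    (t : ℝ) :
    q.form a b ξ (addMul u t v) (addMul u t v)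
      = q.form a b ξ u u + 2 * t * q.form a b ξ u v + t ^ 2 * q.form a b ξ v v := by
  rw [hq.form_addMul hab hu hv (hu.addMul hv t), form_comm, hq.form_addMul hab hu hv hu,
    form_comm (u := v) (v := addMul u t v), hq.form_addMul hab hu hv hv,
    form_comm (u := v) (v := u)]
  ring

theorem Good.form_comb (hab : a ≤ b) (hq : q.Good a b) (hr : r.Good a b) (hu : H3 a b u)
    (hv : H3 a b v) (t : ℝ) :
    (q.comb t r).form a b ξ u v = q.form a b ξ u v + t * r.form a b ξ u v := by
  have e : (q.comb t r).integrand ξ u v = fun x => q.integrand ξ u v x + t * r.integrand ξ u v x := by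
    funext x
    simp only [integrand, FormCoef.comb]
    ring
  unfold form
  rw [e, integral_add (hq.integrable hab hu hv)
    ((hr.integrable hab hu hv).const_mul t), integral_const_mul]
  simp only [FormCoef.comb]
  ring

end FormCoef

theorem gradSq_nonneg : 0 ≤ gradSq a b u :=
  Finset.sum_nonneg fun _ _ => integral_nonneg fun _ => sq_nonneg _

theorem H3.integral_sq_le (hab : a ≤ b) (hu : H3 a b u) (i : Fin 3) :
    ∫ x in Ioo a b, u i x ^ 2 ≤ (b - a) ^ 2 * ∫ x in Ioo a b, deriv (u i) x ^ 2 := by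
  have h : ∫ x in Ioo a b, u i x ^ 2
      ≤ ∫ _x in Ioo a b, (b - a) * ∫ x in Ioo a b, deriv (u i) x ^ 2 :=
    setIntegral_mono_on ((hu i).memLp hab).integrable_sq (integrable_const _) measurableSet_Ioo
      fun x hx => (hu i).sq_le hab (Ioo_subset_Icc_self hx)
  refine h.trans (le_of_eq ?_)
  rw [setIntegral_const]
  simp [hab]
  ring

theorem integral_deriv_sq_le_gradSq (i : Fin 3) :
    ∫ x in Ioo a b, deriv (u i) x ^ 2 ≤ gradSq a b u :=
  Finset.single_le_sum (f := fun i => ∫ x in Ioo a b, deriv (u i) x ^ 2)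
    (fun _ _ => integral_nonneg fun _ => sq_nonneg _) (Finset.mem_univ i)

theorem cauchy_three (x y z r s t : ℝ) :
    (x * r + y * s + z * t) ^ 2 ≤ (x ^ 2 + y ^ 2 + z ^ 2) * (r ^ 2 + s ^ 2 + t ^ 2) := by
  nlinarith [sq_nonneg (x * s - y * r), sq_nonneg (x * t - z * r), sq_nonneg (y * t - z * s)]

theorem abs_four_terms_le {α β γ δ A B G D T X Y Z x y z : ℝ} (hA : |α| ≤ A) (hB : |β| ≤ B)
    (hG : |γ| ≤ G) (hD : |δ| ≤ D) (hT : |T| ≤ x) (hX0 : 0 ≤ X) (hX : X ≤ x) (hY0 : 0 ≤ Y)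
    (hY : Y ≤ y) (hZ0 : 0 ≤ Z) (hZ : Z ≤ z) :
    |2 * α * T + β * X + γ * Y + δ * Z| ≤ 2 * A * x + B * x + G * y + D * z := by
  have h : ∀ {c C t r : ℝ}, |c| ≤ C → |t| ≤ r → |c * t| ≤ C * r := fun h1 h2 => by
    rw [abs_mul]
    exact mul_le_mul h1 h2 (abs_nonneg _) ((abs_nonneg _).trans h1)
  have h1 := abs_le.1 (h hA hT)
  have h2 := abs_le.1 (h hB ((abs_of_nonneg hX0).trans_le hX))
  have h3 := abs_le.1 (h hG ((abs_of_nonneg hY0).trans_le hY))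
  have h4 := abs_le.1 (h hD ((abs_of_nonneg hZ0).trans_le hZ))
  rw [abs_le]
  constructor <;> linarith [h1.1, h1.2, h2.1, h2.2, h3.1, h3.2, h4.1, h4.2]

namespace FormCoef

/-- The forms are bounded in `H₀¹`. -/
theorem Good.exists_bound (hlt : a < b) (h0 : (0 : ℝ) ∈ Icc a b) (hq : q.Good a b) :
    ∃ C, 0 ≤ C ∧ ∀ u, H3 a b u → |q.form a b ξ u u| ≤ C * gradSq a b u := by
  obtain ⟨A, hA⟩ := hq.α.2
  obtain ⟨B, hB⟩ := hq.β.2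
  obtain ⟨G, hG⟩ := hq.γ.2
  obtain ⟨D, hD⟩ := hq.δ.2
  have hab := hlt.le
  have hx0 : (a + b) / 2 ∈ Ioo a b := ⟨by linarith, by linarith⟩
  have A0 := (abs_nonneg _).trans (hA _ hx0)
  have B0 := (abs_nonneg _).trans (hB _ hx0)
  have G0 := (abs_nonneg _).trans (hG _ hx0)
  have D0 := (abs_nonneg _).trans (hD _ hx0)
  set K := ξ 0 ^ 2 + ξ 1 ^ 2 + 1 with hK
  have K1 : 1 ≤ K := by nlinarith [sq_nonneg (ξ 0), sq_nonneg (ξ 1)]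
  set C := 2 * A * K + B * K + 5 * G * K + D with hC
  have C0 : 0 ≤ C := by positivity
  have hpt : ∀ (u : Fin 3 → ℝ → ℝ) (x : ℝ), x ∈ Ioo a b → |q.integrand ξ u u x|
      ≤ C * (∑ i, u i x ^ 2 + ∑ i, deriv (u i) x ^ 2) := by
    intro u x hx
    set S := ∑ i, u i x ^ 2 + ∑ i, deriv (u i) x ^ 2 with hS
    rw [Fin.sum_univ_three, Fin.sum_univ_three] at hS
    have p0 := sq_nonneg (u 0 x)
    have p1 := sq_nonneg (u 1 x)
    have p2 := sq_nonneg (u 2 x)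
    have p3 := sq_nonneg (deriv (u 0) x)
    have p4 := sq_nonneg (deriv (u 1) x)
    have p5 := sq_nonneg (deriv (u 2) x)
    have S0 : 0 ≤ S := by rw [hS]; positivity
    have KS : S ≤ K * S := le_mul_of_one_le_left S0 K1
    have bd : ∀ l m r s t z : ℝ, l ^ 2 + m ^ 2 + r ^ 2 ≤ K → s ^ 2 + t ^ 2 + z ^ 2 ≤ S →
        (l * s + m * t + r * z) ^ 2 ≤ K * S := fun l m r s t z h1 h2 =>
      (cauchy_three l m r s t z).trans (mul_le_mul h1 h2 (by positivity) (by positivity))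
    have t1 : (tang ξ u x) ^ 2 ≤ K * S := by
      have := bd (ξ 0) (ξ 1) 0 (u 0 x) (u 1 x) 0 (by linarith [sq_nonneg (ξ 0), sq_nonneg (ξ 1)]) (by linarith [sq_nonneg (ξ 0), sq_nonneg (ξ 1)])
      simpa [tang] using this
    have t2 : (dvg ξ u x) ^ 2 ≤ K * S := by
      have := bd (ξ 0) (ξ 1) 1 (u 0 x) (u 1 x) (deriv (u 2) x) (by linarith [sq_nonneg (ξ 0), sq_nonneg (ξ 1)]) (by linarith [sq_nonneg (ξ 0), sq_nonneg (ξ 1)])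
      simpa [tang, dvg] using this
    have t3 : (ξ 1 * u 0 x - ξ 0 * u 1 x) ^ 2 ≤ K * S := by
      have := bd (ξ 1) (-ξ 0) 0 (u 0 x) (u 1 x) 0 (by linarith [sq_nonneg (ξ 0), sq_nonneg (ξ 1)]) (by linarith [sq_nonneg (ξ 0), sq_nonneg (ξ 1)])
      simpa [sub_eq_add_neg] using this
    have t4 : (deriv (u 0) x - ξ 0 * u 2 x) ^ 2 ≤ K * S := by
      have := bd 1 (-ξ 0) 0 (deriv (u 0) x) (u 2 x) 0 (by linarith [sq_nonneg (ξ 0), sq_nonneg (ξ 1)]) (by linarith [sq_nonneg (ξ 0), sq_nonneg (ξ 1)])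
      simpa [sub_eq_add_neg] using this
    have t5 : (deriv (u 1) x - ξ 1 * u 2 x) ^ 2 ≤ K * S := by
      have := bd 1 (-ξ 1) 0 (deriv (u 1) x) (u 2 x) 0 (by linarith [sq_nonneg (ξ 0), sq_nonneg (ξ 1)]) (by linarith [sq_nonneg (ξ 0), sq_nonneg (ξ 1)])
      simpa [sub_eq_add_neg] using this
    have t6 : (tang ξ u x - deriv (u 2) x) ^ 2 ≤ K * S := by
      have := bd (ξ 0) (ξ 1) (-1) (u 0 x) (u 1 x) (deriv (u 2) x) (by linarith [sq_nonneg (ξ 0), sq_nonneg (ξ 1)]) (by linarith [sq_nonneg (ξ 0), sq_nonneg (ξ 1)])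
      simpa [tang, sub_eq_add_neg] using this
    have t7 : |tang ξ u x * u 2 x| ≤ K * S := by
      rw [abs_le]
      constructor <;>
        nlinarith [sq_nonneg (tang ξ u x - u 2 x), sq_nonneg (tang ξ u x + u 2 x)]
    have e : q.integrand ξ u u x = 2 * q.α x * (tang ξ u x * u 2 x) + q.β x * dvg ξ u x ^ 2
        + q.γ x * ((ξ 1 * u 0 x - ξ 0 * u 1 x) ^ 2 + (deriv (u 0) x - ξ 0 * u 2 x) ^ 2
          + (deriv (u 1) x - ξ 1 * u 2 x) ^ 2 + (tang ξ u x - deriv (u 2) x) ^ 2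
          + dvg ξ u x ^ 2 / 3) + q.δ x * (u 0 x ^ 2 + u 1 x ^ 2 + u 2 x ^ 2) := by
      unfold integrand; ring
    rw [e]
    refine (abs_four_terms_le (hA x hx) (hB x hx) (hG x hx) (hD x hx) t7 (sq_nonneg _) t2
      (by positivity) (y := 5 * (K * S)) (by linarith [sq_nonneg (dvg ξ u x)])
      (by positivity) (z := S) (by linarith)).trans (le_of_eq ?_)
    rw [hC]
    ring
  refine ⟨C * ((b - a) ^ 2 + 1) + |q.κ| * (b - a), ?_, fun u hu => ?_⟩
  · have := abs_nonneg q.κ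
    have : 0 ≤ b - a := by linarith
    positivity
  have hi : Integrable (fun x => C * (∑ i, u i x ^ 2 + ∑ i, deriv (u i) x ^ 2))
      (volume.restrict (Ioo a b)) :=
    ((integrable_finsetSum _ fun i _ => ((hu i).memLp hab).integrable_sq).add
      (integrable_finsetSum _ fun i _ => (hu i).2.1.integrable_sq)).const_mul C
  have s1 : |∫ x in Ioo a b, q.integrand ξ u u x| ≤ C * ((b - a) ^ 2 + 1) * gradSq a b u := by
    refine (norm_integral_le_of_norm_le hi (ae_restrict_of_forall_mem measurableSet_Ioo
      fun x hx => (Real.norm_eq_abs _).trans_le (hpt u x hx))).trans ?_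
    rw [integral_const_mul, integral_add
      (integrable_finsetSum _ fun i _ => ((hu i).memLp hab).integrable_sq)
      (integrable_finsetSum _ fun i _ => (hu i).2.1.integrable_sq),
      integral_finsetSum _ fun i _ => ((hu i).memLp hab).integrable_sq,
      integral_finsetSum _ fun i _ => (hu i).2.1.integrable_sq, mul_assoc]
    refine mul_le_mul_of_nonneg_left ?_ C0
    rw [add_mul, one_mul]
    refine add_le_add ?_ le_rfl
    rw [gradSq, Finset.mul_sum]
    exact Finset.sum_le_sum fun i _ => hu.integral_sq_le hab i
  have s2 : |q.κ * (u 2 0 * u 2 0)| ≤ |q.κ| * (b - a) * gradSq a b u := by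
    rw [abs_mul, ← sq, abs_of_nonneg (sq_nonneg (u 2 0)), mul_assoc]
    refine mul_le_mul_of_nonneg_left (((hu 2).sq_le hab h0).trans ?_) (abs_nonneg _)
    exact mul_le_mul_of_nonneg_left (integral_deriv_sq_le_gradSq 2) (by linarith)
  unfold form
  refine (abs_sub _ _).trans ?_
  linarith

end FormCoef

end

/-! ### The direct method -/

section

variable {a b : ℝ} {ξ : EuclideanSpace ℝ (Fin 2)} {u v w : Fin 3 → ℝ → ℝ} {q r : FormCoef}

theorem deriv_addMul_ae (hu : H3 a b u) (hv : H3 a b v) (t : ℝ) (i : Fin 3) :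
    deriv (addMul u t v i) =ᵐ[volume.restrict (Ioo a b)]
      fun x => deriv (u i) x + t * deriv (v i) x := (hu i).deriv_add_mul (hv i) t

theorem gradSq_addMul_le (hu : H3 a b u) (hv : H3 a b v) (t : ℝ) :
    gradSq a b (addMul u t v) ≤ 2 * gradSq a b u + 2 * t ^ 2 * gradSq a b v := by
  unfold gradSq
  rw [Finset.mul_sum, Finset.mul_sum, ← Finset.sum_add_distrib]
  refine Finset.sum_le_sum fun i _ => ?_
  rw [← integral_const_mul, ← integral_const_mul, ← integral_add
    ((hu i).2.1.integrable_sq.const_mul _) ((hv i).2.1.integrable_sq.const_mul _)]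
  refine integral_mono_ae (hu.addMul hv t i).2.1.integrable_sq
    (((hu i).2.1.integrable_sq.const_mul _).add ((hv i).2.1.integrable_sq.const_mul _)) ?_
  filter_upwards [deriv_addMul_ae hu hv t i] with x hx
  simp only [hx]
  nlinarith [sq_nonneg (deriv (u i) x - t * deriv (v i) x)]

theorem addMul_sub_cancel : addMul u 1 (addMul v (-1) u) = v := by
  funext i x; simp [addMul]

namespace FormCoef

/-- The bilinear form, bounded by polarization at `u ± t v`; a large weight `t` makes the part of `u`
small. -/
theorem Good.abs_polar_le (hlt : a < b) (hq : q.Good a b) {C : ℝ}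
    (hC : ∀ u, H3 a b u → |q.form a b ξ u u| ≤ C * gradSq a b u) (hC0 : 0 ≤ C)
    (hu : H3 a b u) (hv : H3 a b v) {t : ℝ} (ht : 0 < t) :
    |2 * q.form a b ξ u v| ≤ 2 * C / t * gradSq a b u + 2 * C * t * gradSq a b v := by
  have e1 := hq.form_self_addMul (ξ := ξ) hlt.le hu hv t
  have e2 := hq.form_self_addMul (ξ := ξ) hlt.le hu hv (-t)
  have b1 := hC _ (hu.addMul hv t)
  have b2 := hC _ (hu.addMul hv (-t))
  have g1 := mul_le_mul_of_nonneg_left (gradSq_addMul_le hu hv t) hC0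
  have g2 := mul_le_mul_of_nonneg_left (gradSq_addMul_le hu hv (-t)) hC0
  have : |2 * t * (2 * q.form a b ξ u v)|
      ≤ 2 * (C * (2 * gradSq a b u + 2 * t ^ 2 * gradSq a b v)) := by
    have e : 2 * t * (2 * q.form a b ξ u v) = q.form a b ξ (_root_.addMul u t v) (_root_.addMul u t v)
      - q.form a b ξ (_root_.addMul u (-t) v) (_root_.addMul u (-t) v) := by rw [e1, e2]; ring
    rw [e]
    refine (abs_sub _ _).trans ?_
    rw [neg_sq] at g2
    linarith
  rw [abs_mul, abs_of_pos (by positivity : 0 < 2 * t)] at this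
  have h2 : 2 * C / t * gradSq a b u + 2 * C * t * gradSq a b v
      = (2 * (C * (2 * gradSq a b u + 2 * t ^ 2 * gradSq a b v))) / (2 * t) := by
    field_simp
  rw [h2, le_div_iff₀ (by positivity)]
  linarith

/-- Continuity of the forms along sequences that converge in `H₀¹`. -/
theorem Good.tendsto_form (hlt : a < b) (h0 : (0 : ℝ) ∈ Icc a b) (hq : q.Good a b)
    {v : ℕ → Fin 3 → ℝ → ℝ} (hv : ∀ n, H3 a b (v n)) (hu : H3 a b u)
    (hlim : Tendsto (fun n => gradSq a b (addMul (v n) (-1) u)) atTop (𝓝 0)) :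
    Tendsto (fun n => q.form a b ξ (v n) (v n)) atTop (𝓝 (q.form a b ξ u u)) := by
  obtain ⟨C, hC0, hC⟩ := hq.exists_bound (ξ := ξ) hlt h0
  rw [Metric.tendsto_atTop']
  intro ε hε
  set G := gradSq a b u
  have hG : 0 ≤ G := gradSq_nonneg
  set t := 4 * C * G / ε + 1 with ht
  have htp : 0 < t := by positivity
  have h1 : 2 * C / t * G < ε := by
    rw [div_mul_eq_mul_div, div_lt_iff₀ htp, ht, mul_add, mul_one, mul_div_cancel₀ _ hε.ne']
    nlinarith [mul_nonneg hC0 hG]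
  have h2 : Tendsto (fun n => 2 * C / t * G + (2 * C * t + C) * gradSq a b (addMul (v n) (-1) u))
      atTop (𝓝 (2 * C / t * G)) := by
    simpa using (hlim.const_mul (2 * C * t + C)).const_add (2 * C / t * G)
  obtain ⟨N, hN⟩ := eventually_atTop.1 (h2.eventually (gt_mem_nhds h1))
  refine ⟨N, fun n hn => ?_⟩
  refine lt_of_le_of_lt ?_ (hN n hn.le)
  have hw := (hv n).addMul hu (-1)
  have e := hq.form_self_addMul (ξ := ξ) hlt.le hu hw 1
  rw [addMul_sub_cancel] at e
  rw [Real.dist_eq, e]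
  have p := hq.abs_polar_le (ξ := ξ) hlt hC hC0 hu hw htp
  have s := hC _ hw
  calc _ = |2 * q.form a b ξ u (addMul (v n) (-1) u)
        + q.form a b ξ (addMul (v n) (-1) u) (addMul (v n) (-1) u)| := by congr 1; ring
    _ ≤ _ := abs_add_le _ _
    _ ≤ _ := by linarith

theorem Good.form_smul (hab : a ≤ b) (hq : q.Good a b) (hu : H3 a b u) (t : ℝ) :
    q.form a b ξ (addMul u (t - 1) u) (addMul u (t - 1) u) = t ^ 2 * q.form a b ξ u u := by
  rw [hq.form_self_addMul hab hu hu]; ring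

/-- The weight `δ` in front of `|u|²` and nothing else. -/
def mass (δ : ℝ → ℝ) : FormCoef := ⟨0, 0, 0, δ, 0⟩

theorem mass_form (δ : ℝ → ℝ) : (mass δ).form a b ξ u u
    = ∫ x in Ioo a b, δ x * (u 0 x ^ 2 + u 1 x ^ 2 + u 2 x ^ 2) := by
  simp only [form, mass, integrand, Pi.zero_apply, zero_mul, sub_zero]
  congr 1; funext x; ring

theorem good_mass {δ : ℝ → ℝ} (h : IsCoef a b δ) : (mass δ).Good a b :=
  ⟨IsCoef.const 0, IsCoef.const 0, IsCoef.const 0, h⟩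

end FormCoef

theorem exists_subseq_cauchy_three (hab : a ≤ b) {u : ℕ → Fin 3 → ℝ → ℝ} (hu : ∀ n, H3 a b (u n))
    {M : ℝ} (hM : ∀ n, gradSq a b (u n) ≤ M) :
    ∃ k : ℕ → ℕ, StrictMono k ∧ ∀ ε > 0, ∃ N, ∀ m ≥ N, ∀ n ≥ N, ∀ i, ∀ x ∈ Icc a b,
      |u (k m) i x - u (k n) i x| ≤ ε := by
  have hMi : ∀ n i, ∫ t in Ioo a b, deriv (u n i) t ^ 2 ≤ M := fun n i =>
    (integral_deriv_sq_le_gradSq i).trans (hM n)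
  obtain ⟨k0, hk0, h0⟩ := MemH10.exists_subseq_cauchy hab (fun n => hu n 0) fun n => hMi n 0
  obtain ⟨k1, hk1, h1⟩ := MemH10.exists_subseq_cauchy hab (fun n => hu (k0 n) 1)
    fun n => hMi (k0 n) 1
  obtain ⟨k2, hk2, h2⟩ := MemH10.exists_subseq_cauchy hab (fun n => hu (k0 (k1 n)) 2)
    fun n => hMi (k0 (k1 n)) 2
  refine ⟨fun n => k0 (k1 (k2 n)), hk0.comp (hk1.comp hk2), fun ε hε => ?_⟩
  obtain ⟨N0, h0⟩ := h0 ε hε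
  obtain ⟨N1, h1⟩ := h1 ε hε
  obtain ⟨N2, h2⟩ := h2 ε hε
  refine ⟨max N0 (max N1 N2), fun m hm n hn i x hx => ?_⟩
  simp only [ge_iff_le, max_le_iff] at hm hn
  fin_cases i
  · exact h0 _ (hm.1.trans ((hk1.comp hk2).le_apply (x := m))) _
      (hn.1.trans ((hk1.comp hk2).le_apply (x := n))) x hx
  · exact h1 _ (hm.2.1.trans (hk2.le_apply (x := m))) _ (hn.2.1.trans (hk2.le_apply (x := n))) x hx
  · exact h2 _ hm.2.2 _ hn.2.2 x hx

/-- Existence of minimizers of a coercive form under an `L²` constraint. The parallelogram identity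
turns the `L²` convergence of a subsequence of a minimizing sequence into convergence in `H₀¹`. -/
theorem exists_minimizer (hlt : a < b) (h0 : (0 : ℝ) ∈ Icc a b) (hq : q.Good a b) {δ : ℝ → ℝ}
    (hδ : IsCoef a b δ) (hδ0 : ∀ x ∈ Ioo a b, 0 ≤ δ x) {c : ℝ} (hc : 0 < c)
    (hcoer : ∀ u, H3 a b u → c * gradSq a b u ≤ q.form a b ξ u u)
    (hne : ∃ u, H3 a b u ∧ (FormCoef.mass δ).form a b ξ u u = 1) :
    ∃ u, H3 a b u ∧ (FormCoef.mass δ).form a b ξ u u = 1 ∧ ∀ v, H3 a b v →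
      (FormCoef.mass δ).form a b ξ v v = 1 → q.form a b ξ u u ≤ q.form a b ξ v v := by
  have hab := hlt.le
  set A : (Fin 3 → ℝ → ℝ) → ℝ := fun u => q.form a b ξ u u with hA
  set J : (Fin 3 → ℝ → ℝ) → ℝ := fun u => (FormCoef.mass δ).form a b ξ u u with hJ
  have hm := FormCoef.good_mass hδ
  set S : Set ℝ := {x | ∃ u, H3 a b u ∧ J u = 1 ∧ x = A u} with hS
  have A0 : ∀ u, H3 a b u → 0 ≤ A u := fun u hu =>
    (mul_nonneg hc.le gradSq_nonneg).trans (hcoer u hu)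
  have J0 : ∀ u, 0 ≤ J u := fun u => by
    simp only [hJ, FormCoef.mass_form]
    exact setIntegral_nonneg measurableSet_Ioo fun x hx => mul_nonneg (hδ0 x hx) (by positivity)
  have hbdd : BddBelow S := ⟨0, by rintro _ ⟨u, hu, -, rfl⟩; exact A0 u hu⟩
  have hSne : S.Nonempty := by
    obtain ⟨u, hu, hu1⟩ := hne
    exact ⟨_, u, hu, hu1, rfl⟩
  set m := sInf S with hmdef
  have hm0 : 0 ≤ m := le_csInf hSne (by rintro _ ⟨u, hu, -, rfl⟩; exact A0 u hu)
  have hhom : ∀ u, H3 a b u → m * J u ≤ A u := by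
    intro u hu
    rcases (J0 u).eq_or_lt with h | h
    · rw [← h, mul_zero]; exact A0 u hu
    · set t := (Real.sqrt (J u))⁻¹ with ht
      have ht2 : t ^ 2 = (J u)⁻¹ := by rw [ht, inv_pow, Real.sq_sqrt h.le]
      have h1 : J (addMul u (t - 1) u) = 1 := by
        simp only [hJ, hm.form_smul hab hu]
        rw [ht2]; exact inv_mul_cancel₀ h.ne'
      have h2 : m ≤ A (addMul u (t - 1) u) := csInf_le hbdd ⟨_, hu.addMul hu _, h1, rfl⟩
      simp only [hA, hq.form_smul hab hu] at h2
      rw [ht2, inv_mul_eq_div, le_div_iff₀ h] at h2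
      exact h2
  have hseq : ∀ n : ℕ, ∃ u, H3 a b u ∧ J u = 1 ∧ A u < m + 1 / (n + 1) := by
    intro n
    obtain ⟨_, ⟨u, hu, hu1, rfl⟩, hlt'⟩ := exists_lt_of_csInf_lt hSne
      (show sInf S < m + 1 / ((n : ℝ) + 1) by rw [← hmdef]; linarith [Nat.one_div_pos_of_nat (α := ℝ) (n := n)])
    exact ⟨u, hu, hu1, hlt'⟩
  choose u hu hu1 hum using hseq
  have hgr : ∀ n, gradSq a b (u n) ≤ (m + 1) / c := by
    intro n
    rw [le_div_iff₀ hc, mul_comm]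
    refine (hcoer _ (hu n)).trans ((hum n).le.trans ?_)
    have : 1 / ((n : ℝ) + 1) ≤ 1 := by
      rw [div_le_one (by positivity)]; linarith [Nat.cast_nonneg (α := ℝ) n]
    linarith
  obtain ⟨k, hk, hcau⟩ := exists_subseq_cauchy_three hab hu hgr
  set v : ℕ → Fin 3 → ℝ → ℝ := fun n => u (k n) with hvdef
  have hv : ∀ n, H3 a b (v n) := fun n => hu _
  have hv1 : ∀ n, J (v n) = 1 := fun n => hu1 _
  have hvm : Tendsto (fun n => A (v n)) atTop (𝓝 m) := by
    refine tendsto_of_tendsto_of_tendsto_of_le_of_le (g := fun _ => m)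
      (h := fun n : ℕ => m + 1 / ((k n : ℝ) + 1)) tendsto_const_nhds ?_ (fun n => ?_) fun n => (hum _).le
    · have := (tendsto_one_div_add_atTop_nhds_zero_nat (𝕜 := ℝ)).comp hk.tendsto_atTop
      simpa using this.const_add m
    · exact csInf_le hbdd ⟨_, hv n, hv1 n, rfl⟩
  obtain ⟨B, hB⟩ := hδ.2
  have hB0 : 0 ≤ B := (abs_nonneg _).trans (hB ((a + b) / 2) ⟨by linarith, by linarith⟩)
  -- the parallelogram identity for `A` and `J`: `A(vᵢ + vⱼ) ≥ m J(vᵢ + vⱼ) = m (4 - J(vᵢ - vⱼ))`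
  have hpar : ∀ i j, A (addMul (v i) (-1) (v j)) ≤ 2 * A (v i) + 2 * A (v j) - 4 * m
      + m * J (addMul (v i) (-1) (v j)) := by
    intro i j
    have e1 := hq.form_self_addMul (ξ := ξ) hab (hv i) (hv j) 1
    have e2 := hq.form_self_addMul (ξ := ξ) hab (hv i) (hv j) (-1)
    have e3 := hm.form_self_addMul (ξ := ξ) hab (hv i) (hv j) 1
    have e4 := hm.form_self_addMul (ξ := ξ) hab (hv i) (hv j) (-1)
    have h1 := hhom _ ((hv i).addMul (hv j) 1)
    have j1 := hv1 i
    have j2 := hv1 j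
    simp only [hA, hJ] at *
    rw [e1, e3, j1, j2] at h1
    rw [e2, e4, j1, j2]
    linarith
  have hJc : ∀ ε > 0, ∃ N, ∀ i ≥ N, ∀ j ≥ N, J (addMul (v i) (-1) (v j)) ≤ ε := by
    intro ε hε
    obtain ⟨N, hN⟩ := hcau (Real.sqrt (ε / (3 * B * (b - a) + 1)))
      (Real.sqrt_pos.2 (by have : 0 < b - a := by linarith
                           positivity))
    refine ⟨N, fun i hi j hj => ?_⟩
    have hpos : 0 < 3 * B * (b - a) + 1 := by
      have : 0 < b - a := by linarith
      positivity
    have hpt : ∀ x ∈ Ioo a b, ∀ l, addMul (v i) (-1) (v j) l x ^ 2 ≤ ε / (3 * B * (b - a) + 1) := by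
      intro x hx l
      have h := hN i hi j hj l x (Ioo_subset_Icc_self hx)
      have h' := pow_le_pow_left₀ (abs_nonneg _) h 2
      rw [sq_abs, Real.sq_sqrt (by positivity)] at h'
      simpa [addMul, sub_eq_add_neg] using h'
    simp only [hJ, FormCoef.mass_form]
    set η := ε / (3 * B * (b - a) + 1)
    have hη : 0 < η := by positivity
    have h1 : ‖∫ x in Ioo a b, δ x * (addMul (v i) (-1) (v j) 0 x ^ 2
        + addMul (v i) (-1) (v j) 1 x ^ 2 + addMul (v i) (-1) (v j) 2 x ^ 2)‖
        ≤ B * (3 * η) * volume.real (Ioo a b) := by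
      refine norm_setIntegral_le_of_norm_le_const (by simp) fun x hx => ?_
      rw [norm_mul]
      refine mul_le_mul (hB x hx) ?_ (norm_nonneg _) hB0
      rw [Real.norm_eq_abs, abs_of_nonneg (by positivity)]
      linarith [hpt x hx 0, hpt x hx 1, hpt x hx 2]
    refine (le_abs_self _).trans (h1.trans ?_)
    have h2 : volume.real (Ioo a b) = b - a := by simp [hab]
    rw [h2]
    have h3 : ε = η * (3 * B * (b - a) + 1) := by
      rw [div_mul_cancel₀ _ hpos.ne']
    rw [h3]
    nlinarith
  have hgc : ∀ ε > 0, ∃ N, ∀ i ≥ N, ∀ j ≥ N, gradSq a b (addMul (v i) (-1) (v j)) < ε := by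
    intro ε hε
    obtain ⟨N1, hN1⟩ := hJc (c * ε / (4 * (m + 1))) (by positivity)
    obtain ⟨N2, hN2⟩ := eventually_atTop.1 (hvm.eventually
      (gt_mem_nhds (show m < m + c * ε / 8 by have := mul_pos hc hε; linarith)))
    refine ⟨max N1 N2, fun i hi j hj => ?_⟩
    have h1 := hN1 i (le_of_max_le_left hi) j (le_of_max_le_left hj)
    have h2 := hN2 i (le_of_max_le_right hi)
    have h3 := hN2 j (le_of_max_le_right hj)
    have h4 := hpar i j
    have h5 := hcoer _ ((hv i).addMul (hv j) (-1))
    have h6 : m * J (addMul (v i) (-1) (v j)) ≤ c * ε / 4 := by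
      refine (mul_le_mul_of_nonneg_left h1 hm0).trans ?_
      rw [mul_div_assoc', div_le_div_iff₀ (by positivity) (by norm_num)]
      nlinarith [mul_pos hc hε]
    have : c * gradSq a b (addMul (v i) (-1) (v j)) < c * ε := by
      have := mul_pos hc hε
      simp only [hA] at *
      linarith
    exact lt_of_mul_lt_mul_left this hc.le
  have hlim : ∀ l, ∃ y, MemH10 a b y ∧
      Tendsto (fun n => ∫ x in Ioo a b, (deriv (v n l) x - deriv y x) ^ 2) atTop (𝓝 0) := by
    intro l
    refine MemH10.exists_limit hab (fun n => hv n l) fun ε hε => ?_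
    obtain ⟨N, hN⟩ := hgc ε hε
    refine ⟨N, fun i hi j hj => lt_of_le_of_lt (le_of_eq_of_le ?_
      (integral_deriv_sq_le_gradSq l)) (hN i hi j hj)⟩
    refine integral_congr_ae ?_
    filter_upwards [deriv_addMul_ae (hv i) (hv j) (-1) l] with x hx
    rw [hx]; ring
  choose y hy hylim using hlim
  have hglim : Tendsto (fun n => gradSq a b (addMul (v n) (-1) y)) atTop (𝓝 0) := by
    have h := tendsto_finsetSum Finset.univ fun l _ => hylim l
    simp only [Finset.sum_const_zero] at h
    refine h.congr fun n => Finset.sum_congr rfl fun l _ => integral_congr_ae ?_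
    filter_upwards [deriv_addMul_ae (hv n) hy (-1) l] with x hx
    rw [hx]; ring
  refine ⟨y, hy, ?_, fun z hz hz1 => ?_⟩
  · have h := hm.tendsto_form (ξ := ξ) hlt h0 hv hy hglim
    exact tendsto_nhds_unique h (tendsto_const_nhds.congr fun n => (hv1 n).symm)
  · have h := hq.tendsto_form (ξ := ξ) hlt h0 hv hy hglim
    rw [tendsto_nhds_unique h hvm]
    exact csInf_le hbdd ⟨z, hz, hz1, rfl⟩

end

/-! ### Energy estimates -/

theorem AbsolutelyContinuousOnInterval.ae_Ioo {c d : ℝ} {f : ℝ → ℝ} (hcd : c ≤ d)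
    (hf : AbsolutelyContinuousOnInterval f c d) :
    ∀ᵐ x ∂volume.restrict (Ioo c d), DifferentiableAt ℝ f x := by
  rw [ae_restrict_iff' measurableSet_Ioo]
  filter_upwards [hf.ae_differentiableAt] with x hx h
  exact hx (by rw [uIcc_of_le hcd]; exact Ioo_subset_Icc_self h)

/-- On one side of the interface, `∫ (g²ρψ²/P' - 2gρψψ')` is the boundary term of `-gρψ²`. -/
theorem SideFacts.integral_boundary {g c d : ℝ} {P ρ ψ : ℝ → ℝ} (hcd : c ≤ d)
    (hs : SideFacts g c d P ρ) (hψ : AbsolutelyContinuousOnInterval ψ c d) :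
    IntegrableOn (fun x => g ^ 2 * ρ x * ψ x ^ 2 / deriv P (ρ x) - 2 * g * ρ x * ψ x * deriv ψ x)
        (Ioo c d) ∧
      ∫ x in Ioo c d, (g ^ 2 * ρ x * ψ x ^ 2 / deriv P (ρ x) - 2 * g * ρ x * ψ x * deriv ψ x)
        = g * ρ c * ψ c ^ 2 - g * ρ d * ψ d ^ 2 := by
  have hρ : AbsolutelyContinuousOnInterval ρ c d :=
    ContDiffOn.absolutelyContinuousOnInterval
      ((uIcc_of_le hcd).symm ▸ hs.contDiffOn.of_le (by norm_num))
  have hac := (hρ.fun_mul (hψ.fun_mul hψ)).const_mul (-g)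
  have e : deriv (fun x => -g * (ρ x * (ψ x * ψ x))) =ᵐ[volume.restrict (Ioo c d)]
      fun x => g ^ 2 * ρ x * ψ x ^ 2 / deriv P (ρ x) - 2 * g * ρ x * ψ x * deriv ψ x := by
    filter_upwards [hψ.ae_Ioo hcd, ae_restrict_mem measurableSet_Ioo] with x hx hxI
    have hx' := Ioo_subset_Icc_self hxI
    have h1 := (hs.hasDeriv x hx').hasDerivAt (Icc_mem_nhds hxI.1 hxI.2)
    have h2 := ((h1.mul (hx.hasDerivAt.mul hx.hasDerivAt)).const_mul (-g)).deriv
    refine Eq.trans h2 ?_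
    have := (hs.dP_pos x hx').ne'
    simp only [Pi.mul_apply]
    field_simp
    ring
  have hi := (intervalIntegrable_iff_Ioo hcd).1 hac.intervalIntegrable_deriv
  refine ⟨(integrableOn_congr_fun_ae e).1 hi, ?_⟩
  rw [← integral_congr_ae e, ← intervalIntegral_eq_setIntegral_Ioo hcd, hac.integral_deriv_eq_sub]
  ring

theorem integrableOn_Ioo_split {a b : ℝ} {f : ℝ → ℝ} (ha : a < 0) (hb : 0 < b)
    (h1 : IntegrableOn f (Ioo a 0)) (h2 : IntegrableOn f (Ioo 0 b)) :
    IntegrableOn f (Ioo a b) ∧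
      ∫ x in Ioo a b, f x = (∫ x in Ioo a 0, f x) + ∫ x in Ioo 0 b, f x := by
  have i1 := (intervalIntegrable_iff_Ioo ha.le).2 h1
  have i2 := (intervalIntegrable_iff_Ioo hb.le).2 h2
  refine ⟨(intervalIntegrable_iff_Ioo (ha.trans hb).le).1 (i1.trans i2), ?_⟩
  rw [← intervalIntegral_eq_setIntegral_Ioo (ha.trans hb).le, ← intervalIntegral_eq_setIntegral_Ioo ha.le,
    ← intervalIntegral_eq_setIntegral_Ioo hb.le, intervalIntegral.integral_add_adjacent_intervals i1 i2]

theorem MemH10.ac_mono {a b c d : ℝ} {f : ℝ → ℝ} (hab : a ≤ b) (hcd : c ≤ d) (hac : a ≤ c)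
    (hdb : d ≤ b) (hf : MemH10 a b f) : AbsolutelyContinuousOnInterval f c d :=
  hf.1.mono (by rw [uIcc_of_le hab, uIcc_of_le hcd]; exact Icc_subset_Icc hac hdb)

/-- The trace inequality `ψ(0)² ≤ ε ∫ ψ'² + ε⁻¹ ∫ ψ²`. -/
theorem MemH10.sq_trace_le {a b : ℝ} {ψ : ℝ → ℝ} (ha : a < 0) (hb : 0 < b) (hψ : MemH10 a b ψ)
    {ε : ℝ} (hε : 0 < ε) :
    ψ 0 ^ 2 ≤ ε * (∫ x in Ioo a b, deriv ψ x ^ 2) + ε⁻¹ * ∫ x in Ioo a b, ψ x ^ 2 := by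
  have hab := (ha.trans hb).le
  have hac := hψ.ac_mono hab hb.le ha.le le_rfl
  have h1 := (hac.fun_mul hac).integral_deriv_eq_sub
  rw [hψ.2.2.2, intervalIntegral_eq_setIntegral_Ioo hb.le] at h1
  have e : deriv (fun x => ψ x * ψ x) =ᵐ[volume.restrict (Ioo 0 b)] fun x => 2 * (ψ x * deriv ψ x) := by
    filter_upwards [hac.ae_Ioo hb.le] with x hx
    refine Eq.trans (hx.hasDerivAt.mul hx.hasDerivAt).deriv ?_
    ring
  have hs : Ioo 0 b ⊆ Ioo a b := Ioo_subset_Ioo_left ha.le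
  have m1 := (hψ.memLp hab).integrable_sq
  have m2 := hψ.2.1.integrable_sq
  have hi : Integrable (fun x => ε * deriv ψ x ^ 2 + ε⁻¹ * ψ x ^ 2) (volume.restrict (Ioo a b)) :=
    (m2.const_mul _).add (m1.const_mul _)
  have hnn : ∀ x, 0 ≤ ε * deriv ψ x ^ 2 + ε⁻¹ * ψ x ^ 2 := fun x => by positivity
  rw [← integral_const_mul, ← integral_const_mul, ← integral_add (m2.const_mul _) (m1.const_mul _)]
  calc ψ 0 ^ 2 = -∫ x in Ioo 0 b, 2 * (ψ x * deriv ψ x) := by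
        rw [← integral_congr_ae e, h1]; ring
    _ = ∫ x in Ioo 0 b, -(2 * (ψ x * deriv ψ x)) := (integral_neg _).symm
    _ ≤ ∫ x in Ioo 0 b, (ε * deriv ψ x ^ 2 + ε⁻¹ * ψ x ^ 2) := by
        refine integral_mono (((memLp_two_mono (hψ.memLp hab) hs).integrable_mul
          (memLp_two_mono hψ.2.1 hs)).const_mul 2).neg (hi.mono_measure
            (Measure.restrict_mono hs le_rfl)) fun x => ?_
        have : ε * deriv ψ x ^ 2 + ε⁻¹ * ψ x ^ 2 + 2 * (ψ x * deriv ψ x)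
            = ε⁻¹ * (ε * deriv ψ x + ψ x) ^ 2 := by field_simp; ring
        have h2 : 0 ≤ ε⁻¹ * (ε * deriv ψ x + ψ x) ^ 2 := by positivity
        change -(2 * (ψ x * deriv ψ x)) ≤ _
        linarith
    _ ≤ _ := setIntegral_mono_set hi (Eventually.of_forall hnn) hs.eventuallyLE

/-- Lipschitz functions with zero boundary values are in `H₀¹`. -/
theorem MemH10.of_lipschitzOn {a b : ℝ} {f : ℝ → ℝ} (hab : a ≤ b) {K : NNReal}
    (hf : LipschitzOnWith K f (Icc a b)) (ha : f a = 0) (hb : f b = 0) : MemH10 a b f := by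
  refine ⟨LipschitzOnWith.absolutelyContinuousOnInterval (by rwa [uIcc_of_le hab]), ?_, ha, hb⟩
  refine MemLp.of_bound (C := K) (measurable_deriv f).aestronglyMeasurable ?_
  refine ae_restrict_of_forall_mem measurableSet_Ioo fun x hx => ?_
  exact norm_deriv_le_of_lipschitzOn (Icc_mem_nhds hx.1 hx.2) hf

theorem LipschitzOnWith.glue {a c b : ℝ} {f : ℝ → ℝ} {K L : NNReal}
    (h1 : LipschitzOnWith K f (Icc a c)) (h2 : LipschitzOnWith L f (Icc c b)) :
    LipschitzOnWith (max K L) f (Icc a b) := by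
  have key : ∀ x ∈ Icc a b, ∀ y ∈ Icc a b, x ≤ y → dist (f x) (f y) ≤ (max K L : NNReal) * dist x y := by
    intro x hx y hy hxy
    have m1 : (K : ℝ) ≤ (max K L : NNReal) := by exact_mod_cast le_max_left _ _
    have m2 : (L : ℝ) ≤ (max K L : NNReal) := by exact_mod_cast le_max_right _ _
    rcases le_total y c with hyc | hyc
    · exact (h1.dist_le_mul x ⟨hx.1, hxy.trans hyc⟩ y ⟨hy.1, hyc⟩).trans
        (mul_le_mul_of_nonneg_right m1 dist_nonneg)
    rcases le_total c x with hcx | hcx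
    · exact (h2.dist_le_mul x ⟨hcx, hx.2⟩ y ⟨hcx.trans hxy, hy.2⟩).trans
        (mul_le_mul_of_nonneg_right m2 dist_nonneg)
    have d1 := h1.dist_le_mul x ⟨hx.1, hcx⟩ c ⟨hx.1.trans hcx, le_rfl⟩
    have d2 := h2.dist_le_mul c ⟨le_rfl, hyc.trans hy.2⟩ y ⟨hyc, hy.2⟩
    have e : dist x y = dist x c + dist c y := by
      rw [Real.dist_eq, Real.dist_eq, Real.dist_eq, abs_of_nonpos (by linarith),
        abs_of_nonpos (by linarith), abs_of_nonpos (by linarith)]; ring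
    rw [e, mul_add]
    exact (dist_triangle _ (f c) _).trans (add_le_add
      (d1.trans (mul_le_mul_of_nonneg_right m1 dist_nonneg))
      (d2.trans (mul_le_mul_of_nonneg_right m2 dist_nonneg)))
  refine LipschitzOnWith.of_dist_le_mul fun x hx y hy => ?_
  rcases le_total x y with h | h
  · exact key x hx y hy h
  · rw [dist_comm, dist_comm x]; exact key y hy x hx h

namespace RTData

/-- The coefficients of `E`. -/
def coefE (p : RTData) (ξ : EuclideanSpace ℝ (Fin 2)) : FormCoef :=
  ⟨fun x => p.g * p.rho x, fun x => -(p.dP x * p.rho x), 0, 0, p.ϑ * ‖ξ‖ ^ 2⟩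

/-- The coefficients of `D`. -/
def coefD (p : RTData) : FormCoef := ⟨0, p.bulk, p.mu, 0, 0⟩

/-- The coefficients of `F(·;s)`. -/
def coefF (p : RTData) (ξ : EuclideanSpace ℝ (Fin 2)) (s : ℝ) : FormCoef :=
  (p.coefE ξ).comb (-s) p.coefD

/-- The coefficients of `𝒥`. -/
def coefJ (p : RTData) : FormCoef := FormCoef.mass p.rho

variable {p : RTData} {ξ : EuclideanSpace ℝ (Fin 2)} {u v : Fin 3 → ℝ → ℝ} {s : ℝ}

namespace Valid

theorem good_coefE (hv : p.Valid) : (p.coefE ξ).Good p.hm p.hp :=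
  ⟨hv.isCoef_rho.const_mul _, (hv.isCoef_dP.mul hv.isCoef_rho).neg, IsCoef.const 0, IsCoef.const 0⟩

theorem good_coefD (hv : p.Valid) : p.coefD.Good p.hm p.hp :=
  ⟨IsCoef.const 0, hv.isCoef_bulk, hv.isCoef_mu, IsCoef.const 0⟩

theorem good_coefF (hv : p.Valid) : (p.coefF ξ s).Good p.hm p.hp := hv.good_coefE.comb hv.good_coefD _

theorem good_coefJ (hv : p.Valid) : p.coefJ.Good p.hm p.hp := FormCoef.good_mass hv.isCoef_rho

theorem E_eq (hv : p.Valid) : p.E ξ (u 0) (u 1) (u 2) = (p.coefE ξ).form p.hm p.hp ξ u u := by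
  unfold E FormCoef.form
  rw [intervalIntegral_eq_setIntegral_Ioo hv.lt.le]
  congr 1
  · congr 1; funext x
    simp only [FormCoef.integrand, coefE, tang, dvg, Pi.zero_apply]; ring
  · simp only [coefE]; ring

theorem J_eq (hv : p.Valid) : p.J (u 0) (u 1) (u 2) = p.coefJ.form p.hm p.hp ξ u u := by
  unfold J coefJ
  rw [FormCoef.mass_form, intervalIntegral_eq_setIntegral_Ioo hv.lt.le]

theorem D_eq (hv : p.Valid) (hu : H3 p.hm p.hp u) :
    p.D ξ (u 0) (u 1) (u 2) = p.coefD.form p.hm p.hp ξ u u := by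
  have g1 : (⟨0, p.bulk, 0, 0, 0⟩ : FormCoef).Good p.hm p.hp :=
    ⟨IsCoef.const 0, hv.isCoef_bulk, IsCoef.const 0, IsCoef.const 0⟩
  have g2 : (⟨0, 0, p.mu, 0, 0⟩ : FormCoef).Good p.hm p.hp :=
    ⟨IsCoef.const 0, IsCoef.const 0, hv.isCoef_mu, IsCoef.const 0⟩
  have e : p.coefD = (⟨0, p.bulk, 0, 0, 0⟩ : FormCoef).comb 1 ⟨0, 0, p.mu, 0, 0⟩ := by
    simp only [coefD, FormCoef.comb, FormCoef.mk.injEq]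
    refine ⟨?_, ?_, ?_, ?_, ?_⟩ <;> first | (funext x; simp) | simp
  rw [e, g1.form_comb hv.lt.le g2 hu hu]
  unfold D FormCoef.form
  rw [intervalIntegral_eq_setIntegral_Ioo hv.lt.le, intervalIntegral_eq_setIntegral_Ioo hv.lt.le]
  simp only [zero_mul, sub_zero, one_mul]
  congr 1
  · congr 1; funext x
    simp only [FormCoef.integrand, tang, dvg, Pi.zero_apply]; ring
  · congr 1; funext x
    simp only [FormCoef.integrand, tang, dvg, Pi.zero_apply]; ring

theorem F_eq (hv : p.Valid) (hu : H3 p.hm p.hp u) :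
    p.F ξ s (u 0) (u 1) (u 2) = (p.coefF ξ s).form p.hm p.hp ξ u u := by
  unfold F coefF
  rw [hv.E_eq, hv.D_eq hu, hv.good_coefE.form_comb hv.lt.le hv.good_coefD hu hu]
  ring

theorem coefF_form (hv : p.Valid) (hu : H3 p.hm p.hp u) (hw : H3 p.hm p.hp v) :
    (p.coefF ξ s).form p.hm p.hp ξ u v
      = (p.coefE ξ).form p.hm p.hp ξ u v - s * p.coefD.form p.hm p.hp ξ u v := by
  unfold coefF
  rw [hv.good_coefE.form_comb hv.lt.le hv.good_coefD hu hw]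
  ring

/-- Completing the square in `E`: the remaining terms are the boundary terms of `-gρψ²` on the two
sides of the interface, so that `E = (g⟦ρ⟧ - ϑ|ξ|²) ψ(0)² - ∫ P'ρ (div - gψ/P')²`. -/
theorem energy_identity (hv : p.Valid) (hu : H3 p.hm p.hp u) :
    (p.coefE ξ).form p.hm p.hp ξ u u
      = (p.g * (p.ρp 0 - p.ρm 0) - p.ϑ * ‖ξ‖ ^ 2) * u 2 0 ^ 2
        - ∫ x in Ioo p.hm p.hp, p.dP x * p.rho x * (dvg ξ u x - p.g * u 2 x / p.dP x) ^ 2 := by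
  have hab := hv.lt.le
  set h : ℝ → ℝ := fun x => p.g ^ 2 * p.rho x * u 2 x ^ 2 / p.dP x
    - 2 * p.g * p.rho x * u 2 x * deriv (u 2) x with hdef
  have up := hv.upperFacts.integral_boundary hv.hp_pos.le ((hu 2).ac_mono hab hv.hp_pos.le hv.hm_neg.le le_rfl)
  have lo := hv.lowerFacts.integral_boundary hv.hm_neg.le ((hu 2).ac_mono hab hv.hm_neg.le le_rfl hv.hp_pos.le)
  have eu : EqOn h (fun x => p.g ^ 2 * p.ρp x * u 2 x ^ 2 / deriv p.Pp (p.ρp x)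
      - 2 * p.g * p.ρp x * u 2 x * deriv (u 2) x) (Ioo 0 p.hp) := fun x hx => by
    simp only [hdef, rho, dP, if_pos hx.1]
  have el : EqOn h (fun x => p.g ^ 2 * p.ρm x * u 2 x ^ 2 / deriv p.Pm (p.ρm x)
      - 2 * p.g * p.ρm x * u 2 x * deriv (u 2) x) (Ioo p.hm 0) := fun x hx => by
    simp only [hdef, rho, dP, if_neg (not_lt.2 hx.2.le)]
  obtain ⟨hi, hint⟩ := integrableOn_Ioo_split hv.hm_neg hv.hp_pos
    ((integrableOn_congr_fun el measurableSet_Ioo).2 lo.1)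
    ((integrableOn_congr_fun eu measurableSet_Ioo).2 up.1)
  rw [setIntegral_congr_fun measurableSet_Ioo el, setIntegral_congr_fun measurableSet_Ioo eu,
    up.2, lo.2, (hu 2).2.2.1, (hu 2).2.2.2] at hint
  have e : EqOn (fun x => h x - (p.coefE ξ).integrand ξ u u x)
      (fun x => p.dP x * p.rho x * (dvg ξ u x - p.g * u 2 x / p.dP x) ^ 2) (Ioo p.hm p.hp) := by
    intro x hx
    have := (hv.dP_pos (Ioo_subset_Icc_self hx)).ne'
    simp only [hdef, FormCoef.integrand, coefE, tang, dvg, Pi.zero_apply]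
    field_simp
    ring
  rw [← setIntegral_congr_fun measurableSet_Ioo e, integral_sub hi (hv.good_coefE.integrable hab hu hu),
    hint]
  simp only [FormCoef.form, coefE]
  ring

theorem energy_le (hv : p.Valid) (hu : H3 p.hm p.hp u) :
    (p.coefE ξ).form p.hm p.hp ξ u u
      ≤ (p.g * (p.ρp 0 - p.ρm 0) - p.ϑ * ‖ξ‖ ^ 2) * u 2 0 ^ 2 := by
  rw [hv.energy_identity hu]
  have : 0 ≤ ∫ x in Ioo p.hm p.hp, p.dP x * p.rho x * (dvg ξ u x - p.g * u 2 x / p.dP x) ^ 2 :=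
    setIntegral_nonneg measurableSet_Ioo fun x hx =>
      mul_nonneg (mul_nonneg (hv.dP_pos (Ioo_subset_Icc_self hx)).le
        (hv.rho_pos (Ioo_subset_Icc_self hx)).le) (sq_nonneg _)
  linarith

theorem gJ_pos (hv : p.Valid) : 0 < p.g * (p.ρp 0 - p.ρm 0) := mul_pos hv.g_pos hv.density_jump

theorem energy_le' (hv : p.Valid) (hu : H3 p.hm p.hp u) :
    (p.coefE ξ).form p.hm p.hp ξ u u ≤ p.g * (p.ρp 0 - p.ρm 0) * u 2 0 ^ 2 := by
  refine (hv.energy_le hu).trans (mul_le_mul_of_nonneg_right ?_ (sq_nonneg _))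
  have := mul_nonneg hv.ϑ_nonneg (sq_nonneg ‖ξ‖)
  linarith

theorem D_form_eq (x : ℝ) : p.coefD.integrand ξ u u x
    = p.bulk x * dvg ξ u x ^ 2 + p.mu x * ((ξ 1 * u 0 x - ξ 0 * u 1 x) ^ 2
      + (deriv (u 0) x - ξ 0 * u 2 x) ^ 2 + (deriv (u 1) x - ξ 1 * u 2 x) ^ 2
      + (tang ξ u x - deriv (u 2) x) ^ 2 + dvg ξ u x ^ 2 / 3) := by
  simp only [FormCoef.integrand, coefD, Pi.zero_apply]; ring

theorem D_nonneg (hv : p.Valid) : 0 ≤ p.coefD.form p.hm p.hp ξ u u := by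
  unfold FormCoef.form
  have : 0 ≤ ∫ x in Ioo p.hm p.hp, p.coefD.integrand ξ u u x :=
    integral_nonneg fun x => by
      have := (hv.mu_pos x).le
      have := (hv.bulk_pos x).le
      rw [D_form_eq]; positivity
  simpa [coefD] using this

theorem J_nonneg (hv : p.Valid) : 0 ≤ p.coefJ.form p.hm p.hp ξ u u := by
  unfold coefJ
  rw [FormCoef.mass_form]
  exact setIntegral_nonneg measurableSet_Ioo fun x hx =>
    mul_nonneg (hv.rho_pos (Ioo_subset_Icc_self hx)).le (by positivity)

/-- The dissipation controls the vertical derivative, uniformly in the frequency. -/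
theorem exists_D_lower (hv : p.Valid) : ∃ m > 0, ∀ ξ u, H3 p.hm p.hp u →
    m * ∫ x in Ioo p.hm p.hp, deriv (u 2) x ^ 2 ≤ p.coefD.form p.hm p.hp ξ u u := by
  obtain ⟨m, hm, hmu⟩ := hv.mu_lower
  refine ⟨m, hm, fun ξ u hu => ?_⟩
  have h : ∫ x in Ioo p.hm p.hp, m * deriv (u 2) x ^ 2
      ≤ ∫ x in Ioo p.hm p.hp, p.coefD.integrand ξ u u x := by
    refine integral_mono ((hu 2).2.1.integrable_sq.const_mul m)
      (hv.good_coefD.integrable hv.lt.le hu hu) fun x => ?_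
    rw [D_form_eq]
    have h1 := (hv.bulk_pos x).le
    have h2 : deriv (u 2) x ^ 2 ≤ (ξ 1 * u 0 x - ξ 0 * u 1 x) ^ 2
      + (deriv (u 0) x - ξ 0 * u 2 x) ^ 2 + (deriv (u 1) x - ξ 1 * u 2 x) ^ 2
      + (tang ξ u x - deriv (u 2) x) ^ 2 + dvg ξ u x ^ 2 / 3 := by
      have : (tang ξ u x - deriv (u 2) x) ^ 2 + dvg ξ u x ^ 2 / 3 - deriv (u 2) x ^ 2
          = (2 * tang ξ u x - deriv (u 2) x) ^ 2 / 3 := by unfold dvg; ring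
      linarith [sq_nonneg (ξ 1 * u 0 x - ξ 0 * u 1 x), sq_nonneg (deriv (u 0) x - ξ 0 * u 2 x),
        sq_nonneg (deriv (u 1) x - ξ 1 * u 2 x), sq_nonneg (2 * tang ξ u x - deriv (u 2) x)]
    have h3 := mul_le_mul (hmu x) h2 (sq_nonneg _) (hv.mu_pos x).le
    have h4 := mul_nonneg h1 (sq_nonneg (dvg ξ u x))
    simp only at *
    linarith
  rw [integral_const_mul] at h
  simpa [FormCoef.form, coefD] using h

/-- A Korn type inequality: the dissipation controls the full gradient up to the `L²` norm of the
vertical component. -/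
theorem exists_D_lower_gradSq (hv : p.Valid) (ξ : EuclideanSpace ℝ (Fin 2)) :
    ∃ m > 0, ∀ u, H3 p.hm p.hp u →
    m * gradSq p.hm p.hp u ≤ p.coefD.form p.hm p.hp ξ u u
      + 2 * m * (ξ 0 ^ 2 + ξ 1 ^ 2) * ∫ x in Ioo p.hm p.hp, u 2 x ^ 2 := by
  obtain ⟨m, hm, hmu⟩ := hv.mu_lower
  refine ⟨m / 2, by positivity, fun u hu => ?_⟩
  have hi2 := ((hu 2).memLp hv.lt.le).integrable_sq
  have h : ∫ x in Ioo p.hm p.hp, m / 2 * ∑ i, deriv (u i) x ^ 2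
      ≤ ∫ x in Ioo p.hm p.hp, (p.coefD.integrand ξ u u x
        + 2 * (m / 2) * (ξ 0 ^ 2 + ξ 1 ^ 2) * u 2 x ^ 2) := by
    refine integral_mono ((integrable_finsetSum _ fun i _ => (hu i).2.1.integrable_sq).const_mul _)
      ((hv.good_coefD.integrable hv.lt.le hu hu).add (hi2.const_mul _)) fun x => ?_
    simp only
    rw [D_form_eq, Fin.sum_univ_three]
    have h1 := (hv.bulk_pos x).le
    have h2 : (deriv (u 0) x ^ 2 + deriv (u 1) x ^ 2 + deriv (u 2) x ^ 2) / 2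
      - (ξ 0 ^ 2 + ξ 1 ^ 2) * u 2 x ^ 2
      ≤ (ξ 1 * u 0 x - ξ 0 * u 1 x) ^ 2
      + (deriv (u 0) x - ξ 0 * u 2 x) ^ 2 + (deriv (u 1) x - ξ 1 * u 2 x) ^ 2
      + (tang ξ u x - deriv (u 2) x) ^ 2 + dvg ξ u x ^ 2 / 3 := by
      have : (tang ξ u x - deriv (u 2) x) ^ 2 + dvg ξ u x ^ 2 / 3 - deriv (u 2) x ^ 2
          = (2 * tang ξ u x - deriv (u 2) x) ^ 2 / 3 := by unfold dvg; ring
      linarith [sq_nonneg (ξ 1 * u 0 x - ξ 0 * u 1 x), sq_nonneg (deriv (u 0) x - 2 * (ξ 0 * u 2 x)),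
        sq_nonneg (deriv (u 1) x - 2 * (ξ 1 * u 2 x)), sq_nonneg (2 * tang ξ u x - deriv (u 2) x),
        sq_nonneg (deriv (u 2) x)]
    have h3 := mul_le_mul_of_nonneg_left h2 hm.le
    have h4 := mul_nonneg h1 (sq_nonneg (dvg ξ u x))
    have h5 := mul_le_mul_of_nonneg_right (hmu x) (show 0 ≤ (ξ 1 * u 0 x - ξ 0 * u 1 x) ^ 2
      + (deriv (u 0) x - ξ 0 * u 2 x) ^ 2 + (deriv (u 1) x - ξ 1 * u 2 x) ^ 2
      + (tang ξ u x - deriv (u 2) x) ^ 2 + dvg ξ u x ^ 2 / 3 by positivity)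
    linarith
  rw [integral_const_mul, integral_finsetSum _ fun i _ => (hu i).2.1.integrable_sq,
    integral_add (hv.good_coefD.integrable hv.lt.le hu hu) (hi2.const_mul _), integral_const_mul] at h
  simpa [FormCoef.form, coefD, gradSq] using h

theorem exists_J_lower (hv : p.Valid) : ∃ r > 0, ∀ ξ u, H3 p.hm p.hp u →
    r * ∫ x in Ioo p.hm p.hp, u 2 x ^ 2 ≤ p.coefJ.form p.hm p.hp ξ u u := by
  obtain ⟨r, hr, hrho⟩ := hv.rho_lower
  refine ⟨r, hr, fun ξ u hu => ?_⟩
  have hi := hv.good_coefJ.integrable (ξ := ξ) hv.lt.le hu hu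
  unfold FormCoef.form
  rw [← integral_const_mul]
  have h : ∫ x in Ioo p.hm p.hp, r * u 2 x ^ 2
      ≤ ∫ x in Ioo p.hm p.hp, p.coefJ.integrand ξ u u x := by
    refine setIntegral_mono_on (((hu 2).memLp hv.lt.le).integrable_sq.const_mul r) hi
      measurableSet_Ioo fun x hx => ?_
    have h1 := hrho x (Ioo_subset_Icc_self hx)
    have e : p.coefJ.integrand ξ u u x = p.rho x * (u 0 x ^ 2 + u 1 x ^ 2 + u 2 x ^ 2) := by
      simp only [FormCoef.integrand, coefJ, FormCoef.mass, Pi.zero_apply]; ring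
    rw [e]
    refine mul_le_mul h1 ?_ (sq_nonneg _) (hr.le.trans h1)
    linarith [sq_nonneg (u 0 x), sq_nonneg (u 1 x)]
  simpa [coefJ, FormCoef.mass] using h

/-- The upper bound `F(u;s) ≤ C/s` on the constraint set, uniform in the frequency. -/
theorem exists_F_upper (hv : p.Valid) : ∃ C > 0, ∀ ξ s u, 0 < s → H3 p.hm p.hp u →
    p.coefJ.form p.hm p.hp ξ u u = 1 → (p.coefF ξ s).form p.hm p.hp ξ u u ≤ C / s := by
  obtain ⟨m, hm, hD⟩ := hv.exists_D_lower
  obtain ⟨r, hr, hJ⟩ := hv.exists_J_lower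
  set G := p.g * (p.ρp 0 - p.ρm 0) with hG
  have hG0 : 0 < G := hv.gJ_pos
  refine ⟨G ^ 2 / (m * r), by positivity, fun ξ s u hs hu h1 => ?_⟩
  have hε : 0 < s * m / G := by positivity
  have t1 := mul_le_mul_of_nonneg_left ((hu 2).sq_trace_le hv.hm_neg hv.hp_pos hε) hG0.le
  have t2 := hv.energy_le' (ξ := ξ) hu
  have t3 := mul_le_mul_of_nonneg_left (hD ξ u hu) hs.le
  have t4 := hJ ξ u hu
  rw [h1] at t4
  rw [hv.coefF_form hu hu]
  set X := ∫ x in Ioo p.hm p.hp, deriv (u 2) x ^ 2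
  set Y := ∫ x in Ioo p.hm p.hp, u 2 x ^ 2
  have e1 : G * (s * m / G * X + (s * m / G)⁻¹ * Y) = s * (m * X) + G ^ 2 / (m * s) * Y := by
    field_simp
  have hY : Y ≤ 1 / r := by rw [le_div_iff₀ hr]; linarith
  have e2 : G ^ 2 / (m * s) * Y ≤ G ^ 2 / (m * s) * (1 / r) :=
    mul_le_mul_of_nonneg_left hY (by positivity)
  have e3 : G ^ 2 / (m * s) * (1 / r) = G ^ 2 / (m * r) / s := by field_simp
  linarith

/-- Coercivity of `K𝒥 - F(·;s)`. The trace in the upper bound of `E` is absorbed by the dissipation,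
and what remains are multiples of `∫ ψ²`. -/
theorem exists_coercive (hv : p.Valid) (ξ : EuclideanSpace ℝ (Fin 2)) (hs : 0 < s) :
    ∃ K, ∃ c > 0, ∀ u, H3 p.hm p.hp u → c * gradSq p.hm p.hp u
      ≤ K * p.coefJ.form p.hm p.hp ξ u u - (p.coefF ξ s).form p.hm p.hp ξ u u := by
  obtain ⟨m, hm, hD⟩ := hv.exists_D_lower_gradSq ξ
  obtain ⟨r, hr, hJ⟩ := hv.exists_J_lower
  set G := p.g * (p.ρp 0 - p.ρm 0) with hG
  have hG0 : 0 < G := hv.gJ_pos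
  set B := s * (2 * m * (ξ 0 ^ 2 + ξ 1 ^ 2)) + 2 * G ^ 2 / (s * m) with hB
  refine ⟨B / r, s * m / 2, by positivity, fun u hu => ?_⟩
  have hε : 0 < s * m / (2 * G) := by positivity
  have t1 := mul_le_mul_of_nonneg_left ((hu 2).sq_trace_le hv.hm_neg hv.hp_pos hε) hG0.le
  have t2 := hv.energy_le' (ξ := ξ) hu
  have t3 := mul_le_mul_of_nonneg_left (hD u hu) hs.le
  have t4 := hJ ξ u hu
  have t5 : _ ≤ gradSq p.hm p.hp u := integral_deriv_sq_le_gradSq (2 : Fin 3)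
  rw [hv.coefF_form hu hu]
  set X := ∫ x in Ioo p.hm p.hp, deriv (u 2) x ^ 2
  set Y := ∫ x in Ioo p.hm p.hp, u 2 x ^ 2
  have e1 : G * (s * m / (2 * G) * X + (s * m / (2 * G))⁻¹ * Y)
      = s * m / 2 * X + 2 * G ^ 2 / (s * m) * Y := by
    field_simp
  have t6 := mul_le_mul_of_nonneg_left t5 (show 0 ≤ s * m / 2 by positivity)
  have t7 : B * Y ≤ B / r * p.coefJ.form p.hm p.hp ξ u u := by
    rw [div_mul_eq_mul_div, le_div_iff₀ hr, mul_assoc, mul_comm Y]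
    exact mul_le_mul_of_nonneg_left t4 (by positivity)
  have e2 : B * Y = s * (2 * m * (ξ 0 ^ 2 + ξ 1 ^ 2) * Y) + 2 * G ^ 2 / (s * m) * Y := by
    rw [hB]; ring
  linarith

end Valid

end RTData

/-! ### Growth rates and growing modes -/

namespace RTData

variable {p : RTData} {ξ : EuclideanSpace ℝ (Fin 2)} {u v : Fin 3 → ℝ → ℝ} {s : ℝ}

/-- The vertical component, on one side of the interface, of a trial field with positive energy; `ρ₀`
is the trace of the density at the interface and `d` the height of the boundary. The factor `1/ρ`
solves `ψ' = gψ/P'`. -/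
def trialVert (ρ : ℝ → ℝ) (d x : ℝ) : ℝ := (1 - x ^ 2 / d ^ 2) ^ 2 * (ρ 0 / ρ x)

/-- The tangential part `ξ₁φ + ξ₂θ` of the divergence of the trial field. -/
def trialTang (ρ : ℝ → ℝ) (d x : ℝ) : ℝ := 4 * x / d ^ 2 * (1 - x ^ 2 / d ^ 2) * (ρ 0 / ρ x)

theorem contDiffOn_trial {g c d e : ℝ} {P ρ : ℝ → ℝ} (hs : SideFacts g c d P ρ) :
    ContDiffOn ℝ 1 (trialVert ρ e) (Icc c d) ∧ ContDiffOn ℝ 1 (trialTang ρ e) (Icc c d) := by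
  have h1 : ContDiffOn ℝ 1 (fun x => ρ 0 / ρ x) (Icc c d) :=
    contDiffOn_const.div (hs.contDiffOn.of_le (by norm_num)) fun x hx => (hs.pos x hx).ne'
  have h2 : ContDiff ℝ 1 fun x : ℝ => (1 - x ^ 2 / e ^ 2) ^ 2 := by fun_prop
  have h3 : ContDiff ℝ 1 fun x : ℝ => 4 * x / e ^ 2 * (1 - x ^ 2 / e ^ 2) := by fun_prop
  exact ⟨h2.contDiffOn.mul h1, h3.contDiffOn.mul h1⟩

theorem memH10_ite {a b : ℝ} {f h : ℝ → ℝ} (ha : a < 0) (hb : 0 < b)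
    (hf : ContDiffOn ℝ 1 f (Icc 0 b)) (hh : ContDiffOn ℝ 1 h (Icc a 0)) (h0 : f 0 = h 0)
    (hfb : f b = 0) (hha : h a = 0) : MemH10 a b fun s => if 0 < s then f s else h s := by
  obtain ⟨K, hK⟩ := hf.exists_lipschitzOnWith one_ne_zero (convex_Icc _ _) isCompact_Icc
  obtain ⟨L, hL⟩ := hh.exists_lipschitzOnWith one_ne_zero (convex_Icc _ _) isCompact_Icc
  have e1 : EqOn (fun s => if 0 < s then f s else h s) f (Icc 0 b) := fun x hx => by
    rcases hx.1.eq_or_lt with rfl | hlt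
    · simp [h0]
    · simp [hlt]
  have e2 : EqOn (fun s => if 0 < s then f s else h s) h (Icc a 0) := fun x hx => by
    simp [not_lt.2 hx.2]
  have l1 : LipschitzOnWith K (fun s => if 0 < s then f s else h s) (Icc 0 b) :=
    fun x hx y hy => by rw [e1 hx, e1 hy]; exact hK hx hy
  have l2 : LipschitzOnWith L (fun s => if 0 < s then f s else h s) (Icc a 0) :=
    fun x hx y hy => by rw [e2 hx, e2 hy]; exact hL hx hy
  exact MemH10.of_lipschitzOn (ha.trans hb).le (l2.glue l1) (by simp [not_lt.2 ha.le, hha])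
    (by simp [hb, hfb])

theorem hasDerivAt_trialVert {g c d e x : ℝ} {P ρ : ℝ → ℝ} (hs : SideFacts g c d P ρ)
    (hx : x ∈ Ioo c d) : HasDerivAt (trialVert ρ e)
      (g * trialVert ρ e x / deriv P (ρ x) - trialTang ρ e x) x := by
  have hx' := Ioo_subset_Icc_self hx
  have h1 := (hs.hasDeriv x hx').hasDerivAt (Icc_mem_nhds hx.1 hx.2)
  have h2 : HasDerivAt (fun x : ℝ => (1 - x ^ 2 / e ^ 2) ^ 2)
      (2 * (1 - x ^ 2 / e ^ 2) * (-(2 * x / e ^ 2))) x := by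
    refine ((((hasDerivAt_id' x).fun_pow 2).div_const (e ^ 2)).const_sub 1 |>.fun_pow 2).congr_deriv ?_
    simp
  have h3 := h2.mul ((hasDerivAt_const x (ρ 0)).div h1 (hs.pos x hx').ne')
  refine h3.congr_deriv ?_
  have := (hs.pos x hx').ne'
  have := (hs.dP_pos x hx').ne'
  simp only [trialVert, trialTang, Pi.div_apply]
  field_simp
  ring

/-- A trial field with positive energy at a subcritical frequency: the square in the energy identity
vanishes, and the trace is `1`. -/
theorem Valid.exists_energy_pos (hv : p.Valid) (hξ : 0 < ‖ξ‖)
    (hsub : p.ϑ * ‖ξ‖ ^ 2 < p.g * (p.ρp 0 - p.ρm 0)) :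
    ∃ u, H3 p.hm p.hp u ∧ 0 < (p.coefE ξ).form p.hm p.hp ξ u u := by
  set V : ℝ → ℝ := fun s => if 0 < s then trialVert p.ρp p.hp s else trialVert p.ρm p.hm s with hV
  set W : ℝ → ℝ := fun s => if 0 < s then trialTang p.ρp p.hp s else trialTang p.ρm p.hm s with hW
  have up := contDiffOn_trial (e := p.hp) hv.upperFacts
  have lo := contDiffOn_trial (e := p.hm) hv.lowerFacts
  have hp0 := (hv.upperFacts.pos 0 ⟨le_rfl, hv.hp_pos.le⟩).ne'
  have hm0 := (hv.lowerFacts.pos 0 ⟨hv.hm_neg.le, le_rfl⟩).ne'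
  have hp := hv.hp_pos.ne'
  have hm := hv.hm_neg.ne
  have HV : MemH10 p.hm p.hp V := memH10_ite hv.hm_neg hv.hp_pos up.1 lo.1
    (by simp [trialVert, hp0, hm0]) (by simp [trialVert, hp]) (by simp [trialVert, hm])
  have HW : MemH10 p.hm p.hp W := memH10_ite hv.hm_neg hv.hp_pos up.2 lo.2
    (by simp [trialTang]) (by simp [trialTang, hp]) (by simp [trialTang, hm])
  have hWc : ∀ c : ℝ, MemH10 p.hm p.hp fun x => c * W x := fun c => by
    simpa using MemH10.zero.add_mul HW c
  set u : Fin 3 → ℝ → ℝ :=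
    ![fun x => ξ 0 / ‖ξ‖ ^ 2 * W x, fun x => ξ 1 / ‖ξ‖ ^ 2 * W x, V] with hu
  have hu3 : H3 p.hm p.hp u := by
    intro i
    fin_cases i
    exacts [hWc _, hWc _, HV]
  refine ⟨u, hu3, ?_⟩
  have hn : ξ 0 ^ 2 + ξ 1 ^ 2 = ‖ξ‖ ^ 2 := by
    rw [EuclideanSpace.norm_sq_eq, Fin.sum_univ_two]; simp
  have ht : ∀ x, tang ξ u x = W x := by
    intro x
    simp only [tang, hu, Matrix.cons_val_zero, Matrix.cons_val_one]
    have : ξ 0 * (ξ 0 / ‖ξ‖ ^ 2 * W x) + ξ 1 * (ξ 1 / ‖ξ‖ ^ 2 * W x)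
      = (ξ 0 ^ 2 + ξ 1 ^ 2) / ‖ξ‖ ^ 2 * W x := by ring
    rw [this, hn, div_self (by positivity), one_mul]
  have hd : ∀ x ∈ Ioo p.hm p.hp, x ≠ 0 → dvg ξ u x - p.g * u 2 x / p.dP x = 0 := by
    intro x hx hx0
    have e2 : u 2 = V := rfl
    simp only [dvg, ht, e2]
    rcases lt_or_gt_of_ne hx0 with h | h
    · have e : V =ᶠ[𝓝 x] trialVert p.ρm p.hm := by
        filter_upwards [gt_mem_nhds h] with y hy
        simp [hV, not_lt.2 (le_of_lt hy)]
      rw [e.deriv_eq, (hasDerivAt_trialVert hv.lowerFacts ⟨hx.1, h⟩).deriv, e.eq_of_nhds]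
      simp only [hW, dP, not_lt.2 h.le, if_false]
      ring
    · have e : V =ᶠ[𝓝 x] trialVert p.ρp p.hp := by
        filter_upwards [lt_mem_nhds h] with y hy
        simp [hV, hy]
      rw [e.deriv_eq, (hasDerivAt_trialVert hv.upperFacts ⟨h, hx.2⟩).deriv, e.eq_of_nhds]
      simp only [hW, dP, h, if_true]
      ring
  rw [hv.energy_identity hu3]
  have hz : ∫ x in Ioo p.hm p.hp, p.dP x * p.rho x * (dvg ξ u x - p.g * u 2 x / p.dP x) ^ 2 = 0 := by
    refine integral_eq_zero_of_ae ?_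
    have h0 : ∀ᵐ x ∂volume.restrict (Ioo p.hm p.hp), x ≠ 0 :=
      ae_restrict_of_ae (by simp [ae_iff, measure_singleton])
    filter_upwards [ae_restrict_mem measurableSet_Ioo, h0] with x hx hx0
    simp [hd x hx hx0]
  have h20 : u 2 0 = 1 := by
    have e2 : u 2 = V := rfl
    simp [e2, hV, trialVert, hm0]
  rw [hz, h20]
  linarith

theorem Valid.subcritical_iff (hv : p.Valid) (hξ : ξ ∈ p.subcritical) :
    0 < ‖ξ‖ ∧ p.ϑ * ‖ξ‖ ^ 2 < p.g * (p.ρp 0 - p.ρm 0) := by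
  refine ⟨hξ.1, ?_⟩
  have h := hξ.2
  unfold critFreq at h
  split_ifs at h with hθ
  · rw [EReal.coe_lt_coe_iff, Real.lt_sqrt (norm_nonneg _), lt_div_iff₀ hθ] at h
    linarith
  · rw [le_antisymm (not_lt.1 hθ) hv.ϑ_nonneg, zero_mul]
    exact hv.gJ_pos

theorem constraint_iff (hv : p.Valid) : p.Constraint (u 0) (u 1) (u 2) ↔
    H3 p.hm p.hp u ∧ p.coefJ.form p.hm p.hp ξ u u = 1 := by
  unfold Constraint
  rw [hv.J_eq (ξ := ξ)]
  constructor
  · rintro ⟨h0, h1, h2, h⟩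
    refine ⟨fun i => ?_, h⟩
    fin_cases i
    exacts [h0, h1, h2]
  · rintro ⟨h, h1⟩
    exact ⟨h 0, h 1, h 2, h1⟩

/-- The set of values of `F(·;s)` on the constraint set. -/
theorem values_eq (hv : p.Valid) : {a | ∃ φ θ ψ, p.Constraint φ θ ψ ∧ a = p.F ξ s φ θ ψ}
    = {a | ∃ u, H3 p.hm p.hp u ∧ p.coefJ.form p.hm p.hp ξ u u = 1 ∧
        a = (p.coefF ξ s).form p.hm p.hp ξ u u} := by
  ext a
  constructor
  · rintro ⟨φ, θ, ψ, hc, rfl⟩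
    have h := (constraint_iff (ξ := ξ) (u := ![φ, θ, ψ]) hv).1 hc
    exact ⟨_, h.1, h.2, hv.F_eq h.1⟩
  · rintro ⟨u, hu, h1, rfl⟩
    exact ⟨u 0, u 1, u 2, (constraint_iff hv).2 ⟨hu, h1⟩, (hv.F_eq hu).symm⟩

theorem Valid.exists_normalized (hv : p.Valid) (hu : H3 p.hm p.hp u)
    (hpos : 0 < p.coefJ.form p.hm p.hp ξ u u) :
    ∃ t > 0, p.coefJ.form p.hm p.hp ξ (addMul u (t - 1) u) (addMul u (t - 1) u) = 1 ∧
      t ^ 2 * p.coefJ.form p.hm p.hp ξ u u = 1 := by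
  refine ⟨(Real.sqrt (p.coefJ.form p.hm p.hp ξ u u))⁻¹, by positivity, ?_⟩
  rw [hv.good_coefJ.form_smul hv.lt.le hu, inv_pow, Real.sq_sqrt hpos.le, inv_mul_cancel₀ hpos.ne']
  simp

theorem Valid.eq_zero_of_J (hv : p.Valid) (hu : H3 p.hm p.hp u)
    (h : p.coefJ.form p.hm p.hp ξ u u = 0) : ∀ x ∈ Icc p.hm p.hp, ∀ i, u i x = 0 := by
  have hc : ContinuousOn (fun x => u 0 x ^ 2 + u 1 x ^ 2 + u 2 x ^ 2) (Icc p.hm p.hp) :=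
    ((((hu 0).continuousOn hv.lt.le).pow 2).add (((hu 1).continuousOn hv.lt.le).pow 2)).add
      (((hu 2).continuousOn hv.lt.le).pow 2)
  obtain ⟨r, hr, hrho⟩ := hv.rho_lower
  unfold coefJ at h
  rw [FormCoef.mass_form] at h
  have hi := hv.good_coefJ.integrable (ξ := ξ) hv.lt.le hu hu
  have hi' : IntegrableOn (fun x => p.rho x * (u 0 x ^ 2 + u 1 x ^ 2 + u 2 x ^ 2))
      (Ioo p.hm p.hp) := by
    refine hi.congr (Eventually.of_forall fun x => ?_)
    simp only [FormCoef.integrand, coefJ, FormCoef.mass, Pi.zero_apply]; ring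
  have hae : (fun x => u 0 x ^ 2 + u 1 x ^ 2 + u 2 x ^ 2) =ᵐ[volume.restrict (Ioo p.hm p.hp)]
      fun _ => 0 := by
    have h0 := (setIntegral_eq_zero_iff_of_nonneg_ae (μ := volume) (s := Ioo p.hm p.hp)
      (ae_restrict_of_forall_mem measurableSet_Ioo fun x hx => mul_nonneg
        (hv.rho_pos (Ioo_subset_Icc_self hx)).le (by positivity)) hi').1 h
    filter_upwards [h0, ae_restrict_mem measurableSet_Ioo] with x hx hxI
    exact (mul_eq_zero.1 hx).resolve_left (hv.rho_pos (Ioo_subset_Icc_self hxI)).ne'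
  have he : EqOn (fun x => u 0 x ^ 2 + u 1 x ^ 2 + u 2 x ^ 2) (fun _ => 0) (Icc p.hm p.hp) := by
    have h1 := Measure.eqOn_open_of_ae_eq hae isOpen_Ioo (hc.mono Ioo_subset_Icc_self)
      continuousOn_const
    exact h1.of_subset_closure hc continuousOn_const Ioo_subset_Icc_self
      (closure_Ioo hv.lt.ne).symm.subset
  intro x hx i
  have h2 := he hx
  simp only at h2
  have p0 := sq_nonneg (u 0 x)
  have p1 := sq_nonneg (u 1 x)
  have p2 := sq_nonneg (u 2 x)
  fin_cases i
  · exact pow_eq_zero_iff two_ne_zero |>.1 (show u 0 x ^ 2 = 0 by linarith)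
  · exact pow_eq_zero_iff two_ne_zero |>.1 (show u 1 x ^ 2 = 0 by linarith)
  · exact pow_eq_zero_iff two_ne_zero |>.1 (show u 2 x ^ 2 = 0 by linarith)

/-- The largest `s` for which `F(·;s)` exceeds `s²` somewhere on the constraint set is a growth
rate. -/
theorem Valid.exists_isGrowthRate (hv : p.Valid) (hξ : ξ ∈ p.subcritical) :
    ∃ s, p.IsGrowthRate ξ s := by
  obtain ⟨hξ0, hsub⟩ := hv.subcritical_iff hξ
  obtain ⟨C, hC, hup⟩ := hv.exists_F_upper
  set Fs : ℝ → (Fin 3 → ℝ → ℝ) → ℝ := fun s u => (p.coefF ξ s).form p.hm p.hp ξ u u with hFs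
  have hF : ∀ {s u}, H3 p.hm p.hp u → Fs s u = (p.coefE ξ).form p.hm p.hp ξ u u
      - s * p.coefD.form p.hm p.hp ξ u u := fun hu => hv.coefF_form hu hu
  set S : Set ℝ := {s | 0 < s ∧ ∃ u, H3 p.hm p.hp u ∧ p.coefJ.form p.hm p.hp ξ u u = 1 ∧
    s ^ 2 < Fs s u} with hS
  have hSne : S.Nonempty := by
    obtain ⟨u, hu, hE⟩ := hv.exists_energy_pos hξ0 hsub
    set e := (p.coefE ξ).form p.hm p.hp ξ u u
    have hD : 0 ≤ p.coefD.form p.hm p.hp ξ u u := hv.D_nonneg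
    set D := p.coefD.form p.hm p.hp ξ u u with hDdef
    have hJ0 : 0 ≤ p.coefJ.form p.hm p.hp ξ u u := hv.J_nonneg
    have hJ : 0 < p.coefJ.form p.hm p.hp ξ u u := by
      refine lt_of_le_of_ne hJ0 fun h => ?_
      have h2 := hv.energy_le (ξ := ξ) hu
      rw [hv.eq_zero_of_J hu h.symm 0 hv.zero_mem 2] at h2
      simp only [ne_eq, OfNat.ofNat_ne_zero, not_false_eq_true, zero_pow, mul_zero] at h2
      exact absurd hE (not_lt.2 h2)
    set J := p.coefJ.form p.hm p.hp ξ u u with hJdef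
    obtain ⟨t, ht, ht1, ht2⟩ := hv.exists_normalized hu hJ
    set s := min 1 (e / (D + J + 1)) with hs
    have hs0 : 0 < s := lt_min one_pos (by positivity)
    have hs1 : s ≤ 1 := min_le_left _ _
    have hs2 : s * (D + J + 1) ≤ e := by
      rw [← le_div_iff₀ (by positivity)]; exact min_le_right _ _
    refine ⟨s, hs0, _, hu.addMul hu (t - 1), ht1, ?_⟩
    have e1 : Fs s (addMul u (t - 1) u) = t ^ 2 * (e - s * D) := by
      rw [← hF hu]; exact hv.good_coefF.form_smul hv.lt.le hu t
    rw [e1]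
    have h3 : s ^ 2 * J < e - s * D := by
      have : s ^ 2 * J ≤ s * J := mul_le_mul_of_nonneg_right (by nlinarith) hJ0
      linarith
    have h4 := mul_lt_mul_of_pos_left h3 (show 0 < t ^ 2 by positivity)
    calc s ^ 2 = s ^ 2 * (t ^ 2 * J) := by rw [ht2, mul_one]
      _ = t ^ 2 * (s ^ 2 * J) := by ring
      _ < _ := h4
  have hSb : BddAbove S := by
    refine ⟨max 1 C, ?_⟩
    rintro s ⟨hs, u, hu, h1, h2⟩
    rcases le_total s 1 with h | h
    · exact h.trans (le_max_left _ _)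
    · have h3 := h2.le.trans (hup ξ s u hs hu h1)
      rw [le_div_iff₀ hs] at h3
      refine le_trans ?_ (le_max_right _ _)
      nlinarith [mul_nonneg hs.le hs.le]
  set σ := sSup S with hσ
  obtain ⟨s0, hs0⟩ := hSne
  have hσ0 : 0 < σ := hs0.1.trans_le (le_csSup hSb hs0)
  refine ⟨σ, hσ0, ?_⟩
  rw [values_eq hv]
  constructor
  · rintro _ ⟨u, hu, h1, rfl⟩
    by_contra! hlt
    -- `F(u;s) - s²` is continuous in `s`, so `σ` could be enlarged
    have hcont : Continuous fun s : ℝ => (p.coefE ξ).form p.hm p.hp ξ u u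
      - s * p.coefD.form p.hm p.hp ξ u u - s ^ 2 := by fun_prop
    have hpos : 0 < (p.coefE ξ).form p.hm p.hp ξ u u
      - σ * p.coefD.form p.hm p.hp ξ u u - σ ^ 2 := by
      have := hF (s := σ) hu
      simp only [hFs] at this
      rw [this] at hlt; linarith
    have hev := (hcont.tendsto σ).eventually (lt_mem_nhds hpos)
    have hev' := hev.filter_mono (nhdsWithin_le_nhds (s := Ioi σ))
    obtain ⟨s', hs', hlt'⟩ := (hev'.and self_mem_nhdsWithin).exists
    have : s' ∈ S := ⟨hσ0.trans hlt', u, hu, h1, by rw [hF hu]; linarith⟩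
    exact absurd (le_csSup hSb this) (not_le.2 hlt')
  · intro B hB
    by_contra! hlt
    -- for admissible `u` and `s` close to `σ` the dissipation is bounded: subtract
    -- `F(u;σ/2) ≤ C/(σ/2)` from `F(u;s) > s²`; hence `F(u;σ)` is as close to `σ²` as one likes
    have hDb : ∀ s u, σ / 2 < s → H3 p.hm p.hp u → p.coefJ.form p.hm p.hp ξ u u = 1 →
        s ^ 2 < Fs s u → p.coefD.form p.hm p.hp ξ u u * (s - σ / 2) ≤ C / (σ / 2) := by
      intro s u hs hu h1 h2
      have h3 := hup ξ (σ / 2) u (by positivity) hu h1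
      change Fs (σ / 2) u ≤ _ at h3
      rw [hF hu] at h2 h3
      nlinarith [sq_nonneg s]
    set M := C / (σ / 2) / (σ / 4) with hM
    have hM0 : 0 < M := by positivity
    have hcont : Continuous fun s : ℝ => s ^ 2 - (σ - s) * M := by fun_prop
    have hev := (hcont.tendsto σ).eventually (lt_mem_nhds (show B < σ ^ 2 - (σ - σ) * M by simpa))
    obtain ⟨δ, hδ, hball⟩ := Metric.eventually_nhds_iff.1 hev
    obtain ⟨s, hsS, hs⟩ := exists_lt_of_lt_csSup ⟨s0, hs0⟩
      (show max (σ - δ) (3 * σ / 4) < sSup S from max_lt (by linarith) (by linarith))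
    have hsσ : s ≤ σ := le_csSup hSb hsS
    obtain ⟨hs0', u, hu, h1, h2⟩ := hsS
    have h3 : 3 * σ / 4 < s := (le_max_right _ _).trans_lt hs
    have h4 : σ - δ < s := (le_max_left _ _).trans_lt hs
    have h5 := hball (show dist s σ < δ by
      rw [Real.dist_eq, abs_of_nonpos (by linarith)]; linarith)
    have h6 := hDb s u (by linarith) hu h1 h2
    have h7 : p.coefD.form p.hm p.hp ξ u u ≤ M := by
      rw [hM, le_div_iff₀ (by positivity)]
      refine le_trans ?_ h6
      exact mul_le_mul_of_nonneg_left (by linarith) hv.D_nonneg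
    have h8 := hB ⟨u, hu, h1, rfl⟩
    change Fs σ u ≤ B at h8
    rw [hF hu] at h2 h8
    have h9 := mul_le_mul_of_nonneg_left h7 (sub_nonneg.2 hsσ)
    linarith

/-- The supremum of `F(·;s)` is nonincreasing in `s`, and `s²` is strictly increasing. -/
theorem Valid.isGrowthRate_unique (hv : p.Valid) {s t : ℝ} (hs : p.IsGrowthRate ξ s)
    (ht : p.IsGrowthRate ξ t) : s = t := by
  wlog hst : s < t generalizing s t
  · rcases lt_trichotomy s t with h | h | h
    exacts [absurd h hst, h, (this ht hs h).symm]
  obtain ⟨hs0, hs⟩ := hs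
  obtain ⟨ht0, ht⟩ := ht
  rw [values_eq hv] at hs ht
  have : t ^ 2 ≤ s ^ 2 := by
    refine ht.2 ?_
    rintro _ ⟨u, hu, h1, rfl⟩
    refine le_trans ?_ (hs.1 ⟨u, hu, h1, rfl⟩)
    rw [hv.coefF_form hu hu, hv.coefF_form hu hu]
    have := mul_le_mul_of_nonneg_right hst.le (hv.D_nonneg (ξ := ξ) (u := u))
    linarith
  nlinarith

theorem Valid.isGrowthRate_lam (hv : p.Valid) (hξ : ξ ∈ p.subcritical) :
    p.IsGrowthRate ξ (p.lam ξ) := Classical.epsilon_spec (hv.exists_isGrowthRate hξ)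

theorem Valid.lam_pos (hv : p.Valid) (hξ : ξ ∈ p.subcritical) : 0 < p.lam ξ :=
  (hv.isGrowthRate_lam hξ).1

theorem Valid.bddAbove_lam (hv : p.Valid) : BddAbove (p.lam '' p.subcritical) := by
  obtain ⟨C, hC, hup⟩ := hv.exists_F_upper
  refine ⟨max 1 C, ?_⟩
  rintro _ ⟨ξ, hξ, rfl⟩
  obtain ⟨h0, h⟩ := hv.isGrowthRate_lam hξ
  rw [values_eq hv] at h
  have h1 : p.lam ξ ^ 2 ≤ C / p.lam ξ := h.2 (by
    rintro _ ⟨u, hu, h1, rfl⟩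
    exact hup ξ _ u h0 hu h1)
  rcases le_total (p.lam ξ) 1 with h | h
  · exact h.trans (le_max_left _ _)
  · rw [le_div_iff₀ h0] at h1
    refine le_trans ?_ (le_max_right _ _)
    nlinarith [mul_nonneg h0.le h0.le]

theorem Valid.subcritical_nonempty (hv : p.Valid) : p.subcritical.Nonempty := by
  have hex : ∃ r : ℝ, 0 < r ∧ (r : EReal) < p.critFreq := by
    unfold critFreq
    split_ifs with h
    · have : 0 < Real.sqrt (p.g * (p.ρp 0 - p.ρm 0) / p.ϑ) := Real.sqrt_pos.2 (div_pos hv.gJ_pos h)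
      exact ⟨_, half_pos this, EReal.coe_lt_coe_iff.2 (half_lt_self this)⟩
    · exact ⟨1, one_pos, EReal.coe_lt_top 1⟩
  obtain ⟨r, hr, hlt⟩ := hex
  refine ⟨EuclideanSpace.single 0 r, ?_⟩
  have : ‖EuclideanSpace.single (0 : Fin 2) r‖ = r := by simp [abs_of_pos hr]
  exact ⟨by rw [this]; exact hr, by rw [this]; exact hlt⟩

theorem Valid.exists_near_supRate (hv : p.Valid) :
    ∃ ξ ∈ p.subcritical, p.lam ξ ∈ Ioc (2 * p.supRate / 3) p.supRate := by
  obtain ⟨ξ₀, hξ₀⟩ := hv.subcritical_nonempty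
  have h0 : 0 < p.supRate :=
    (hv.lam_pos hξ₀).trans_le (le_csSup hv.bddAbove_lam (mem_image_of_mem _ hξ₀))
  obtain ⟨_, ⟨ξ, hξ, rfl⟩, hlt⟩ := exists_lt_of_lt_csSup
    (show (p.lam '' p.subcritical).Nonempty from ⟨_, mem_image_of_mem _ hξ₀⟩)
    (show 2 * p.supRate / 3 < sSup (p.lam '' p.subcritical) by
      change _ < p.supRate; linarith)
  exact ⟨ξ, hξ, hlt, le_csSup hv.bddAbove_lam (mem_image_of_mem _ hξ)⟩

theorem Valid.exists_isMode (hv : p.Valid) (hξ : ξ ∈ p.subcritical) :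
    ∃ φ θ ψ, p.IsMode ξ φ θ ψ := by
  set s := p.lam ξ
  have hs : 0 < s := hv.lam_pos hξ
  obtain ⟨K, c, hc, hcoer⟩ := hv.exists_coercive ξ hs
  -- minimize `K𝒥 - F(·;s)`
  set q : FormCoef := (FormCoef.mass fun x => K * p.rho x).comb (-1) (p.coefF ξ s) with hq
  have gK : (FormCoef.mass fun x => K * p.rho x).Good p.hm p.hp :=
    FormCoef.good_mass (hv.isCoef_rho.const_mul K)
  have gq : q.Good p.hm p.hp := gK.comb hv.good_coefF _
  have eq : ∀ u, H3 p.hm p.hp u → q.form p.hm p.hp ξ u u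
      = K * p.coefJ.form p.hm p.hp ξ u u - (p.coefF ξ s).form p.hm p.hp ξ u u := by
    intro u hu
    rw [hq, gK.form_comb hv.lt.le hv.good_coefF hu hu]
    have : (FormCoef.mass fun x => K * p.rho x).form p.hm p.hp ξ u u
        = K * p.coefJ.form p.hm p.hp ξ u u := by
      unfold coefJ
      rw [FormCoef.mass_form, FormCoef.mass_form, ← integral_const_mul]
      simp_rw [mul_assoc]
    rw [this]; ring
  have hne : ∃ u, H3 p.hm p.hp u ∧ (FormCoef.mass p.rho).form p.hm p.hp ξ u u = 1 := by
    obtain ⟨h0, h⟩ := hv.isGrowthRate_lam hξ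
    obtain ⟨_, φ, θ, ψ, hc, -⟩ := h.nonempty
    exact ⟨_, (constraint_iff (ξ := ξ) (u := ![φ, θ, ψ]) hv).1 hc⟩
  obtain ⟨u, hu, hu1, hmin⟩ := exists_minimizer hv.lt hv.zero_mem gq hv.isCoef_rho
    (fun x hx => (hv.rho_pos (Ioo_subset_Icc_self hx)).le) hc
    (fun u hu => (hcoer u hu).trans_eq (eq u hu).symm) hne
  refine ⟨u 0, u 1, u 2, (constraint_iff hv).2 ⟨hu, hu1⟩, fun φ θ ψ hc => ?_⟩
  obtain ⟨hw, hw1⟩ := (constraint_iff (ξ := ξ) (u := ![φ, θ, ψ]) hv).1 hc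
  have h := hmin _ hw hw1
  rw [eq _ hu, eq _ hw] at h
  have e1 : p.coefJ.form p.hm p.hp ξ u u = 1 := hu1
  rw [e1, hw1] at h
  have e2 := hv.F_eq (ξ := ξ) (s := s) hw
  rw [hv.F_eq hu]
  refine le_trans (le_of_eq e2) ?_
  linarith

/-- A growing mode attains the value `λ(ξ)²` of the supremum. -/
theorem Valid.forms_of_isMode (hv : p.Valid) (hξ : ξ ∈ p.subcritical)
    (hm : p.IsMode ξ (u 0) (u 1) (u 2)) : H3 p.hm p.hp u ∧ p.coefJ.form p.hm p.hp ξ u u = 1 ∧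
      (p.coefF ξ (p.lam ξ)).form p.hm p.hp ξ u u = p.lam ξ ^ 2 := by
  obtain ⟨hu, h1⟩ := (constraint_iff (ξ := ξ) hv).1 hm.1
  refine ⟨hu, h1, ?_⟩
  rw [← hv.F_eq hu]
  obtain ⟨h0, h⟩ := hv.isGrowthRate_lam hξ
  refine le_antisymm (h.1 ⟨_, _, _, hm.1, rfl⟩) (h.2 ?_)
  rintro _ ⟨φ, θ, ψ, hc, rfl⟩
  exact hm.2 φ θ ψ hc

/-- The Euler–Lagrange equation in weak form. By homogeneity `F(·;λ) - λ²𝒥` is nonpositive on all of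
`H₀¹`, and it vanishes at the growing mode. -/
theorem Valid.euler_lagrange (hv : p.Valid) (hξ : ξ ∈ p.subcritical)
    (hm : p.IsMode ξ (u 0) (u 1) (u 2)) (hw : H3 p.hm p.hp v) :
    (p.coefF ξ (p.lam ξ)).form p.hm p.hp ξ u v
      = p.lam ξ ^ 2 * p.coefJ.form p.hm p.hp ξ u v := by
  obtain ⟨hu, h1, h2⟩ := hv.forms_of_isMode hξ hm
  set s := p.lam ξ
  have hle : ∀ w, H3 p.hm p.hp w → (p.coefF ξ s).form p.hm p.hp ξ w w
      ≤ s ^ 2 * p.coefJ.form p.hm p.hp ξ w w := by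
    intro w hw
    rcases (hv.J_nonneg (ξ := ξ) (u := w)).eq_or_lt with h | h
    · have h3 := hv.energy_le (ξ := ξ) hw
      rw [hv.eq_zero_of_J hw h.symm 0 hv.zero_mem 2] at h3
      simp only [ne_eq, OfNat.ofNat_ne_zero, not_false_eq_true, zero_pow, mul_zero] at h3
      rw [← h, mul_zero, hv.coefF_form hw hw]
      have := mul_nonneg (hv.lam_pos hξ).le (hv.D_nonneg (ξ := ξ) (u := w))
      linarith
    · obtain ⟨t, ht, ht1, ht2⟩ := hv.exists_normalized hw h
      obtain ⟨-, hlub⟩ := hv.isGrowthRate_lam hξ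
      rw [values_eq hv] at hlub
      have h3 : _ ≤ s ^ 2 := hlub.1 ⟨_, hw.addMul hw (t - 1), ht1, rfl⟩
      rw [hv.good_coefF.form_smul hv.lt.le hw] at h3
      have h4 : t ^ 2 * (p.coefF ξ s).form p.hm p.hp ξ w w
          ≤ t ^ 2 * (s ^ 2 * p.coefJ.form p.hm p.hp ξ w w) := by
        refine h3.trans (le_of_eq ?_)
        calc s ^ 2 = s ^ 2 * (t ^ 2 * p.coefJ.form p.hm p.hp ξ w w) := by rw [ht2, mul_one]
          _ = _ := by ring
      exact le_of_mul_le_mul_left h4 (by positivity)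
  -- a quadratic polynomial `2tb - t²c` that is nonpositive for all `t` has `b = 0`
  set b := s ^ 2 * p.coefJ.form p.hm p.hp ξ u v - (p.coefF ξ s).form p.hm p.hp ξ u v with hb
  set c := s ^ 2 * p.coefJ.form p.hm p.hp ξ v v - (p.coefF ξ s).form p.hm p.hp ξ v v with hcdef
  have hq : ∀ t : ℝ, 0 ≤ 2 * t * b + t ^ 2 * c := by
    intro t
    have h3 := hle _ (hu.addMul hw t)
    rw [hv.good_coefF.form_self_addMul hv.lt.le hu hw, hv.good_coefJ.form_self_addMul hv.lt.le hu hw,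
      h1, h2] at h3
    rw [hb, hcdef]
    linarith
  have hc0 : 0 ≤ c := by
    have := hle v hw
    rw [hcdef]; linarith
  have hb0 : b = 0 := by
    have h3 := hq (-(b / (c + 1)))
    have hc1 : 0 < c + 1 := by linarith
    have e : 2 * -(b / (c + 1)) * b + (-(b / (c + 1))) ^ 2 * c
        = -(b ^ 2 * (c + 2)) / (c + 1) ^ 2 := by field_simp; ring
    rw [e, neg_div, Left.nonneg_neg_iff] at h3
    have h4 : b ^ 2 * (c + 2) ≤ 0 := by
      by_contra! h
      exact absurd h3 (not_le.2 (by positivity))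
    have : b ^ 2 = 0 := by nlinarith [sq_nonneg b]
    exact pow_eq_zero_iff two_ne_zero |>.1 this
  linarith

/-- No growing mode has a vanishing vertical trace at the interface, since `E ≤ 0` if the trace
vanishes. -/
theorem Valid.trace_ne_zero (hv : p.Valid) (hξ : ξ ∈ p.subcritical)
    (hm : p.IsMode ξ (u 0) (u 1) (u 2)) : u 2 0 ≠ 0 := by
  obtain ⟨hu, h1, h2⟩ := hv.forms_of_isMode hξ hm
  intro h
  have h3 := hv.energy_le (ξ := ξ) hu
  rw [h] at h3
  rw [hv.coefF_form hu hu] at h2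
  have := mul_nonneg (hv.lam_pos hξ).le (hv.D_nonneg (ξ := ξ) (u := u))
  have := pow_pos (hv.lam_pos hξ) 2
  simp only [ne_eq, OfNat.ofNat_ne_zero, not_false_eq_true, zero_pow, mul_zero] at h3
  linarith

/-- The gravity term is the only destabilizing one, and it needs a tangential component. -/
theorem Valid.tang_ne_zero (hv : p.Valid) (hξ : ξ ∈ p.subcritical)
    (hm : p.IsMode ξ (u 0) (u 1) (u 2)) : ∃ x ∈ Ioo p.hm p.hp, u 0 x ≠ 0 ∨ u 1 x ≠ 0 := by
  obtain ⟨hu, h1, h2⟩ := hv.forms_of_isMode hξ hm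
  by_contra! h
  have h3 : (p.coefE ξ).form p.hm p.hp ξ u u ≤ 0 := by
    unfold FormCoef.form
    have : ∫ x in Ioo p.hm p.hp, (p.coefE ξ).integrand ξ u u x ≤ 0 :=
      setIntegral_nonpos measurableSet_Ioo fun x hx => by
        have ht : tang ξ u x = 0 := by simp [tang, (h x hx).1, (h x hx).2]
        simp only [FormCoef.integrand, coefE, ht, Pi.zero_apply]
        have := mul_nonneg (mul_nonneg (hv.dP_pos (Ioo_subset_Icc_self hx)).le
          (hv.rho_pos (Ioo_subset_Icc_self hx)).le) (sq_nonneg (dvg ξ u x))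
        linarith
    have h4 : 0 ≤ (p.coefE ξ).κ * (u 2 0 * u 2 0) :=
      mul_nonneg (mul_nonneg hv.ϑ_nonneg (sq_nonneg _)) (mul_self_nonneg _)
    linarith
  rw [hv.coefF_form hu hu] at h2
  have := mul_nonneg (hv.lam_pos hξ).le (hv.D_nonneg (ξ := ξ) (u := u))
  have := pow_pos (hv.lam_pos hξ) 2
  linarith

end RTData

/-! ### Functions with Lipschitz derivatives -/

/-- The class `C^{k,1}` on `[c,d]`, with derivatives up to the boundary. -/
def CLip (c d : ℝ) : ℕ → (ℝ → ℝ) → Prop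
  | 0, f => ∃ K, LipschitzOnWith K f (Icc c d)
  | k + 1, f => ∃ f', (∀ x ∈ Icc c d, HasDerivWithinAt f (f' x) (Icc c d) x) ∧ CLip c d k f'

namespace CLip

variable {c d : ℝ} {f h : ℝ → ℝ} {k : ℕ}

theorem zero_of_deriv {f' : ℝ → ℝ} (hf : ∀ x ∈ Icc c d, HasDerivWithinAt f (f' x) (Icc c d) x)
    (hc : ContinuousOn f' (Icc c d)) : CLip c d 0 f := by
  obtain ⟨C, hC⟩ := isCompact_Icc.exists_bound_of_continuousOn hc
  refine ⟨C.toNNReal, (convex_Icc c d).lipschitzOnWith_of_nnnorm_hasDerivWithin_le hf fun x hx => ?_⟩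
  rw [← NNReal.coe_le_coe, coe_nnnorm]
  exact (hC x hx).trans (Real.le_coe_toNNReal C)

theorem continuousOn : ∀ {k : ℕ} {f : ℝ → ℝ}, CLip c d k f → ContinuousOn f (Icc c d)
  | 0, _, ⟨_, h⟩ => h.continuousOn
  | _ + 1, _, ⟨_, h, _⟩ => fun x hx => (h x hx).continuousWithinAt

theorem of_succ : ∀ {k : ℕ} {f : ℝ → ℝ}, CLip c d (k + 1) f → CLip c d k f
  | 0, _, ⟨_, h, h'⟩ => zero_of_deriv h h'.continuousOn
  | _ + 1, _, ⟨f', h, h'⟩ => ⟨f', h, of_succ h'⟩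

theorem mono {j : ℕ} (hf : CLip c d k f) (hjk : j ≤ k) : CLip c d j f := by
  induction hjk with
  | refl => exact hf
  | step _ ih => exact ih hf.of_succ

theorem const (r : ℝ) : ∀ k, CLip c d k fun _ => r
  | 0 => ⟨0, (LipschitzWith.const r).lipschitzOnWith⟩
  | k + 1 => ⟨fun _ => 0, fun x _ => hasDerivWithinAt_const x _ r, const 0 k⟩

theorem add : ∀ {k : ℕ} {f h : ℝ → ℝ}, CLip c d k f → CLip c d k h → CLip c d k fun x => f x + h x
  | 0, _, _, ⟨_, h1⟩, ⟨_, h2⟩ => ⟨_, h1.add h2⟩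
  | _ + 1, _, _, ⟨f', h1, h1'⟩, ⟨h', h2, h2'⟩ =>
    ⟨fun x => f' x + h' x, fun x hx => (h1 x hx).add (h2 x hx), h1'.add h2'⟩

theorem mul : ∀ {k : ℕ} {f h : ℝ → ℝ}, CLip c d k f → CLip c d k h → CLip c d k fun x => f x * h x
  | 0, f, h, ⟨K, h1⟩, ⟨L, h2⟩ => by
    obtain ⟨C, hC⟩ := isCompact_Icc.exists_bound_of_continuousOn h1.continuousOn
    obtain ⟨D, hD⟩ := isCompact_Icc.exists_bound_of_continuousOn h2.continuousOn
    refine ⟨D.toNNReal * K + C.toNNReal * L, LipschitzOnWith.of_dist_le_mul fun x hx y hy => ?_⟩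
    have e : f x * h x - f y * h y = (f x - f y) * h x + f y * (h x - h y) := by ring
    have d1 := h1.dist_le_mul x hx y hy
    have d2 := h2.dist_le_mul x hx y hy
    have c1 := (hC y hy).trans (Real.le_coe_toNNReal C)
    have c2 := (hD x hx).trans (Real.le_coe_toNNReal D)
    rw [Real.dist_eq] at d1 d2 ⊢
    rw [e]
    refine (abs_add_le _ _).trans ?_
    rw [abs_mul, abs_mul, NNReal.coe_add, NNReal.coe_mul, NNReal.coe_mul, add_mul]
    refine add_le_add ?_ ?_
    · rw [mul_comm, mul_assoc]
      exact mul_le_mul c2 d1 (abs_nonneg _) (by positivity)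
    · rw [mul_assoc]
      exact mul_le_mul c1 d2 (abs_nonneg _) (by positivity)
  | _ + 1, _, _, ⟨f', h1, h1'⟩, ⟨h', h2, h2'⟩ =>
    ⟨_, fun x hx => (h1 x hx).mul (h2 x hx),
      (h1'.mul (of_succ ⟨h', h2, h2'⟩)).add ((of_succ ⟨f', h1, h1'⟩).mul h2')⟩

theorem const_mul (r : ℝ) (hf : CLip c d k f) : CLip c d k fun x => r * f x := (const r k).mul hf

theorem neg (hf : CLip c d k f) : CLip c d k fun x => -f x := by simpa using hf.const_mul (-1)

theorem sub (hf : CLip c d k f) (hh : CLip c d k h) : CLip c d k fun x => f x - h x := by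
  simpa [sub_eq_add_neg] using hf.add hh.neg

theorem comp : ∀ {k : ℕ} {Q f : ℝ → ℝ}, ContDiffOn ℝ (k + 1 : ℕ) Q (Ioi 0) → CLip c d k f →
    (∀ x ∈ Icc c d, 0 < f x) → CLip c d k fun x => Q (f x)
  | 0, Q, f, hQ, ⟨K, hK⟩, hpos => by
    rcases (Icc c d).eq_empty_or_nonempty with he | hne
    · exact ⟨0, by rw [he]; exact fun x hx => hx.elim⟩
    obtain ⟨x1, hx1, hmin⟩ := isCompact_Icc.exists_isMinOn hne hK.continuousOn
    obtain ⟨x2, hx2, hmax⟩ := isCompact_Icc.exists_isMaxOn hne hK.continuousOn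
    have hsub : Icc (f x1) (f x2) ⊆ Ioi 0 := fun t ht => (hpos x1 hx1).trans_le ht.1
    obtain ⟨L, hL⟩ := (hQ.mono hsub).exists_lipschitzOnWith (by simp) (convex_Icc _ _) isCompact_Icc
    exact ⟨L * K, hL.comp hK fun x hx => ⟨hmin hx, hmax hx⟩⟩
  | k + 1, Q, f, hQ, ⟨f', h1, h1'⟩, hpos => by
    refine ⟨fun x => deriv Q (f x) * f' x, fun x hx => ?_, ?_⟩
    · have hd : HasDerivAt Q (deriv Q (f x)) (f x) := ((hQ.differentiableOn (by simp)).differentiableAt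
        (Ioi_mem_nhds (hpos x hx))).hasDerivAt
      exact hd.comp_hasDerivWithinAt x (h1 x hx)
    · refine mul (comp ?_ (of_succ ⟨f', h1, h1'⟩) hpos) h1'
      exact hQ.deriv_of_isOpen isOpen_Ioi (by norm_cast)

theorem inv (hf : CLip c d k f) (hpos : ∀ x ∈ Icc c d, 0 < f x) : CLip c d k fun x => (f x)⁻¹ :=
  comp (Q := fun x => x⁻¹) (contDiffOn_inv ℝ |>.mono fun x hx => (ne_of_gt hx : x ≠ 0)) hf hpos

theorem of_memW3Inf (hcd : c < d) (hf : MemW3Inf c d f) : CLip c d 2 f := by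
  obtain ⟨h, K, hK⟩ := hf
  have hu := uniqueDiffOn_Icc hcd
  refine ⟨derivWithin f (Icc c d), fun x hx =>
    ((h.differentiableOn (by norm_num)) x hx).hasDerivWithinAt,
    derivWithin (derivWithin f (Icc c d)) (Icc c d), fun x hx => ?_, K, ?_⟩
  · have h1 : ContDiffOn ℝ 1 (derivWithin f (Icc c d)) (Icc c d) :=
      h.derivWithin hu (by norm_num)
    exact ((h1.differentiableOn (by norm_num)) x hx).hasDerivWithinAt
  · have e : EqOn (iteratedDerivWithin 2 f (Icc c d))
        (derivWithin (derivWithin f (Icc c d)) (Icc c d)) (Icc c d) := fun x hx => by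
      rw [iteratedDerivWithin_succ]
      congr 1
      funext y
      rw [iteratedDerivWithin_one]
    intro x hx y hy
    rw [← e hx, ← e hy]
    exact hK hx hy

/-- On the open interval the derivatives are the classical ones, and all of them are Lipschitz. -/
theorem lipschitz_iterate_deriv : ∀ {k : ℕ} {f : ℝ → ℝ}, CLip c d k f → ∀ j ≤ k,
    ∃ K, LipschitzOnWith K (deriv^[j] f) (Ioo c d)
  | k, f, hf, 0, _ => by
    obtain ⟨K, hK⟩ := hf.mono (Nat.zero_le k)
    exact ⟨K, hK.mono Ioo_subset_Icc_self⟩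
  | 0, _, _, j + 1, hj => absurd hj (by omega)
  | k + 1, f, ⟨f', h1, h1'⟩, j + 1, hj => by
    obtain ⟨K, hK⟩ := lipschitz_iterate_deriv h1' j (by omega)
    have e : EqOn (deriv f) f' (Ioo c d) := fun x hx =>
      ((h1 x (Ioo_subset_Icc_self hx)).hasDerivAt (Icc_mem_nhds hx.1 hx.2)).deriv
    have e' : ∀ j, EqOn (deriv^[j] (deriv f)) (deriv^[j] f') (Ioo c d) := by
      intro j
      induction j with
      | zero => exact e
      | succ j ih =>
        intro x hx
        rw [Function.iterate_succ_apply', Function.iterate_succ_apply']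
        exact (ih.eventuallyEq_of_mem (isOpen_Ioo.mem_nhds hx)).deriv_eq
    refine ⟨K, fun x hx y hy => ?_⟩
    rw [Function.iterate_succ_apply, e' j hx, e' j hy]
    exact hK hx hy

theorem contDiffOn : ∀ {k : ℕ} {f : ℝ → ℝ}, CLip c d k f → ContDiffOn ℝ k f (Ioo c d)
  | 0, _, hf => by
    simpa [contDiffOn_zero] using hf.continuousOn.mono Ioo_subset_Icc_self
  | k + 1, f, ⟨f', h1, h1'⟩ => by
    have hd : ∀ x ∈ Ioo c d, HasDerivAt f (f' x) x := fun x hx =>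
      (h1 x (Ioo_subset_Icc_self hx)).hasDerivAt (Icc_mem_nhds hx.1 hx.2)
    have := (contDiffOn_succ_iff_deriv_of_isOpen (𝕜 := ℝ) (n := (k : ℕ)) (f := f)
      (isOpen_Ioo (a := c) (b := d))).2 ⟨fun x hx => (hd x hx).differentiableAt.differentiableWithinAt,
        by simp, (contDiffOn h1').congr fun x hx => (hd x hx).deriv⟩
    exact_mod_cast this

end CLip

/-! ### Regularity of weak solutions of the mode equations -/

theorem IsCoef.memLp {a b : ℝ} {c f : ℝ → ℝ} (hc : IsCoef a b c)
    (hf : MemLp f 2 (volume.restrict (Ioo a b))) :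
    MemLp (fun x => c x * f x) 2 (volume.restrict (Ioo a b)) := by
  obtain ⟨C, hC⟩ := hc.2
  refine MemLp.of_le_mul (c := C) hf (hc.1.mul hf.1) ?_
  refine ae_restrict_of_forall_mem measurableSet_Ioo fun x hx => ?_
  rw [norm_mul]
  exact mul_le_mul_of_nonneg_right (hC x hx) (norm_nonneg _)

/-- The lemma of du Bois-Reymond, with a point source at `0`: `N' = -A` on both sides of `0`, and
`N` has the jump `k` there. -/
theorem du_bois_reymond {a b : ℝ} (ha : a < 0) (hb : 0 < b) {A N : ℝ → ℝ} {k : ℝ}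
    (hA : MemLp A 2 (volume.restrict (Ioo a b))) (hN : MemLp N 2 (volume.restrict (Ioo a b)))
    (hw : ∀ w, MemH10 a b w → ∫ x in Ioo a b, (A x * w x - N x * deriv w x) = k * w 0) :
    ∃ r, N =ᵐ[volume.restrict (Ioo a b)]
      fun x => r - (∫ t in a..x, A t) - if x < 0 then k else 0 := by
  have hab := (ha.trans hb).le
  have hAi : IntervalIntegrable A volume a b := (intervalIntegrable_iff_Ioo hab).2 hA.integrableOn_Ioo
  set M : ℝ → ℝ := fun x => ∫ t in a..x, A t with hM
  have hMac : AbsolutelyContinuousOnInterval M a b :=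
    hAi.absolutelyContinuousOnInterval_intervalIntegral left_mem_uIcc
  have hMd : deriv M =ᵐ[volume.restrict (Ioo a b)] A := by
    refine (ae_restrict_iff' measurableSet_Ioo).2 ?_
    filter_upwards [hAi.ae_hasDerivAt_integral] with x hx h
    exact (hx (Icc_subset_uIcc (Ioo_subset_Icc_self h)) a left_mem_uIcc).deriv
  have hMc : ContinuousOn M (Icc a b) := by simpa [uIcc_of_le hab] using hMac.continuousOn
  have hML : MemLp M 2 (volume.restrict (Ioo a b)) := by
    obtain ⟨C, hC⟩ := isCompact_Icc.exists_bound_of_continuousOn hMc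
    exact MemLp.of_bound (hMc.mono Ioo_subset_Icc_self |>.aestronglyMeasurable measurableSet_Ioo) C
      (ae_restrict_of_forall_mem measurableSet_Ioo fun x hx => hC x (Ioo_subset_Icc_self hx))
  set S : ℝ → ℝ := fun x => if x < 0 then k else 0 with hS
  have hSm : Measurable S := Measurable.ite measurableSet_Iio measurable_const measurable_const
  have hSL : MemLp S 2 (volume.restrict (Ioo a b)) :=
    MemLp.of_bound hSm.aestronglyMeasurable |k| (Eventually.of_forall fun x => by
      simp only [hS]; split_ifs <;> simp)
  -- `G` is constant: test with the primitive `w` of `G` minus its mean value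
  set G : ℝ → ℝ := fun x => M x + N x + S x with hG
  have hGL : MemLp G 2 (volume.restrict (Ioo a b)) := (hML.add hN).add hSL
  set m := (∫ x in Ioo a b, G x) / (b - a) with hm
  have hba : 0 < b - a := by linarith
  have hgL : MemLp (fun x => G x - m) 2 (volume.restrict (Ioo a b)) := hGL.sub (memLp_const m)
  have hg0 : ∫ x in Ioo a b, (G x - m) = 0 := by
    rw [integral_sub hGL.integrableOn_Ioo (integrable_const _)]
    simp [hab, hm]
    field_simp
    ring
  obtain ⟨hwH, hwd⟩ := MemH10.of_primitive hab hgL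
    (by rw [intervalIntegral_eq_setIntegral_Ioo hab, hg0])
  set w : ℝ → ℝ := fun x => ∫ t in a..x, (G t - m) with hwdef
  have hwL := hwH.memLp hab
  -- integration by parts turns the hypothesis into `∫ G w' = 0`
  have i1 : ∫ x in Ioo a b, A x * w x = -∫ x in Ioo a b, M x * deriv w x := by
    have h := hMac.integral_mul_deriv_eq_deriv_mul hwH.1
    rw [hwH.2.2.1, hwH.2.2.2, intervalIntegral_eq_setIntegral_Ioo hab,
      intervalIntegral_eq_setIntegral_Ioo hab] at h
    have e : ∫ x in Ioo a b, deriv M x * w x = ∫ x in Ioo a b, A x * w x := by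
      refine integral_congr_ae ?_
      filter_upwards [hMd] with x hx
      rw [hx]
    rw [e] at h
    linarith
  have i2 : k * w 0 = ∫ x in Ioo a b, S x * deriv w x := by
    have h0 : w 0 = ∫ x in Ioo a 0, deriv w x := by
      have := hwH.eq_integral hab (left_mem_Icc.2 hab) (show (0 : ℝ) ∈ Icc a b from ⟨ha.le, hb.le⟩)
      rw [hwH.2.2.1, sub_zero] at this
      rw [this, intervalIntegral_eq_setIntegral_Ioo ha.le]
    have hSw : Integrable (fun x => S x * deriv w x) (volume.restrict (Ioo a b)) :=
      hSL.integrable_mul hwH.2.1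
    rw [(integrableOn_Ioo_split ha hb (hSw.mono_measure (Measure.restrict_mono
      (Ioo_subset_Ioo_right hb.le) le_rfl)) (hSw.mono_measure (Measure.restrict_mono
      (Ioo_subset_Ioo_left ha.le) le_rfl))).2, h0, ← integral_const_mul]
    have z : ∫ x in Ioo 0 b, S x * deriv w x = 0 :=
      setIntegral_eq_zero_of_forall_eq_zero fun x hx => by simp [hS, not_lt.2 hx.1.le]
    rw [z, add_zero]
    exact setIntegral_congr_fun measurableSet_Ioo fun x hx => by simp [hS, hx.2]
  have i3 : ∫ x in Ioo a b, G x * deriv w x = 0 := by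
    have h := hw w hwH
    have j1 : Integrable (fun x => A x * w x) (volume.restrict (Ioo a b)) := hA.integrable_mul hwL
    have j2 : Integrable (fun x => N x * deriv w x) (volume.restrict (Ioo a b)) :=
      hN.integrable_mul hwH.2.1
    have j3 : Integrable (fun x => M x * deriv w x) (volume.restrict (Ioo a b)) :=
      hML.integrable_mul hwH.2.1
    have j4 : Integrable (fun x => S x * deriv w x) (volume.restrict (Ioo a b)) :=
      hSL.integrable_mul hwH.2.1
    rw [integral_sub j1 j2, i1, i2] at h
    have e : ∀ x, G x * deriv w x = M x * deriv w x + 1 * (N x * deriv w x)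
        + 1 * (S x * deriv w x) := fun x => by simp only [hG]; ring
    simp_rw [e]
    rw [integral_add_mul_add_mul j3 j2 j4]
    linarith
  have i4 : ∫ x in Ioo a b, (G x - m) ^ 2 = 0 := by
    have e : ∫ x in Ioo a b, (G x - m) ^ 2 = ∫ x in Ioo a b, (G x * deriv w x - m * (G x - m)) := by
      refine integral_congr_ae ?_
      filter_upwards [hwd] with x hx
      simp only [hx]; ring
    have j1 : Integrable (fun x => G x * deriv w x) (volume.restrict (Ioo a b)) :=
      hGL.integrable_mul hwH.2.1
    rw [e, integral_sub j1 (hgL.integrableOn_Ioo.const_mul m), i3,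
      integral_const_mul, hg0]
    simp
  refine ⟨m, ?_⟩
  have h := (integral_eq_zero_iff_of_nonneg (fun x => sq_nonneg _) hgL.integrable_sq).1 i4
  filter_upwards [h] with x hx
  have h2 : G x - m = 0 := pow_eq_zero_iff two_ne_zero |>.1 hx
  simp only [hG, hS, hM] at h2 ⊢
  linarith

/-- A primitive of a function that agrees almost everywhere with a continuous one is continuously
differentiable up to the boundary. -/
theorem hasDerivWithinAt_of_ae {c d : ℝ} (hcd : c ≤ d) {f f' h : ℝ → ℝ}
    (hf : ∀ x ∈ Icc c d, f x - f c = ∫ t in c..x, f' t)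
    (he : f' =ᵐ[volume.restrict (Ioo c d)] h) (hc : ContinuousOn h (Icc c d)) :
    ∀ x ∈ Icc c d, HasDerivWithinAt f (h x) (Icc c d) x := by
  intro x hx
  set H : ℝ → ℝ := IccExtend hcd ((Icc c d).domRestrict h) with hH
  have hHc : Continuous H := hc.domRestrict.Icc_extend'
  have hHe : EqOn H h (Icc c d) := fun y hy => by simp [hH, IccExtend_of_mem _ _ hy]
  have h1 : HasDerivAt (fun y => f c + ∫ t in c..y, H t) (H x) x :=
    ((hHc.integral_hasStrictDerivAt c x).hasDerivAt).const_add (f c)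
  rw [hHe hx] at h1
  refine h1.hasDerivWithinAt.congr_of_mem (fun y hy => ?_) hx
  have h2 : ∫ t in c..y, H t = ∫ t in c..y, f' t := by
    rw [intervalIntegral_eq_setIntegral_Ioo hy.1, intervalIntegral_eq_setIntegral_Ioo hy.1]
    refine integral_congr_ae ?_
    have hs : Ioo c y ⊆ Ioo c d := Ioo_subset_Ioo_right hy.2
    filter_upwards [ae_restrict_of_ae_restrict_of_subset hs he, ae_restrict_mem measurableSet_Ioo]
      with t ht hty
    rw [ht, hHe (Ioo_subset_Icc_self (hs hty))]
  rw [h2, ← hf y hy]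
  ring

/-- The first-order system for the displacement `u = (φ, θ, ψ)` and the fluxes `n` of a mode in one
of the fluids; `q = P'(ρ)`, and `s` is the growth rate. -/
structure ModeSystem (g s μ ς : ℝ) (ξ : EuclideanSpace ℝ (Fin 2)) where
  q : ℝ → ℝ
  ρ : ℝ → ℝ
  u : Fin 3 → ℝ → ℝ
  n : Fin 3 → ℝ → ℝ

namespace ModeSystem

variable {g s μ ς : ℝ} {ξ : EuclideanSpace ℝ (Fin 2)} (S : ModeSystem g s μ ς ξ)

/-- The coefficient of `ψ'` in the normal flux. -/
def lead (x : ℝ) : ℝ := S.q x * S.ρ x + s * ς + 4 / 3 * (s * μ)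

/-- The derivatives of `φ`, `θ`, `ψ` in terms of the fluxes. -/
def du (i : Fin 3) (x : ℝ) : ℝ :=
  ![(s * μ)⁻¹ * S.n 0 x + ξ 0 * S.u 2 x,
    (s * μ)⁻¹ * S.n 1 x + ξ 1 * S.u 2 x,
    (S.n 2 x - (S.q x * S.ρ x + (s * ς - 2 / 3 * (s * μ))) * (ξ 0 * S.u 0 x + ξ 1 * S.u 1 x))
      * (S.lead x)⁻¹] i

/-- The divergence. -/
def X (x : ℝ) : ℝ := ξ 0 * S.u 0 x + ξ 1 * S.u 1 x + S.du 2 x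

/-- The derivatives of the fluxes. -/
def dn (i : Fin 3) (x : ℝ) : ℝ :=
  ![s ^ 2 * (S.ρ x * S.u 0 x) - g * ξ 0 * (S.ρ x * S.u 2 x)
      + (S.q x * S.ρ x + (s * ς + s * μ / 3)) * (ξ 0 * S.X x)
      + s * μ * (ξ 1 * (ξ 1 * S.u 0 x - ξ 0 * S.u 1 x)
        + ξ 0 * (ξ 0 * S.u 0 x + ξ 1 * S.u 1 x - S.du 2 x)),
    s ^ 2 * (S.ρ x * S.u 1 x) - g * ξ 1 * (S.ρ x * S.u 2 x)
      + (S.q x * S.ρ x + (s * ς + s * μ / 3)) * (ξ 1 * S.X x)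
      + s * μ * (-ξ 0 * (ξ 1 * S.u 0 x - ξ 0 * S.u 1 x)
        + ξ 1 * (ξ 0 * S.u 0 x + ξ 1 * S.u 1 x - S.du 2 x)),
    s ^ 2 * (S.ρ x * S.u 2 x) - g * (S.ρ x * (ξ 0 * S.u 0 x + ξ 1 * S.u 1 x))
      - s * μ * (ξ 0 * (S.du 0 x - ξ 0 * S.u 2 x) + ξ 1 * (S.du 1 x - ξ 1 * S.u 2 x))] i

variable {S} {c d : ℝ} {k : ℕ}

theorem clip_lead (hq : CLip c d k S.q) (hρ : CLip c d k S.ρ) : CLip c d k S.lead :=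
  ((hq.mul hρ).add (CLip.const _ k)).add (CLip.const _ k)

theorem clip_du (hq : CLip c d k S.q) (hρ : CLip c d k S.ρ) (hl : ∀ x ∈ Icc c d, 0 < S.lead x)
    (hu : ∀ i, CLip c d k (S.u i)) (hn : ∀ i, CLip c d k (S.n i)) (i : Fin 3) :
    CLip c d k (S.du i) := by
  fin_cases i
  · exact ((hn 0).const_mul _).add ((hu 2).const_mul _)
  · exact ((hn 1).const_mul _).add ((hu 2).const_mul _)
  · exact ((hn 2).sub (((hq.mul hρ).add (CLip.const _ k)).mul
      (((hu 0).const_mul _).add ((hu 1).const_mul _)))).mul ((clip_lead hq hρ).inv hl)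

theorem clip_dn (hq : CLip c d k S.q) (hρ : CLip c d k S.ρ) (hl : ∀ x ∈ Icc c d, 0 < S.lead x)
    (hu : ∀ i, CLip c d k (S.u i)) (hn : ∀ i, CLip c d k (S.n i)) (i : Fin 3) :
    CLip c d k (S.dn i) := by
  have hdu := clip_du hq hρ hl hu hn
  have hT := ((hu 0).const_mul (ξ 0)).add ((hu 1).const_mul (ξ 1))
  have hX : CLip c d k S.X := hT.add (hdu 2)
  have hB : ∀ r : ℝ, CLip c d k fun x => S.q x * S.ρ x + r := fun r => (hq.mul hρ).add (CLip.const r k)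
  have hR := ((hu 0).const_mul (ξ 1)).sub ((hu 1).const_mul (ξ 0))
  fin_cases i
  · exact ((((hρ.mul (hu 0)).const_mul _).sub ((hρ.mul (hu 2)).const_mul _)).add
      ((hB _).mul (hX.const_mul _))).add (((hR.const_mul _).add
        ((hT.sub (hdu 2)).const_mul _)).const_mul _)
  · exact ((((hρ.mul (hu 1)).const_mul _).sub ((hρ.mul (hu 2)).const_mul _)).add
      ((hB _).mul (hX.const_mul _))).add (((hR.const_mul _).add
        ((hT.sub (hdu 2)).const_mul _)).const_mul _)
  · exact (((hρ.mul (hu 2)).const_mul _).sub ((hρ.mul hT).const_mul _)).sub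
      (((((hdu 0).sub ((hu 2).const_mul _)).const_mul _).add
        (((hdu 1).sub ((hu 2).const_mul _)).const_mul _)).const_mul _)

/-- The bootstrap: a linear system with `C^{2,1}` coefficients has `C^{3,1}` solutions. -/
theorem clip_three (hq : CLip c d 2 S.q) (hρ : CLip c d 2 S.ρ) (hl : ∀ x ∈ Icc c d, 0 < S.lead x)
    (hu0 : ∀ i, CLip c d 0 (S.u i)) (hn0 : ∀ i, CLip c d 0 (S.n i))
    (hu : ∀ i, ∀ x ∈ Icc c d, HasDerivWithinAt (S.u i) (S.du i x) (Icc c d) x)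
    (hn : ∀ i, ∀ x ∈ Icc c d, HasDerivWithinAt (S.n i) (S.dn i x) (Icc c d) x) :
    ∀ k ≤ 3, (∀ i, CLip c d k (S.u i)) ∧ ∀ i, CLip c d k (S.n i) := by
  intro k hk
  induction k with
  | zero => exact ⟨hu0, hn0⟩
  | succ k ih =>
    obtain ⟨h1, h2⟩ := ih (by omega)
    have hq' := hq.mono (show k ≤ 2 by omega)
    have hρ' := hρ.mono (show k ≤ 2 by omega)
    exact ⟨fun i => ⟨_, hu i, clip_du hq' hρ' hl h1 h2 i⟩,
      fun i => ⟨_, hn i, clip_dn hq' hρ' hl h1 h2 i⟩⟩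

end ModeSystem

/-! ### The mode equations on both sides of the interface -/

namespace ModeSystem

variable {g s μ ς : ℝ} {ξ : EuclideanSpace ℝ (Fin 2)}

/-- `S` is a solution of class `C^{3,1}` on `[c,d]`. -/
structure SolvesOn (S : ModeSystem g s μ ς ξ) (c d : ℝ) : Prop where
  clip_u : ∀ i, CLip c d 3 (S.u i)
  clip_n : ∀ i, CLip c d 3 (S.n i)
  deriv_u : ∀ i, ∀ x ∈ Icc c d, HasDerivWithinAt (S.u i) (S.du i x) (Icc c d) x
  deriv_n : ∀ i, ∀ x ∈ Icc c d, HasDerivWithinAt (S.n i) (S.dn i x) (Icc c d) x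

variable {S : ModeSystem g s μ ς ξ} {c d : ℝ}

theorem continuousOn_du (hq : ContinuousOn S.q (Icc c d)) (hρ : ContinuousOn S.ρ (Icc c d))
    (hl : ∀ x ∈ Icc c d, 0 < S.lead x) (hu : ∀ i, ContinuousOn (S.u i) (Icc c d))
    (hn : ∀ i, ContinuousOn (S.n i) (Icc c d)) (i : Fin 3) : ContinuousOn (S.du i) (Icc c d) := by
  have hli : ContinuousOn (fun x => (S.lead x)⁻¹) (Icc c d) :=
    ((hq.mul hρ).add continuousOn_const |>.add continuousOn_const).inv₀ fun x hx => (hl x hx).ne'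
  have u0 := hu 0
  have u1 := hu 1
  have u2 := hu 2
  have n0 := hn 0
  have n1 := hn 1
  have n2 := hn 2
  fin_cases i
  · change ContinuousOn (fun x => (s * μ)⁻¹ * S.n 0 x + ξ 0 * S.u 2 x) _
    fun_prop
  · change ContinuousOn (fun x => (s * μ)⁻¹ * S.n 1 x + ξ 1 * S.u 2 x) _
    fun_prop
  · change ContinuousOn (fun x => (S.n 2 x - (S.q x * S.ρ x + (s * ς - 2 / 3 * (s * μ))) *
      (ξ 0 * S.u 0 x + ξ 1 * S.u 1 x)) * (S.lead x)⁻¹) _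
    fun_prop

theorem continuousOn_dn (hq : ContinuousOn S.q (Icc c d)) (hρ : ContinuousOn S.ρ (Icc c d))
    (hu : ∀ i, ContinuousOn (S.u i) (Icc c d))
    (hdu : ∀ i, ContinuousOn (S.du i) (Icc c d)) (i : Fin 3) : ContinuousOn (S.dn i) (Icc c d) := by
  have u0 := hu 0
  have u1 := hu 1
  have u2 := hu 2
  have d0 := hdu 0
  have d1 := hdu 1
  have d2 := hdu 2
  have hX : ContinuousOn S.X (Icc c d) := by
    change ContinuousOn (fun x => ξ 0 * S.u 0 x + ξ 1 * S.u 1 x + S.du 2 x) _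
    fun_prop
  unfold dn
  fin_cases i <;> simp only [Fin.zero_eta, Fin.mk_one, Fin.reduceFinMk, Matrix.cons_val] <;> fun_prop

end ModeSystem

namespace RTData

variable {p : RTData} {ξ : EuclideanSpace ℝ (Fin 2)} {u v : Fin 3 → ℝ → ℝ} {s : ℝ}

/-- The fluxes in the weak form of the mode equations. -/
def flux (p : RTData) (ξ : EuclideanSpace ℝ (Fin 2)) (s : ℝ) (u : Fin 3 → ℝ → ℝ) (i : Fin 3)
    (x : ℝ) : ℝ :=
  ![p.mu x * (s * (deriv (u 0) x - ξ 0 * u 2 x)),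
    p.mu x * (s * (deriv (u 1) x - ξ 1 * u 2 x)),
    p.dP x * (p.rho x * dvg ξ u x) + p.bulk x * (s * dvg ξ u x)
      + p.mu x * (s * (-(tang ξ u x - deriv (u 2) x) + 3⁻¹ * dvg ξ u x))] i

/-- The zeroth order terms in the weak form of the mode equations. -/
def source (p : RTData) (ξ : EuclideanSpace ℝ (Fin 2)) (s : ℝ) (u : Fin 3 → ℝ → ℝ) (i : Fin 3)
    (x : ℝ) : ℝ :=
  ![p.rho x * (p.g * ξ 0 * u 2 x) - p.dP x * (p.rho x * (ξ 0 * dvg ξ u x))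
      - p.bulk x * (s * ξ 0 * dvg ξ u x)
      - p.mu x * (s * (ξ 1 * (ξ 1 * u 0 x - ξ 0 * u 1 x) + ξ 0 * (tang ξ u x - deriv (u 2) x)
        + 3⁻¹ * (ξ 0 * dvg ξ u x)))
      - p.rho x * (s ^ 2 * u 0 x),
    p.rho x * (p.g * ξ 1 * u 2 x) - p.dP x * (p.rho x * (ξ 1 * dvg ξ u x))
      - p.bulk x * (s * ξ 1 * dvg ξ u x)
      - p.mu x * (s * (-ξ 0 * (ξ 1 * u 0 x - ξ 0 * u 1 x) + ξ 1 * (tang ξ u x - deriv (u 2) x)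
        + 3⁻¹ * (ξ 1 * dvg ξ u x)))
      - p.rho x * (s ^ 2 * u 1 x),
    p.rho x * (p.g * tang ξ u x)
      + p.mu x * (s * (ξ 0 * (deriv (u 0) x - ξ 0 * u 2 x) + ξ 1 * (deriv (u 1) x - ξ 1 * u 2 x)))
      - p.rho x * (s ^ 2 * u 2 x)] i

theorem integrand_eq_source_flux (x : ℝ) :
    (p.coefF ξ s).integrand ξ u v x - s ^ 2 * p.coefJ.integrand ξ u v x
      = ∑ i, (p.source ξ s u i x * v i x - p.flux ξ s u i x * deriv (v i) x) := by
  rw [Fin.sum_univ_three]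
  simp only [FormCoef.integrand, coefF, coefE, coefD, coefJ, FormCoef.mass, FormCoef.comb, source,
    flux, Matrix.cons_val, Pi.zero_apply]
  simp only [dvg, tang]
  ring

theorem Valid.memLp_flux (hv : p.Valid) (hu : H3 p.hm p.hp u) (i : Fin 3) :
    MemLp (p.flux ξ s u i) 2 (volume.restrict (Ioo p.hm p.hp)) := by
  have hab := hv.lt.le
  have m := fun i => (hu i).memLp hab
  have d := fun i => (hu i).2.1
  have T := hu.memLp_tang (ξ := ξ) hab
  have X := hu.memLp_dvg (ξ := ξ) hab
  unfold flux
  fin_cases i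
  · exact hv.isCoef_mu.memLp (((d 0).sub ((m 2).const_mul _)).const_mul s)
  · exact hv.isCoef_mu.memLp (((d 1).sub ((m 2).const_mul _)).const_mul s)
  · exact ((hv.isCoef_dP.memLp (hv.isCoef_rho.memLp X)).add
      (hv.isCoef_bulk.memLp (X.const_mul s))).add (hv.isCoef_mu.memLp
        (((T.sub (d 2)).neg.add (X.const_mul 3⁻¹)).const_mul s))

theorem Valid.memLp_source (hv : p.Valid) (hu : H3 p.hm p.hp u) (i : Fin 3) :
    MemLp (p.source ξ s u i) 2 (volume.restrict (Ioo p.hm p.hp)) := by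
  have hab := hv.lt.le
  have m := fun i => (hu i).memLp hab
  have d := fun i => (hu i).2.1
  have T := hu.memLp_tang (ξ := ξ) hab
  have X := hu.memLp_dvg (ξ := ξ) hab
  have R := ((m 0).const_mul (ξ 1)).sub ((m 1).const_mul (ξ 0))
  have r := hv.isCoef_rho
  unfold source
  fin_cases i
  · exact ((((r.memLp ((m 2).const_mul _)).sub (hv.isCoef_dP.memLp (r.memLp (X.const_mul _)))).sub
      (hv.isCoef_bulk.memLp (X.const_mul _))).sub (hv.isCoef_mu.memLp ((((R.const_mul _).add
        ((T.sub (d 2)).const_mul _)).add ((X.const_mul _).const_mul _)).const_mul _))).sub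
        (r.memLp ((m 0).const_mul _))
  · exact ((((r.memLp ((m 2).const_mul _)).sub (hv.isCoef_dP.memLp (r.memLp (X.const_mul _)))).sub
      (hv.isCoef_bulk.memLp (X.const_mul _))).sub (hv.isCoef_mu.memLp ((((R.const_mul _).add
        ((T.sub (d 2)).const_mul _)).add ((X.const_mul _).const_mul _)).const_mul _))).sub
        (r.memLp ((m 1).const_mul _))
  · exact ((r.memLp (T.const_mul _)).add (hv.isCoef_mu.memLp
      (((((d 0).sub ((m 2).const_mul _)).const_mul _).add
        (((d 1).sub ((m 2).const_mul _)).const_mul _)).const_mul _))).sub (r.memLp ((m 2).const_mul _))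

/-- The weak form of the mode equations, one component at a time. -/
theorem Valid.weak_component (hv : p.Valid) (hξ : ξ ∈ p.subcritical)
    (hm : p.IsMode ξ (u 0) (u 1) (u 2)) (i : Fin 3) {w : ℝ → ℝ} (hw : MemH10 p.hm p.hp w) :
    ∫ x in Ioo p.hm p.hp, (p.source ξ (p.lam ξ) u i x * w x - p.flux ξ (p.lam ξ) u i x * deriv w x)
      = (if i = 2 then p.ϑ * ‖ξ‖ ^ 2 * u 2 0 else 0) * w 0 := by
  obtain ⟨hu, -, -⟩ := hv.forms_of_isMode hξ hm
  set v : Fin 3 → ℝ → ℝ := Function.update (fun _ _ => 0) i w with hvdef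
  have hvi : v i = w := by simp [hvdef]
  have hvj : ∀ j, j ≠ i → v j = fun _ => 0 := fun j hj => by simp [hvdef, hj]
  have hv3 : H3 p.hm p.hp v := fun j => by
    by_cases hj : j = i
    · rw [hj, hvi]; exact hw
    · rw [hvj j hj]; exact MemH10.zero
  have h := hv.euler_lagrange hξ hm hv3
  unfold FormCoef.form at h
  have e : ∀ x, p.source ξ (p.lam ξ) u i x * w x - p.flux ξ (p.lam ξ) u i x * deriv w x
      = (p.coefF ξ (p.lam ξ)).integrand ξ u v x
        - p.lam ξ ^ 2 * p.coefJ.integrand ξ u v x := by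
    intro x
    rw [integrand_eq_source_flux, Finset.sum_eq_single i]
    · rw [hvi]
    · intro j _ hj
      simp [hvj j hj]
    · simp
  simp_rw [e]
  rw [integral_sub (hv.good_coefF.integrable hv.lt.le hu hv3)
    ((hv.good_coefJ.integrable hv.lt.le hu hv3).const_mul _), integral_const_mul]
  have k1 : (p.coefF ξ (p.lam ξ)).κ = p.ϑ * ‖ξ‖ ^ 2 := by
    simp [coefF, coefE, coefD, FormCoef.comb]
  have k2 : p.coefJ.κ = 0 := rfl
  rw [k1, k2] at h
  have e2 : (if i = 2 then p.ϑ * ‖ξ‖ ^ 2 * u 2 0 else 0) * w 0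
      = p.ϑ * ‖ξ‖ ^ 2 * (u 2 0 * v 2 0) := by
    split_ifs with hi
    · rw [← hvi, hi]; ring
    · rw [hvj 2 (Ne.symm hi)]; ring
  rw [e2]
  linarith

/-- On one side of the interface, the fluxes and displacements of a mode solve the first-order
system, and are therefore smooth. -/
theorem solvesOn_of_flux {c d μ ς : ℝ} {P ρ : ℝ → ℝ} {n : Fin 3 → ℝ → ℝ} (hv : p.Valid)
    (hu : H3 p.hm p.hp u) (hs : 0 < s) (hcd : c < d) (hc : p.hm ≤ c) (hd : d ≤ p.hp) (hμ : 0 < μ)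
    (hς : 0 < ς) (hf : SideFacts p.g c d P ρ) (hρ : MemW3Inf c d ρ)
    (hP : ContDiffOn ℝ 4 P (Ioi 0))
    (hcoef : ∀ x ∈ Ioo c d, p.rho x = ρ x ∧ p.dP x = deriv P (ρ x) ∧ p.mu x = μ ∧ p.bulk x = ς)
    (hn : ∀ i, n i =ᵐ[volume.restrict (Ioo c d)] p.flux ξ s u i)
    (hn' : ∀ i, ∀ x ∈ Icc c d, n i x - n i c = ∫ t in c..x, -p.source ξ s u i t) :
    (⟨fun x => deriv P (ρ x), ρ, u, n⟩ : ModeSystem p.g s μ ς ξ).SolvesOn c d := by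
  set S : ModeSystem p.g s μ ς ξ := ⟨fun x => deriv P (ρ x), ρ, u, n⟩ with hS
  have hq : ContinuousOn S.q (Icc c d) := hf.dP_continuousOn
  have hρc : ContinuousOn S.ρ (Icc c d) := hf.contDiffOn.continuousOn
  have hl : ∀ x ∈ Icc c d, 0 < S.lead x := fun x hx => by
    have h1 := hf.dP_pos x hx
    have h2 := hf.pos x hx
    change 0 < deriv P (ρ x) * ρ x + s * ς + 4 / 3 * (s * μ)
    positivity
  have huc : ∀ i, ContinuousOn (S.u i) (Icc c d) := fun i =>
    ((hu i).continuousOn hv.lt.le).mono (Icc_subset_Icc hc hd)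
  have hsub : Ioo c d ⊆ Ioo p.hm p.hp := Ioo_subset_Ioo hc hd
  have hncont : ∀ i, ContinuousOn (S.n i) (Icc c d) := fun i => by
    have hi : IntervalIntegrable (fun t => -p.source ξ s u i t) volume c d :=
      (intervalIntegrable_iff_Ioo hcd.le).2
        (memLp_two_mono (hv.memLp_source (ξ := ξ) (s := s) hu i) hsub).neg.integrableOn_Ioo
    have h1 : ContinuousOn (fun x => n i c + ∫ t in c..x, -p.source ξ s u i t) (Icc c d) := by
      have := intervalIntegral.continuousOn_primitive_interval' hi left_mem_uIcc
      rw [uIcc_of_le hcd.le] at this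
      exact continuousOn_const.add this
    exact h1.congr fun x hx => by
      have := hn' i x hx
      change n i x = _
      linarith
  have hdu := ModeSystem.continuousOn_du hq hρc hl huc hncont
  have hdn := ModeSystem.continuousOn_dn hq hρc huc hdu
  have hsm : s * μ ≠ 0 := (mul_pos hs hμ).ne'
  have hae : ∀ᵐ x ∂volume.restrict (Ioo c d), (∀ i, deriv (u i) x = S.du i x) ∧
      ∀ i, -p.source ξ s u i x = S.dn i x := by
    filter_upwards [hn 0, hn 1, hn 2, ae_restrict_mem measurableSet_Ioo] with x h0 h1 h2 hx
    obtain ⟨cρ, cP, cμ, cς⟩ := hcoef x hx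
    have hlx := (hl x (Ioo_subset_Icc_self hx)).ne'
    simp only [flux, cρ, cP, cμ, cς, Matrix.cons_val] at h0 h1 h2
    have d0 : deriv (u 0) x = S.du 0 x := by
      simp only [ModeSystem.du, Matrix.cons_val, hS, h0]
      field_simp
      ring
    have d1 : deriv (u 1) x = S.du 1 x := by
      simp only [ModeSystem.du, Matrix.cons_val, hS, h1]
      field_simp
      ring
    have d2 : deriv (u 2) x = S.du 2 x := by
      simp only [ModeSystem.du, Matrix.cons_val]
      rw [← div_eq_mul_inv, eq_div_iff hlx]
      simp only [ModeSystem.lead, hS, h2, dvg, tang]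
      ring
    have hd : ∀ i, deriv (u i) x = S.du i x := by
      intro i
      fin_cases i
      exacts [d0, d1, d2]
    refine ⟨hd, fun i => ?_⟩
    have hX : dvg ξ u x = S.X x := by simp only [dvg, tang, d2, ModeSystem.X, hS]
    fin_cases i
    · simp only [source, ModeSystem.dn, cρ, cP, cμ, cς, Fin.zero_eta, Matrix.cons_val, d2, hX]
      simp only [hS, tang]
      ring
    · simp only [source, ModeSystem.dn, cρ, cP, cμ, cς, Fin.mk_one, Matrix.cons_val, d2, hX]
      simp only [hS, tang]
      ring
    · simp only [source, ModeSystem.dn, cρ, cP, cμ, cς, Fin.reduceFinMk, Matrix.cons_val, d0, d1,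
        hX]
      simp only [hS, tang]
      ring
  have hdu' : ∀ i, ∀ x ∈ Icc c d, HasDerivWithinAt (S.u i) (S.du i x) (Icc c d) x := fun i =>
    hasDerivWithinAt_of_ae hcd.le (fun x hx => (hu i).eq_integral hv.lt.le
      ⟨hc, hcd.le.trans hd⟩ ⟨hc.trans hx.1, hx.2.trans hd⟩) (hae.mono fun x hx => hx.1 i) (hdu i)
  have hdn' : ∀ i, ∀ x ∈ Icc c d, HasDerivWithinAt (S.n i) (S.dn i x) (Icc c d) x := fun i =>
    hasDerivWithinAt_of_ae hcd.le (hn' i) (hae.mono fun x hx => hx.2 i) (hdn i)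
  have hρ2 : CLip c d 2 S.ρ := CLip.of_memW3Inf hcd hρ
  have hq2 : CLip c d 2 S.q := CLip.comp (k := 2) (Q := deriv P) (f := ρ)
    (hP.deriv_of_isOpen isOpen_Ioi (by norm_num)) hρ2 hf.pos
  have h3 := ModeSystem.clip_three hq2 hρ2 hl (fun i => CLip.zero_of_deriv (hdu' i) (hdu i))
    (fun i => CLip.zero_of_deriv (hdn' i) (hdn i)) hdu' hdn' 3 le_rfl
  exact ⟨h3.1, h3.2, hdu', hdn'⟩

/-- The first-order system of a mode in the upper fluid. -/
def upperSystem (p : RTData) (ξ : EuclideanSpace ℝ (Fin 2)) (s : ℝ) (u n : Fin 3 → ℝ → ℝ) :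
    ModeSystem p.g s p.μp p.ςp ξ := ⟨fun x => deriv p.Pp (p.ρp x), p.ρp, u, n⟩

/-- The first-order system of a mode in the lower fluid. -/
def lowerSystem (p : RTData) (ξ : EuclideanSpace ℝ (Fin 2)) (s : ℝ) (u n : Fin 3 → ℝ → ℝ) :
    ModeSystem p.g s p.μm p.ςm ξ := ⟨fun x => deriv p.Pm (p.ρm x), p.ρm, u, n⟩

/-- Regularity of growing modes: they solve the mode equations classically on both sides of the
interface, and the normal flux jumps by the surface tension term. -/
theorem Valid.mode_regular (hv : p.Valid) (hξ : ξ ∈ p.subcritical)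
    (hm : p.IsMode ξ (u 0) (u 1) (u 2)) : ∃ n m : Fin 3 → ℝ → ℝ,
      (p.upperSystem ξ (p.lam ξ) u n).SolvesOn 0 p.hp ∧
      (p.lowerSystem ξ (p.lam ξ) u m).SolvesOn p.hm 0 ∧
      ∀ i, n i 0 - m i 0 = if i = 2 then p.ϑ * ‖ξ‖ ^ 2 * u 2 0 else 0 := by
  obtain ⟨hu, -, -⟩ := hv.forms_of_isMode hξ hm
  have hs := hv.lam_pos hξ
  set s := p.lam ξ
  have hdb := fun i => du_bois_reymond hv.hm_neg hv.hp_pos (hv.memLp_source (ξ := ξ) (s := s) hu i)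
    (hv.memLp_flux (ξ := ξ) (s := s) hu i) fun w hw => hv.weak_component hξ hm i hw
  choose r hr using hdb
  have hint : ∀ i, ∀ x ∈ Icc p.hm p.hp,
      IntervalIntegrable (p.source ξ s u i) volume p.hm x := fun i x hx =>
    (intervalIntegrable_iff_Ioo hx.1).2 (memLp_two_mono (hv.memLp_source hu i)
      (Ioo_subset_Ioo_right hx.2)).integrableOn_Ioo
  have hdiff : ∀ i, ∀ x ∈ Icc p.hm p.hp, ∀ y ∈ Icc p.hm p.hp,
      (-∫ t in p.hm..x, p.source ξ s u i t) - (-∫ t in p.hm..y, p.source ξ s u i t)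
        = ∫ t in y..x, -p.source ξ s u i t := fun i x hx y hy => by
    rw [intervalIntegral.integral_neg,
      ← intervalIntegral.integral_interval_sub_left (hint i x hx) (hint i y hy)]
    ring
  refine ⟨fun i x => r i - ∫ t in p.hm..x, p.source ξ s u i t,
    fun i x => r i - (∫ t in p.hm..x, p.source ξ s u i t)
      - if i = 2 then p.ϑ * ‖ξ‖ ^ 2 * u 2 0 else 0, ?_, ?_, fun i => by simp⟩
  · refine solvesOn_of_flux hv hu hs hv.hp_pos hv.hm_neg.le le_rfl hv.μp_pos hv.ςp_pos hv.upperFacts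
      hv.ρp_smooth hv.Pp_smooth (fun x hx => by simp [rho, dP, mu, bulk, hx.1]) (fun i => ?_)
      fun i x hx => ?_
    · have h := ae_restrict_of_ae_restrict_of_subset (Ioo_subset_Ioo_left hv.hm_neg.le) (hr i)
      filter_upwards [h, ae_restrict_mem measurableSet_Ioo] with x hx hx0
      rw [hx, if_neg (not_lt.2 hx0.1.le), sub_zero]
    · rw [← hdiff i x ⟨hv.hm_neg.le.trans hx.1, hx.2⟩ 0 hv.zero_mem]
      ring
  · refine solvesOn_of_flux hv hu hs hv.hm_neg le_rfl hv.hp_pos.le hv.μm_pos hv.ςm_pos hv.lowerFacts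
      hv.ρm_smooth hv.Pm_smooth (fun x hx => by simp [rho, dP, mu, bulk, not_lt.2 hx.2.le])
      (fun i => ?_) fun i x hx => ?_
    · have h := ae_restrict_of_ae_restrict_of_subset (Ioo_subset_Ioo_right hv.hp_pos.le) (hr i)
      filter_upwards [h, ae_restrict_mem measurableSet_Ioo] with x hx hx0
      rw [hx, if_pos hx0.2]
    · rw [← hdiff i x ⟨hx.1, hx.2.trans hv.hp_pos.le⟩ p.hm ⟨le_rfl, hv.lt.le⟩]
      ring

end RTData

/-! ### The real form of the combined mode -/

/-- The phase `y_h · ξ`. -/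
def phase (ξ : EuclideanSpace ℝ (Fin 2)) (y : Pt) : ℝ := y 0 * ξ 0 + y 1 * ξ 1

/-- The horizontal profiles of the three components of the combined mode. -/
def wave (i : Fin 3) : ℝ → ℝ := ![Real.sin, Real.sin, Real.cos] i

/-- The real field with components `a uᵢ(y₃) sin(y_h · ξ)`, `i = 1, 2`, and
`a u₃(y₃) cos(y_h · ξ)`. -/
def modeField (a : ℝ) (ξ : EuclideanSpace ℝ (Fin 2)) (u : Fin 3 → ℝ → ℝ) : VField :=
  fun y i => a * u i (y 2) * wave i (phase ξ y)

theorem planeWave_eq (ξ : EuclideanSpace ℝ (Fin 2)) (y : Pt) :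
    planeWave ξ y = (Real.cos (phase ξ y) : ℂ) + Real.sin (phase ξ y) * Complex.I := by
  rw [planeWave, mul_comm, Complex.exp_mul_I, ← phase]
  push_cast
  rfl

theorem planeWave_neg (ξ : EuclideanSpace ℝ (Fin 2)) (y : Pt) :
    planeWave (-ξ) y = (Real.cos (phase ξ y) : ℂ) - Real.sin (phase ξ y) * Complex.I := by
  have e : phase (-ξ) y = -phase ξ y := by simp [phase]; ring
  rw [planeWave_eq, e, Real.cos_neg, Real.sin_neg]
  push_cast
  ring

theorem uTildeC_eq (ξ : EuclideanSpace ℝ (Fin 2)) (u : Fin 3 → ℝ → ℝ) (y : Pt) (i : Fin 3) :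
    uTildeC ξ (u 0) (u 1) (u 2) y i = (modeField 2 ξ u y i : ℂ) := by
  have hI : Complex.I * Complex.I = -1 := Complex.I_mul_I
  rw [uTildeC, planeWave_eq, planeWave_neg]
  fin_cases i <;>
    simp only [modeProfile, modeField, wave, Fin.zero_eta, Fin.mk_one, Fin.reduceFinMk,
      Matrix.cons_val] <;> push_cast
  · linear_combination (-2 * (u 0 (y 2) : ℂ) * Complex.sin (phase ξ y)) * hI
  · linear_combination (-2 * (u 1 (y 2) : ℂ) * Complex.sin (phase ξ y)) * hI
  · ring

theorem uTilde_eq (ξ : EuclideanSpace ℝ (Fin 2)) (u : Fin 3 → ℝ → ℝ) :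
    uTilde ξ (u 0) (u 1) (u 2) = modeField 2 ξ u := by
  funext y i
  rw [uTilde, uTildeC_eq, Complex.ofReal_re]

theorem smul_modeField (c a : ℝ) (ξ : EuclideanSpace ℝ (Fin 2)) (u : Fin 3 → ℝ → ℝ) (y : Pt) :
    c • modeField a ξ u y = modeField (c * a) ξ u y := by
  funext i
  simp [modeField]
  ring

/-! ### Partial derivatives of separated functions -/

theorem pd_eq_deriv (k : Fin 3) (f : Pt → ℝ) (y : Pt) :
    pd k f y = deriv (fun t : ℝ => f (y + t • Pi.single k 1)) 0 := rfl

section Separated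

variable {ξ : EuclideanSpace ℝ (Fin 2)} {f T T' : ℝ → ℝ}

theorem pd_zero_sep (hT : ∀ z, HasDerivAt T (T' z) z) (y : Pt) :
    pd 0 (fun y => f (y 2) * T (phase ξ y)) y = f (y 2) * (ξ 0 * T' (phase ξ y)) := by
  have h : HasDerivAt (fun t : ℝ => T (phase ξ y + t * ξ 0)) (T' (phase ξ y) * ξ 0) 0 := by
    have h1 : HasDerivAt (fun t : ℝ => phase ξ y + t * ξ 0) (ξ 0) 0 := by
      simpa using ((hasDerivAt_id (0 : ℝ)).mul_const (ξ 0)).const_add (phase ξ y)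
    have h2 : HasDerivAt T (T' (phase ξ y)) (phase ξ y + 0 * ξ 0) := by simpa using hT (phase ξ y)
    exact h2.comp 0 h1
  have e : (fun t : ℝ => f ((y + t • Pi.single 0 1 : Pt) 2) * T (phase ξ (y + t • Pi.single 0 1)))
      = fun t => f (y 2) * T (phase ξ y + t * ξ 0) := by
    funext t
    have : phase ξ (y + t • Pi.single 0 1) = phase ξ y + t * ξ 0 := by simp [phase]; ring
    rw [this]
    simp
  rw [pd_eq_deriv, e, (h.const_mul (f (y 2))).deriv]
  ring

theorem pd_one_sep (hT : ∀ z, HasDerivAt T (T' z) z) (y : Pt) :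
    pd 1 (fun y => f (y 2) * T (phase ξ y)) y = f (y 2) * (ξ 1 * T' (phase ξ y)) := by
  have h : HasDerivAt (fun t : ℝ => T (phase ξ y + t * ξ 1)) (T' (phase ξ y) * ξ 1) 0 := by
    have h1 : HasDerivAt (fun t : ℝ => phase ξ y + t * ξ 1) (ξ 1) 0 := by
      simpa using ((hasDerivAt_id (0 : ℝ)).mul_const (ξ 1)).const_add (phase ξ y)
    have h2 : HasDerivAt T (T' (phase ξ y)) (phase ξ y + 0 * ξ 1) := by simpa using hT (phase ξ y)
    exact h2.comp 0 h1
  have e : (fun t : ℝ => f ((y + t • Pi.single 1 1 : Pt) 2) * T (phase ξ (y + t • Pi.single 1 1)))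
      = fun t => f (y 2) * T (phase ξ y + t * ξ 1) := by
    funext t
    have : phase ξ (y + t • Pi.single 1 1) = phase ξ y + t * ξ 1 := by simp [phase]; ring
    rw [this]
    simp
  rw [pd_eq_deriv, e, (h.const_mul (f (y 2))).deriv]
  ring

/-- The vertical derivative, with the junk value `0` on both sides where `f` is not
differentiable. -/
theorem pd_two_sep (y : Pt) :
    pd 2 (fun y => f (y 2) * T (phase ξ y)) y = deriv f (y 2) * T (phase ξ y) := by
  have e : (fun t : ℝ => f ((y + t • Pi.single 2 1 : Pt) 2) * T (phase ξ (y + t • Pi.single 2 1)))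
      = fun t => f (y 2 + t) * T (phase ξ y) := by
    funext t
    have : phase ξ (y + t • Pi.single 2 1) = phase ξ y := by simp [phase]
    rw [this]
    simp
  rw [pd_eq_deriv, e, deriv_mul_const_field, deriv_comp_const_add, add_zero]

end Separated

/-- The derivatives of the horizontal profiles. -/
def wave' (i : Fin 3) : ℝ → ℝ := ![Real.cos, Real.cos, fun z => -Real.sin z] i

theorem hasDerivAt_wave (i : Fin 3) (z : ℝ) : HasDerivAt (wave i) (wave' i z) z := by
  fin_cases i
  · exact Real.hasDerivAt_sin z
  · exact Real.hasDerivAt_sin z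
  · exact Real.hasDerivAt_cos z

theorem contDiff_wave (i : Fin 3) {k : WithTop ℕ∞} : ContDiff ℝ k (wave i) := by
  fin_cases i
  · exact Real.contDiff_sin
  · exact Real.contDiff_sin
  · exact Real.contDiff_cos

theorem contDiff_phase (ξ : EuclideanSpace ℝ (Fin 2)) {k : WithTop ℕ∞} :
    ContDiff ℝ k (phase ξ) := by
  unfold phase
  fun_prop

namespace RTData

variable {p : RTData} {ξ : EuclideanSpace ℝ (Fin 2)} {u : Fin 3 → ℝ → ℝ} {s : ℝ}

/-- The vertical profiles of the stress of a mode. -/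
def stress (p : RTData) (ξ : EuclideanSpace ℝ (Fin 2)) (s : ℝ) (u : Fin 3 → ℝ → ℝ) (i j : Fin 3)
    (x : ℝ) : ℝ :=
  !![p.mu x * (2 * s * ξ 0 * u 0 x)
      + (p.dP x * p.rho x + s * (p.bulk x - 2 * p.mu x / 3)) * dvg ξ u x,
      p.mu x * (s * (ξ 1 * u 0 x + ξ 0 * u 1 x)), p.mu x * (s * (deriv (u 0) x - ξ 0 * u 2 x));
    p.mu x * (s * (ξ 1 * u 0 x + ξ 0 * u 1 x)), p.mu x * (2 * s * ξ 1 * u 1 x)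
      + (p.dP x * p.rho x + s * (p.bulk x - 2 * p.mu x / 3)) * dvg ξ u x,
      p.mu x * (s * (deriv (u 1) x - ξ 1 * u 2 x));
    p.mu x * (s * (deriv (u 0) x - ξ 0 * u 2 x)), p.mu x * (s * (deriv (u 1) x - ξ 1 * u 2 x)),
      p.mu x * (2 * s * deriv (u 2) x)
      + (p.dP x * p.rho x + s * (p.bulk x - 2 * p.mu x / 3)) * dvg ξ u x] i j

/-- The horizontal profiles of the stress of a mode. -/
def stressWave (i j : Fin 3) : ℝ → ℝ :=
  !![Real.cos, Real.cos, Real.sin; Real.cos, Real.cos, Real.sin; Real.sin, Real.sin, Real.cos] i j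

theorem pd_modeField (a : ℝ) (i k : Fin 3) (y : Pt) :
    pd k (fun z => modeField a ξ u z i) y
      = ![a * u i (y 2) * (ξ 0 * wave' i (phase ξ y)), a * u i (y 2) * (ξ 1 * wave' i (phase ξ y)),
        a * deriv (u i) (y 2) * wave i (phase ξ y)] k := by
  have h := hasDerivAt_wave i
  fin_cases k
  · exact pd_zero_sep (f := fun x => a * u i x) h y
  · exact pd_one_sep (f := fun x => a * u i x) h y
  · refine (pd_two_sep (f := fun x => a * u i x) (T := wave i) y).trans ?_
    rw [deriv_const_mul_field]
    rfl

theorem dv_modeField (a : ℝ) (y : Pt) :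
    dv (modeField a ξ u) y = a * dvg ξ u (y 2) * Real.cos (phase ξ y) := by
  rw [dv, Fin.sum_univ_three, pd_modeField, pd_modeField, pd_modeField]
  simp only [Matrix.cons_val, wave, wave', dvg, tang]
  ring

theorem Ups_modeField (a : ℝ) (i j : Fin 3) (y : Pt) :
    p.Ups (modeField a ξ u) (modeField (a * s) ξ u) i j y
      = a * p.stress ξ s u i j (y 2) * stressWave i j (phase ξ y) := by
  rw [Ups, pd_modeField, pd_modeField, dv_modeField, dv_modeField]
  fin_cases i <;> fin_cases j <;>
    simp only [Fin.zero_eta, Fin.mk_one, Fin.reduceFinMk, Matrix.cons_val, wave, wave', stress,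
      stressWave, Matrix.of_apply, if_true, reduceIte, Fin.reduceEq] <;> ring

end RTData

/-! ### The growing solution of the linearized problem -/

namespace RTData

variable {p : RTData} {ξ : EuclideanSpace ℝ (Fin 2)} {u : Fin 3 → ℝ → ℝ} {s : ℝ}

/-- The heights of the points of `Ω`. -/
def heights (p : RTData) : Set ℝ := Ioo 0 p.hp ∪ Ioo p.hm 0

theorem isOpen_heights : IsOpen p.heights := isOpen_Ioo.union isOpen_Ioo

theorem mem_dom {y : Pt} : y ∈ p.dom ↔ y 2 ∈ p.heights := Iff.rfl

theorem isOpen_dom : IsOpen p.dom := isOpen_heights.preimage (f := fun y : Pt => y 2) (continuous_apply 2)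

/-- The vertical derivatives of the vertical stresses that the momentum equation asks for. -/
def force (p : RTData) (ξ : EuclideanSpace ℝ (Fin 2)) (s : ℝ) (u : Fin 3 → ℝ → ℝ) (i : Fin 3)
    (x : ℝ) : ℝ :=
  ![s ^ 2 * (p.rho x * u 0 x) - p.g * ξ 0 * (p.rho x * u 2 x)
      + (ξ 0 * p.stress ξ s u 0 0 x + ξ 1 * p.stress ξ s u 0 1 x),
    s ^ 2 * (p.rho x * u 1 x) - p.g * ξ 1 * (p.rho x * u 2 x)
      + (ξ 0 * p.stress ξ s u 1 0 x + ξ 1 * p.stress ξ s u 1 1 x),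
    s ^ 2 * (p.rho x * u 2 x) - p.g * (p.rho x * tang ξ u x)
      - (ξ 0 * p.stress ξ s u 2 0 x + ξ 1 * p.stress ξ s u 2 1 x)] i

/-- The regularity of a growing mode, and the equations that it solves, in terms of the
stresses. -/
structure ClassicalMode (p : RTData) (ξ : EuclideanSpace ℝ (Fin 2)) (s : ℝ) (u : Fin 3 → ℝ → ℝ) :
    Prop where
  continuousOn : ∀ i, ContinuousOn (u i) (Icc p.hm p.hp)
  left : ∀ i, u i p.hm = 0
  right : ∀ i, u i p.hp = 0
  upper : ∀ i, CLip 0 p.hp 3 (u i)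
  lower : ∀ i, CLip p.hm 0 3 (u i)
  hasDerivAt : ∀ i, ∀ x ∈ p.heights, HasDerivAt (p.stress ξ s u i 2) (p.force ξ s u i x) x
  jump : ∃ a b : Fin 3 → ℝ, (∀ i, Tendsto (p.stress ξ s u i 2) (𝓝[>] 0) (𝓝 (a i))) ∧
    (∀ i, Tendsto (p.stress ξ s u i 2) (𝓝[<] 0) (𝓝 (b i))) ∧
    ∀ i, a i - b i = if i = 2 then p.ϑ * ‖ξ‖ ^ 2 * u 2 0 else 0

/-- The stresses of a solution of the first-order system are its fluxes. -/
theorem stress_of_solvesOn {c d μ ς : ℝ} {S : ModeSystem p.g s μ ς ξ} (hS : S.SolvesOn c d)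
    (hsm : s * μ ≠ 0) (hl : ∀ x ∈ Icc c d, 0 < S.lead x)
    (hcoef : ∀ x ∈ Ioo c d, p.rho x = S.ρ x ∧ p.dP x = S.q x ∧ p.mu x = μ ∧ p.bulk x = ς) :
    (∀ i, EqOn (p.stress ξ s S.u i 2) (S.n i) (Ioo c d)) ∧
      ∀ i, ∀ x ∈ Ioo c d, HasDerivAt (p.stress ξ s S.u i 2) (p.force ξ s S.u i x) x := by
  have hd : ∀ i, ∀ x ∈ Ioo c d, deriv (S.u i) x = S.du i x := fun i x hx =>
    ((hS.deriv_u i x (Ioo_subset_Icc_self hx)).hasDerivAt (Icc_mem_nhds hx.1 hx.2)).deriv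
  have he : ∀ i, EqOn (p.stress ξ s S.u i 2) (S.n i) (Ioo c d) := by
    intro i x hx
    obtain ⟨cρ, cP, cμ, cς⟩ := hcoef x hx
    have hlx := (hl x (Ioo_subset_Icc_self hx)).ne'
    fin_cases i
    · simp only [stress, Fin.zero_eta, Matrix.of_apply, Matrix.cons_val, hd 0 x hx, cμ,
        ModeSystem.du]
      rw [add_sub_cancel_right, ← mul_assoc, ← mul_assoc, mul_comm μ s, mul_inv_cancel₀ hsm,
        one_mul]
    · simp only [stress, Fin.mk_one, Matrix.of_apply, Matrix.cons_val, hd 1 x hx, cμ,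
        ModeSystem.du]
      rw [add_sub_cancel_right, ← mul_assoc, ← mul_assoc, mul_comm μ s, mul_inv_cancel₀ hsm,
        one_mul]
    · have h2 : S.du 2 x * S.lead x = S.n 2 x - (S.q x * S.ρ x + (s * ς - 2 / 3 * (s * μ))) *
          (ξ 0 * S.u 0 x + ξ 1 * S.u 1 x) := by
        simp only [ModeSystem.du, Matrix.cons_val]
        rw [inv_mul_cancel_right₀ hlx]
      simp only [stress, Fin.reduceFinMk, Matrix.of_apply, Matrix.cons_val, hd 2 x hx, cμ, cρ, cP,
        cς, dvg, tang]
      simp only [ModeSystem.lead] at h2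
      linear_combination h2
  refine ⟨he, fun i x hx => ?_⟩
  have h1 : HasDerivAt (S.n i) (S.dn i x) x :=
    (hS.deriv_n i x (Ioo_subset_Icc_self hx)).hasDerivAt (Icc_mem_nhds hx.1 hx.2)
  have h2 : p.force ξ s S.u i x = S.dn i x := by
    obtain ⟨cρ, cP, cμ, cς⟩ := hcoef x hx
    fin_cases i <;>
      simp only [force, stress, ModeSystem.dn, ModeSystem.X, dvg, tang, Fin.zero_eta, Fin.mk_one,
        Fin.reduceFinMk, Matrix.of_apply, Matrix.cons_val, hd 0 x hx, hd 1 x hx, hd 2 x hx, cρ, cP,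
        cμ, cς] <;> ring
  rw [h2]
  exact h1.congr_of_eventuallyEq ((he i).eventuallyEq_of_mem (Ioo_mem_nhds hx.1 hx.2))

/-- The regularity of growing modes, with the fluxes of the first-order systems rewritten as
stresses. -/
theorem Valid.classicalMode (hv : p.Valid) (hξ : ξ ∈ p.subcritical)
    (hm : p.IsMode ξ (u 0) (u 1) (u 2)) : p.ClassicalMode ξ (p.lam ξ) u := by
  obtain ⟨hu, -, -⟩ := hv.forms_of_isMode hξ hm
  obtain ⟨n, m, hn, hm', hj⟩ := hv.mode_regular hξ hm
  have hs := hv.lam_pos hξ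
  have hμp := hv.μp_pos
  have hμm := hv.μm_pos
  have hςp := hv.ςp_pos
  have hςm := hv.ςm_pos
  have hU := stress_of_solvesOn hn (mul_pos hs hμp).ne' (fun x hx => by
      have h1 := hv.upperFacts.dP_pos x hx
      have h2 := hv.upperFacts.pos x hx
      change 0 < deriv p.Pp (p.ρp x) * p.ρp x + _ * p.ςp + 4 / 3 * (_ * p.μp)
      positivity) (fun x hx => by simp [rho, dP, mu, bulk, upperSystem, hx.1])
  have hL := stress_of_solvesOn hm' (mul_pos hs hμm).ne' (fun x hx => by
      have h1 := hv.lowerFacts.dP_pos x hx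
      have h2 := hv.lowerFacts.pos x hx
      change 0 < deriv p.Pm (p.ρm x) * p.ρm x + _ * p.ςm + 4 / 3 * (_ * p.μm)
      positivity) (fun x hx => by simp [rho, dP, mu, bulk, lowerSystem, not_lt.2 hx.2.le])
  refine ⟨fun i => (hu i).continuousOn hv.lt.le, fun i => (hu i).2.2.1, fun i => (hu i).2.2.2,
    hn.clip_u, hm'.clip_u, fun i x hx => ?_, fun i => n i 0, fun i => m i 0, fun i => ?_,
    fun i => ?_, hj⟩
  · rcases hx with hx | hx
    exacts [hU.2 i x hx, hL.2 i x hx]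
  · have h1 : Tendsto (n i) (𝓝[Ioo 0 p.hp] 0) (𝓝 (n i 0)) :=
      ((hn.clip_n i).continuousOn 0 ⟨le_rfl, hv.hp_pos.le⟩).mono Ioo_subset_Icc_self
    rw [nhdsWithin_Ioo_eq_nhdsGT hv.hp_pos] at h1
    exact h1.congr' (by
      filter_upwards [Ioo_mem_nhdsGT hv.hp_pos] with x hx
      exact (hU.1 i hx).symm)
  · have h1 : Tendsto (m i) (𝓝[Ioo p.hm 0] 0) (𝓝 (m i 0)) :=
      ((hm'.clip_n i).continuousOn 0 ⟨hv.hm_neg.le, le_rfl⟩).mono Ioo_subset_Icc_self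
    rw [nhdsWithin_Ioo_eq_nhdsLT hv.hm_neg] at h1
    exact h1.congr' (by
      filter_upwards [Ioo_mem_nhdsLT hv.hm_neg] with x hx
      exact (hL.1 i hx).symm)

section Coefficients

theorem eventuallyEq_upper (a b : ℝ → ℝ) {x : ℝ} (hx : 0 < x) :
    (fun s => if 0 < s then a s else b s) =ᶠ[𝓝 x] a := by
  filter_upwards [Ioi_mem_nhds hx] with t ht
  exact if_pos ht

theorem eventuallyEq_lower (a b : ℝ → ℝ) {x : ℝ} (hx : x < 0) :
    (fun s => if 0 < s then a s else b s) =ᶠ[𝓝 x] b := by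
  filter_upwards [Iio_mem_nhds hx] with t ht
  exact if_neg (not_lt.2 (le_of_lt ht))

theorem differentiableAt_ite {a b : ℝ → ℝ} (ha : ∀ x ∈ Ioo 0 p.hp, DifferentiableAt ℝ a x)
    (hb : ∀ x ∈ Ioo p.hm 0, DifferentiableAt ℝ b x) {x : ℝ} (hx : x ∈ p.heights) :
    DifferentiableAt ℝ (fun s => if 0 < s then a s else b s) x := by
  rcases hx with hx | hx
  · exact (ha x hx).congr_of_eventuallyEq (eventuallyEq_upper a b hx.1)
  · exact (hb x hx).congr_of_eventuallyEq (eventuallyEq_lower a b hx.2)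

theorem differentiableAt_mu {x : ℝ} (hx : x ∈ p.heights) : DifferentiableAt ℝ p.mu x :=
  differentiableAt_ite (fun _ _ => differentiableAt_const _) (fun _ _ => differentiableAt_const _) hx

theorem differentiableAt_bulk {x : ℝ} (hx : x ∈ p.heights) : DifferentiableAt ℝ p.bulk x :=
  differentiableAt_ite (fun _ _ => differentiableAt_const _) (fun _ _ => differentiableAt_const _) hx

theorem SideFacts.differentiableAt {g c d : ℝ} {P ρ : ℝ → ℝ} (hf : SideFacts g c d P ρ)
    (hP : ContDiffOn ℝ 4 P (Ioi 0)) {x : ℝ} (hx : x ∈ Ioo c d) :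
    DifferentiableAt ℝ ρ x ∧ DifferentiableAt ℝ (fun x => deriv P (ρ x)) x := by
  have h1 : DifferentiableAt ℝ ρ x := ((hf.hasDeriv x (Ioo_subset_Icc_self hx)).hasDerivAt
    (Icc_mem_nhds hx.1 hx.2)).differentiableAt
  have h2 : ContDiffOn ℝ 1 (deriv P) (Ioi 0) := hP.deriv_of_isOpen isOpen_Ioi (by norm_num)
  have h3 : DifferentiableAt ℝ (deriv P) (ρ x) := (h2.differentiableOn one_ne_zero).differentiableAt
    (Ioi_mem_nhds (hf.pos x (Ioo_subset_Icc_self hx)))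
  exact ⟨h1, h3.comp x h1⟩

theorem Valid.differentiableAt_rho (hv : p.Valid) {x : ℝ} (hx : x ∈ p.heights) :
    DifferentiableAt ℝ p.rho x :=
  differentiableAt_ite (fun _ h => (SideFacts.differentiableAt hv.upperFacts hv.Pp_smooth h).1)
    (fun _ h => (SideFacts.differentiableAt hv.lowerFacts hv.Pm_smooth h).1) hx

theorem Valid.differentiableAt_dP (hv : p.Valid) {x : ℝ} (hx : x ∈ p.heights) :
    DifferentiableAt ℝ p.dP x :=
  differentiableAt_ite (fun _ h => (SideFacts.differentiableAt hv.upperFacts hv.Pp_smooth h).2)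
    (fun _ h => (SideFacts.differentiableAt hv.lowerFacts hv.Pm_smooth h).2) hx

end Coefficients

namespace ClassicalMode

theorem contDiffOn (h : p.ClassicalMode ξ s u) (i : Fin 3) : ContDiffOn ℝ 3 (u i) p.heights :=
  ((h.upper i).contDiffOn).union_of_isOpen (h.lower i).contDiffOn isOpen_Ioo isOpen_Ioo

theorem differentiableAt_stress (h : p.ClassicalMode ξ s u) (hv : p.Valid) (i j : Fin 3) {x : ℝ}
    (hx : x ∈ p.heights) : DifferentiableAt ℝ (p.stress ξ s u i j) x := by
  have hu : ∀ i, DifferentiableAt ℝ (u i) x := fun i =>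
    ((h.contDiffOn i).differentiableOn (by norm_num)).differentiableAt (isOpen_heights.mem_nhds hx)
  have hd : ∀ i, DifferentiableAt ℝ (deriv (u i)) x := fun i =>
    (((h.contDiffOn i).deriv_of_isOpen (m := 2) isOpen_heights (by norm_num)).differentiableOn
      (by norm_num)).differentiableAt (isOpen_heights.mem_nhds hx)
  have u0 := hu 0
  have u1 := hu 1
  have u2 := hu 2
  have d0 := hd 0
  have d1 := hd 1
  have d2 := hd 2
  have hμ := differentiableAt_mu hx
  have hς := differentiableAt_bulk hx
  have hρ := hv.differentiableAt_rho hx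
  have hP := hv.differentiableAt_dP hx
  unfold stress dvg tang
  fin_cases i <;> fin_cases j <;>
    simp only [Fin.zero_eta, Fin.mk_one, Fin.reduceFinMk, Matrix.of_apply, Matrix.cons_val] <;>
    fun_prop

end ClassicalMode

theorem periodLen_phase (ξ : EuclideanSpace ℝ (Fin 2)) (k : Fin 2) :
    ∃ m : ℤ, 2 * Real.pi * periodLen ξ k * ξ k = m * (2 * Real.pi) := by
  unfold periodLen
  split_ifs with h
  · rcases lt_or_gt_of_ne h with h' | h'
    · refine ⟨-1, ?_⟩
      rw [abs_of_neg h']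
      push_cast
      field_simp
    · refine ⟨1, ?_⟩
      rw [abs_of_pos h']
      push_cast
      field_simp
  · refine ⟨0, ?_⟩
    push Not at h
    simp [h]

theorem wave_add_int (i : Fin 3) (z : ℝ) (m : ℤ) : wave i (z + m * (2 * Real.pi)) = wave i z := by
  fin_cases i
  · exact Real.sin_add_int_mul_two_pi z m
  · exact Real.sin_add_int_mul_two_pi z m
  · exact Real.cos_add_int_mul_two_pi z m

theorem ClassicalMode.periodicRegular (h : p.ClassicalMode ξ s u) (a : ℝ)
    (hH : ∀ i, MemH 4 p.dom (p.cell (periodLen ξ 0) (periodLen ξ 1)) fun y => modeField a ξ u y i) :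
    p.PeriodicRegular (periodLen ξ 0) (periodLen ξ 1) (modeField a ξ u) where
  periodic₁ y := by
    obtain ⟨m, hm⟩ := periodLen_phase ξ 0
    have e : phase ξ (y + Pi.single 0 (2 * Real.pi * periodLen ξ 0))
        = phase ξ y + m * (2 * Real.pi) := by
      rw [← hm]
      simp [phase]
      ring
    funext i
    simp only [modeField]
    rw [e, wave_add_int]
    simp
  periodic₂ y := by
    obtain ⟨m, hm⟩ := periodLen_phase ξ 1
    have e : phase ξ (y + Pi.single 1 (2 * Real.pi * periodLen ξ 1))
        = phase ξ y + m * (2 * Real.pi) := by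
      rw [← hm]
      simp [phase]
      ring
    funext i
    simp only [modeField]
    rw [e, wave_add_int]
    simp
  memH4 := hH
  continuousOn := by
    refine continuousOn_pi.2 fun i => ContinuousOn.mul (continuousOn_const.mul ?_) ?_
    · exact (h.continuousOn i).comp (continuous_apply 2).continuousOn fun y hy => hy
    · exact ((contDiff_wave i (k := 0)).continuous.comp
        (contDiff_phase ξ (k := 0)).continuous).continuousOn
  boundary y hy := by
    funext i
    have : u i (y 2) = 0 := by
      rcases hy with hy | hy
      · rw [hy, h.left]
      · rw [hy, h.right]
    simp [modeField, this]
  contDiffOn := by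
    refine contDiffOn_pi.2 fun i => ContDiffOn.mul (contDiffOn_const.mul ?_) ?_
    · exact ((h.contDiffOn i).of_le (by norm_num)).comp (contDiff_apply ℝ ℝ 2).contDiffOn
        fun y hy => hy
    · exact ((contDiff_wave i).comp (contDiff_phase ξ)).contDiffOn
  interface := by
    refine contDiff_pi.2 fun i => ?_
    simp only [modeField, phase, Matrix.cons_val]
    exact contDiff_const.mul ((contDiff_wave i).comp (by fun_prop))

theorem hasDerivAt_stressWave (i j : Fin 3) (z : ℝ) : HasDerivAt (stressWave i j)
    (!![-Real.sin z, -Real.sin z, Real.cos z; -Real.sin z, -Real.sin z, Real.cos z;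
      Real.cos z, Real.cos z, -Real.sin z] i j) z := by
  have h1 := Real.hasDerivAt_sin z
  have h2 := Real.hasDerivAt_cos z
  fin_cases i <;> fin_cases j <;> first | exact h1 | exact h2

theorem pd_Ups_modeField (a : ℝ) (i j k : Fin 3) (y : Pt) :
    pd k (p.Ups (modeField a ξ u) (modeField (a * s) ξ u) i j) y
      = ![a * p.stress ξ s u i j (y 2) * (ξ 0 * deriv (stressWave i j) (phase ξ y)),
        a * p.stress ξ s u i j (y 2) * (ξ 1 * deriv (stressWave i j) (phase ξ y)),
        a * deriv (p.stress ξ s u i j) (y 2) * stressWave i j (phase ξ y)] k := by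
  have e : p.Ups (modeField a ξ u) (modeField (a * s) ξ u) i j
      = fun y => a * p.stress ξ s u i j (y 2) * stressWave i j (phase ξ y) :=
    funext fun y => Ups_modeField a i j y
  have h : ∀ z, HasDerivAt (stressWave i j) (deriv (stressWave i j) z) z := fun z =>
    (hasDerivAt_stressWave i j z).differentiableAt.hasDerivAt
  rw [e]
  fin_cases k
  · exact pd_zero_sep (f := fun x => a * p.stress ξ s u i j x) h y
  · exact pd_one_sep (f := fun x => a * p.stress ξ s u i j x) h y
  · refine (pd_two_sep (f := fun x => a * p.stress ξ s u i j x) (T := stressWave i j) y).trans ?_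
    rw [deriv_const_mul_field]
    rfl

/-- The momentum equation for the exponentially growing field with amplitude `a` of the
displacement. -/
theorem ClassicalMode.momentum (h : p.ClassicalMode ξ s u) (a : ℝ) {y : Pt} (hy : y ∈ p.dom)
    (i : Fin 3) : p.rho (y 2) * (s * modeField (a * s) ξ u y i) =
      p.g * p.rho (y 2) * ((if i = 2 then dv (modeField a ξ u) y else 0)
        - pd i (fun z => modeField a ξ u z 2) y)
        + ∑ j, pd j (p.Ups (modeField a ξ u) (modeField (a * s) ξ u) i j) y := by
  have hd := fun i => (h.hasDerivAt i (y 2) (mem_dom.1 hy)).deriv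
  rw [Fin.sum_univ_three, dv_modeField, pd_modeField]
  simp only [pd_Ups_modeField, (hasDerivAt_stressWave _ _ _).deriv, Matrix.cons_val, hd]
  fin_cases i <;>
    simp only [Fin.zero_eta, Fin.mk_one, Fin.reduceFinMk, Matrix.cons_val, modeField, wave, wave',
      force, stressWave, Matrix.of_apply, reduceIte, Fin.reduceEq, dvg] <;> ring

theorem norm_sq_eq (ξ : EuclideanSpace ℝ (Fin 2)) : ‖ξ‖ ^ 2 = ξ 0 ^ 2 + ξ 1 ^ 2 := by
  rw [EuclideanSpace.norm_sq_eq, Fin.sum_univ_two, Real.norm_eq_abs, Real.norm_eq_abs, sq_abs,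
    sq_abs]

theorem ClassicalMode.stress_jump (h : p.ClassicalMode ξ s u) (a : ℝ) {y : Pt}
    (hy : y 2 = 0) : ∃ A B : Fin 3 → ℝ,
      Tendsto (fun z i => p.Ups (modeField a ξ u) (modeField (a * s) ξ u) i 2 z) (𝓝[p.upper] y)
        (𝓝 A) ∧
      Tendsto (fun z i => p.Ups (modeField a ξ u) (modeField (a * s) ξ u) i 2 z) (𝓝[p.lower] y)
        (𝓝 B) ∧
      ∀ i, A i - B i = if i = 2 then
        -p.ϑ * (pd 0 (pd 0 fun z => modeField a ξ u z 2) y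
          + pd 1 (pd 1 fun z => modeField a ξ u z 2) y) else 0 := by
  obtain ⟨α, β, hα, hβ, hj⟩ := h.jump
  have hw : ∀ i, Tendsto (fun z => stressWave i 2 (phase ξ z)) (𝓝 y)
      (𝓝 (stressWave i 2 (phase ξ y))) := fun i =>
    ((hasDerivAt_stressWave i 2 _).continuousAt.tendsto).comp
      (contDiff_phase ξ (k := 0)).continuous.continuousAt
  have h2 : Tendsto (fun z : Pt => z 2) (𝓝 y) (𝓝 0) := hy ▸ (continuous_apply 2).tendsto y
  have hup : Tendsto (fun z : Pt => z 2) (𝓝[p.upper] y) (𝓝[>] 0) :=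
    tendsto_nhdsWithin_of_tendsto_nhds_of_eventually_within _ (h2.mono_left nhdsWithin_le_nhds)
      (eventually_mem_nhdsWithin.mono fun z hz => hz.1)
  have hlo : Tendsto (fun z : Pt => z 2) (𝓝[p.lower] y) (𝓝[<] 0) :=
    tendsto_nhdsWithin_of_tendsto_nhds_of_eventually_within _ (h2.mono_left nhdsWithin_le_nhds)
      (eventually_mem_nhdsWithin.mono fun z hz => hz.2)
  refine ⟨fun i => a * α i * stressWave i 2 (phase ξ y),
    fun i => a * β i * stressWave i 2 (phase ξ y), tendsto_pi_nhds.2 fun i => ?_,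
    tendsto_pi_nhds.2 fun i => ?_, fun i => ?_⟩
  · simp only [Ups_modeField]
    exact (((hα i).comp hup).const_mul a).mul ((hw i).mono_left nhdsWithin_le_nhds)
  · simp only [Ups_modeField]
    exact (((hβ i).comp hlo).const_mul a).mul ((hw i).mono_left nhdsWithin_le_nhds)
  · have hji := hj i
    have e : a * α i * stressWave i 2 (phase ξ y) - a * β i * stressWave i 2 (phase ξ y)
        = a * (α i - β i) * stressWave i 2 (phase ξ y) := by ring
    simp only [e, hji]
    split_ifs with hi
    · have e0 : (pd 0 fun z => modeField a ξ u z 2)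
          = fun y => (a * ξ 0) * u 2 (y 2) * (-Real.sin (phase ξ y)) := funext fun y => by
        rw [pd_modeField]; simp only [wave', Matrix.cons_val]; ring
      have e1 : (pd 1 fun z => modeField a ξ u z 2)
          = fun y => (a * ξ 1) * u 2 (y 2) * (-Real.sin (phase ξ y)) := funext fun y => by
        rw [pd_modeField]; simp only [wave', Matrix.cons_val]; ring
      have hs : ∀ z, HasDerivAt (fun z => -Real.sin z) (-Real.cos z) z := fun z =>
        (Real.hasDerivAt_sin z).neg
      rw [e0, e1, pd_zero_sep (f := fun x => (a * ξ 0) * u 2 x) hs,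
        pd_one_sep (f := fun x => (a * ξ 1) * u 2 x) hs, hi, hy, norm_sq_eq]
      simp only [stressWave, Matrix.of_apply, Matrix.cons_val]
      ring
    · simp

theorem Valid.differentiableOn_Ups (hv : p.Valid) (h : p.ClassicalMode ξ s u) (a : ℝ)
    (i j : Fin 3) :
    DifferentiableOn ℝ (p.Ups (modeField a ξ u) (modeField (a * s) ξ u) i j) p.dom := by
  have e : p.Ups (modeField a ξ u) (modeField (a * s) ξ u) i j
      = fun y => a * p.stress ξ s u i j (y 2) * stressWave i j (phase ξ y) :=
    funext fun y => Ups_modeField a i j y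
  rw [e]
  intro y hy
  refine DifferentiableAt.differentiableWithinAt (DifferentiableAt.mul
    (DifferentiableAt.const_mul ?_ a) ?_)
  · exact DifferentiableAt.comp (g := p.stress ξ s u i j) (f := fun y : Pt => y 2) y
      (h.differentiableAt_stress hv i j (mem_dom.1 hy)) (differentiableAt_apply 2 y)
  · exact DifferentiableAt.comp y (hasDerivAt_stressWave i j _).differentiableAt
      ((contDiff_phase ξ (k := 1)).differentiable one_ne_zero y)

/-- The growing mode gives a solution of the linearized problem. -/
theorem Valid.isPeriodicSolution (hv : p.Valid) (h : p.ClassicalMode ξ s u) (hs : 0 < s)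
    (hH : ∀ a i, MemH 4 p.dom (p.cell (periodLen ξ 0) (periodLen ξ 1))
      fun y => modeField a ξ u y i) :
    p.IsPeriodicSolution (periodLen ξ 0) (periodLen ξ 1)
      (fun y => s⁻¹ • modeField 2 ξ u y) (modeField 2 ξ u)
      (fun t y => Real.exp (s * t) • s⁻¹ • modeField 2 ξ u y)
      (fun t y => Real.exp (s * t) • modeField 2 ξ u y) := by
  have eη : ∀ t, (fun y => Real.exp (s * t) • s⁻¹ • modeField 2 ξ u y)
      = modeField (Real.exp (s * t) * (s⁻¹ * 2)) ξ u := fun t => funext fun y => by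
    rw [smul_modeField, smul_modeField]
  have eu : ∀ t, (fun y => Real.exp (s * t) • modeField 2 ξ u y)
      = modeField (Real.exp (s * t) * (s⁻¹ * 2) * s) ξ u := fun t => funext fun y => by
    rw [smul_modeField]
    congr 1
    field_simp
  have hexp : ∀ t, HasDerivAt (fun t => Real.exp (s * t)) (Real.exp (s * t) * s) t := fun t => by
    simpa using ((hasDerivAt_id t).const_mul s).exp
  have dη : ∀ t y, HasDerivAt (fun t => modeField (Real.exp (s * t) * (s⁻¹ * 2)) ξ u y)
      (modeField (Real.exp (s * t) * (s⁻¹ * 2) * s) ξ u y) t := fun t y => by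
    have := (hexp t).smul_const (s⁻¹ • modeField 2 ξ u y)
    simp only [smul_modeField] at this
    rwa [mul_right_comm] at this
  have du : ∀ t y, HasDerivAt (fun t => modeField (Real.exp (s * t) * (s⁻¹ * 2) * s) ξ u y)
      (s • modeField (Real.exp (s * t) * (s⁻¹ * 2) * s) ξ u y) t := fun t y => by
    have := (hexp t).smul_const (s⁻¹ • modeField (2 * s) ξ u y)
    simp only [smul_modeField] at this ⊢
    simp only [mul_assoc, mul_left_comm s] at this ⊢
    exact this
  rw [funext eη, funext eu]
  refine ⟨fun t _ => h.periodicRegular _ (hH _), fun t _ => h.periodicRegular _ (hH _),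
    fun t _ y _ => (dη t y).hasDerivWithinAt, fun t _ i j => hv.differentiableOn_Ups h _ i j,
    fun t _ y hy => ⟨_, (du t y).hasDerivWithinAt, fun i => h.momentum _ hy i⟩,
    fun t _ y hy => h.stress_jump _ hy, fun y _ => ?_, fun y _ => ?_⟩
  · simp only [mul_zero, Real.exp_zero, one_mul, smul_modeField]
  · have : s⁻¹ * 2 * s = 2 := by field_simp
    simp only [mul_zero, Real.exp_zero, one_mul, this]

end RTData

/-! ### Weak derivatives of separated functions -/

theorem pd_eq_fderiv {Ψ : Pt → ℝ} (h : Differentiable ℝ Ψ) (k : Fin 3) :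
    pd k Ψ = fun y => fderiv ℝ Ψ y (Pi.single k 1) :=
  funext fun y => (h y).lineDeriv_eq_fderiv

theorem contDiff_pd {Ψ : Pt → ℝ} (h : ContDiff ℝ ∞ Ψ) (k : Fin 3) : ContDiff ℝ ∞ (pd k Ψ) := by
  rw [pd_eq_fderiv (h.differentiable (by simp))]
  exact (h.fderiv_right (m := ∞) (by simp)).clm_apply contDiff_const

theorem contDiff_iterate_pd {Ψ : Pt → ℝ} (h : ContDiff ℝ ∞ Ψ) (k : Fin 3) :
    ∀ a, ContDiff ℝ ∞ ((pd k)^[a] Ψ)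
  | 0 => h
  | a + 1 => by
    rw [Function.iterate_succ_apply']
    exact contDiff_pd (contDiff_iterate_pd h k a) k

theorem pd_congr {F H : Pt → ℝ} {y : Pt} (h : F =ᶠ[𝓝 y] H) (k : Fin 3) : pd k F y = pd k H y :=
  h.lineDeriv_eq

theorem pd_mul {F H : Pt → ℝ} (hF : ContDiff ℝ ∞ F) (hH : ContDiff ℝ ∞ H) (k : Fin 3) (y : Pt) :
    pd k (fun z => F z * H z) y = pd k F y * H y + F y * pd k H y := by
  have h1 := hF.differentiable (by simp)
  have h2 := hH.differentiable (by simp)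
  rw [pd_eq_fderiv (h1.fun_mul h2), pd_eq_fderiv h1, pd_eq_fderiv h2]
  beta_reduce
  rw [fderiv_fun_mul (h1 y) (h2 y)]
  simp
  ring

theorem pd_comm {Ψ : Pt → ℝ} (h : ContDiff ℝ ∞ Ψ) (j k : Fin 3) :
    pd j (pd k Ψ) = pd k (pd j Ψ) := by
  have hd : Differentiable ℝ (fderiv ℝ Ψ) :=
    (h.fderiv_right (m := 1) (by norm_cast)).differentiable one_ne_zero
  have e : ∀ j k, pd j (pd k Ψ)
      = fun y => fderiv ℝ (fderiv ℝ Ψ) y (Pi.single j 1) (Pi.single k 1) := fun j k => by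
    rw [pd_eq_fderiv ((contDiff_pd h k).differentiable (by simp)),
      pd_eq_fderiv (h.differentiable (by simp))]
    funext y
    rw [fderiv_clm_apply (hd y) (differentiableAt_const _)]
    simp
  rw [e, e]
  funext y
  exact (h.contDiffAt.isSymmSndFDerivAt (by simp; norm_cast)).eq _ _

theorem iterate_pd_comm {Ψ : Pt → ℝ} (h : ContDiff ℝ ∞ Ψ) (j k : Fin 3) (a b : ℕ) :
    (pd j)^[a] ((pd k)^[b] Ψ) = (pd k)^[b] ((pd j)^[a] Ψ) := by
  have h1 : ∀ (a : ℕ) {Ψ : Pt → ℝ}, ContDiff ℝ ∞ Ψ → (pd j)^[a] (pd k Ψ) = pd k ((pd j)^[a] Ψ) := by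
    intro a
    induction a with
    | zero => intro Ψ _; rfl
    | succ a ih =>
      intro Ψ h
      rw [Function.iterate_succ_apply, pd_comm h, ih (contDiff_pd h j), Function.iterate_succ_apply]
  induction b generalizing Ψ with
  | zero => rfl
  | succ b ih =>
    rw [Function.iterate_succ_apply, ih (contDiff_pd h k), h1 a h, Function.iterate_succ_apply]

/-- Line derivatives of functions of the third coordinate alone. -/
theorem pd_vertical (f : ℝ → ℝ) (k : Fin 3) (y : Pt) :
    pd k (fun z => f (z 2)) y = if k = 2 then deriv f (y 2) else 0 := by
  rw [pd_eq_deriv]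
  split_ifs with hk
  · subst hk
    have e : (fun t : ℝ => f ((y + t • Pi.single 2 1 : Pt) 2)) = fun t => f (y 2 + t) := by
      funext t; simp
    rw [e, deriv_comp_const_add, add_zero]
  · have e : (fun t : ℝ => f ((y + t • Pi.single k 1 : Pt) 2)) = fun _ => f (y 2) := by
      funext t; simp [Ne.symm hk]
    rw [e, deriv_const]

/-- Test functions on `U`. -/
structure IsTest (U : Set Pt) (Ψ : Pt → ℝ) : Prop where
  smooth : ContDiff ℝ ∞ Ψ
  compact : HasCompactSupport Ψ
  subset : tsupport Ψ ⊆ U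

namespace IsTest

variable {U V : Set Pt} {Ψ : Pt → ℝ}

theorem pd (h : IsTest U Ψ) (k : Fin 3) : IsTest U (pd k Ψ) := by
  have e := pd_eq_fderiv (h.smooth.differentiable (by simp)) k
  refine ⟨contDiff_pd h.smooth k, ?_, ?_⟩
  · rw [e]; exact h.compact.fderiv_apply ℝ _
  · rw [e]; exact (tsupport_fderiv_apply_subset ℝ _).trans h.subset

theorem iterate_pd (h : IsTest U Ψ) (k : Fin 3) : ∀ a, IsTest U ((_root_.pd k)^[a] Ψ)
  | 0 => h
  | a + 1 => by
    rw [Function.iterate_succ_apply']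
    exact (iterate_pd h k a).pd k

/-- Test functions on a disjoint union of open sets restrict to test functions on each of
them. -/
theorem indicator (h : IsTest (U ∪ V) Ψ) (hU : IsOpen U) (hV : IsOpen V) (hd : Disjoint U V) :
    IsTest U (U.indicator Ψ) := by
  have hloc : ∀ y, U.indicator Ψ =ᶠ[𝓝 y] Ψ ∧ y ∈ U ∨ U.indicator Ψ =ᶠ[𝓝 y] 0 := by
    intro y
    by_cases hy : y ∈ tsupport Ψ
    · rcases h.subset hy with hy | hy
      · left
        exact ⟨by filter_upwards [hU.mem_nhds hy] with z hz using indicator_of_mem hz _, hy⟩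
      · right
        filter_upwards [hV.mem_nhds hy] with z hz
        exact indicator_of_notMem (fun hz' => hd.le_bot ⟨hz', hz⟩) _
    · right
      filter_upwards [(isClosed_tsupport Ψ).isOpen_compl.mem_nhds hy] with z hz
      simp [image_eq_zero_of_notMem_tsupport hz]
  have hsub : tsupport (U.indicator Ψ) ⊆ tsupport Ψ :=
    closure_mono (by rw [support_indicator]; exact inter_subset_right)
  refine ⟨contDiff_iff_contDiffAt.2 fun y => ?_, h.compact.of_isClosed_subset
    (isClosed_tsupport _) hsub, fun y hy => ?_⟩
  · rcases hloc y with hy | hy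
    · exact h.smooth.contDiffAt.congr_of_eventuallyEq hy.1
    · exact contDiffAt_const.congr_of_eventuallyEq hy
  · rcases hloc y with hy' | hy'
    · exact hy'.2
    · exact absurd hy (notMem_tsupport_iff_eventuallyEq.2 hy')

theorem eq_zero (h : IsTest U Ψ) {y : Pt} (hy : y ∉ U) : Ψ y = 0 :=
  image_eq_zero_of_notMem_tsupport fun h' => hy (h.subset h')

end IsTest

/-- Integration by parts against functions of the third coordinate, Lipschitz in a strip: extend `f` to
a Lipschitz function on the line, and use integration by parts for Lipschitz functions on the whole
space. -/
theorem setIntegral_strip_mul_pd {c d : ℝ} {f : ℝ → ℝ} {K : NNReal}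
    (hf : LipschitzOnWith K f (Ioo c d)) {G Ψ : Pt → ℝ} (hG : ContDiff ℝ ∞ G)
    (hΨ : IsTest {y | y 2 ∈ Ioo c d} Ψ) (k : Fin 3) :
    IntegrableOn (fun y => G y * f (y 2) * pd k Ψ y) {y : Pt | y 2 ∈ Ioo c d} ∧
    IntegrableOn (fun y => (pd k G y * f (y 2) + G y * if k = 2 then deriv f (y 2) else 0) * Ψ y)
      {y : Pt | y 2 ∈ Ioo c d} ∧
    ∫ y in {y : Pt | y 2 ∈ Ioo c d}, G y * f (y 2) * pd k Ψ y
      = -∫ y in {y : Pt | y 2 ∈ Ioo c d},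
        (pd k G y * f (y 2) + G y * if k = 2 then deriv f (y 2) else 0) * Ψ y := by
  obtain ⟨F, hF, hfF⟩ := hf.extend_real
  set U : Set Pt := {y | y 2 ∈ Ioo c d} with hU
  have hUm : MeasurableSet U := (measurable_pi_apply 2) measurableSet_Ioo
  have hF3 : LipschitzWith K fun y : Pt => F (y 2) := by
    have h := hF.comp (LipschitzWith.eval (α := fun _ : Fin 3 => ℝ) 2)
    rwa [mul_one] at h
  have hFc : Continuous fun y : Pt => F (y 2) := hF3.continuous
  have hg : ContDiff ℝ ∞ fun y => G y * Ψ y := hG.mul hΨ.smooth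
  have hgc : HasCompactSupport fun y => G y * Ψ y := hΨ.compact.mul_left
  obtain ⟨D, hD⟩ := hg.lipschitzWith_of_hasCompactSupport hgc (by simp)
  have key := hF3.integral_lineDeriv_mul_eq (μ := volume) hD hgc (Pi.single k 1)
  have i1 : Integrable fun y => pd k G y * F (y 2) * Ψ y :=
    (((contDiff_pd hG k).continuous.mul hFc).mul hΨ.smooth.continuous).integrable_of_hasCompactSupport
      hΨ.compact.mul_left
  have i2 : Integrable fun y => G y * F (y 2) * pd k Ψ y :=
    ((hG.continuous.mul hFc).mul (hΨ.pd k).smooth.continuous).integrable_of_hasCompactSupport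
      (hΨ.pd k).compact.mul_left
  have i3 : Integrable fun y => G y * (if k = 2 then deriv F (y 2) else 0) * Ψ y := by
    have h := (hg.continuous.integrable_of_hasCompactSupport (μ := volume) hgc).bdd_mul (c := K)
      (measurable_lineDeriv (𝕜 := ℝ) (v := Pi.single k 1) hFc).aestronglyMeasurable
      (Eventually.of_forall fun y => by
        have h2 := pd_vertical F k y
        unfold pd at h2
        rw [h2]
        split_ifs
        · exact norm_deriv_le_of_lipschitz hF
        · simp)
    refine h.congr (Eventually.of_forall fun y => ?_)
    have h2 := pd_vertical F k y
    unfold pd at h2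
    simp only [h2]
    ring
  have i4 : Integrable fun y =>
      (pd k G y * F (y 2) + G y * if k = 2 then deriv F (y 2) else 0) * Ψ y :=
    (i1.add i3).congr (Eventually.of_forall fun y => by simp only [Pi.add_apply]; ring)
  have hdF : ∀ y ∈ U, deriv f (y 2) = deriv F (y 2) := fun y hy =>
    (hfF.eventuallyEq_of_mem (Ioo_mem_nhds hy.1 hy.2)).deriv_eq
  have e1 : EqOn (fun y => G y * F (y 2) * pd k Ψ y) (fun y => G y * f (y 2) * pd k Ψ y) U :=
    fun y hy => by simp only [hfF hy]
  have e2 : EqOn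
      (fun y => (pd k G y * F (y 2) + G y * if k = 2 then deriv F (y 2) else 0) * Ψ y)
      (fun y => (pd k G y * f (y 2) + G y * if k = 2 then deriv f (y 2) else 0) * Ψ y) U :=
    fun y hy => by simp only [hfF hy, hdF y hy]
  refine ⟨i2.integrableOn.congr_fun e1 hUm, i4.integrableOn.congr_fun e2 hUm, ?_⟩
  rw [← setIntegral_congr_fun hUm e1, ← setIntegral_congr_fun hUm e2,
    setIntegral_eq_integral_of_forall_compl_eq_zero fun y hy => by rw [(hΨ.pd k).eq_zero hy, mul_zero],
    setIntegral_eq_integral_of_forall_compl_eq_zero fun y hy => by rw [hΨ.eq_zero hy, mul_zero]]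
  have k1 : ∀ y, lineDeriv ℝ (fun y : Pt => F (y 2)) y (Pi.single k 1) * (G y * Ψ y)
      = G y * (if k = 2 then deriv F (y 2) else 0) * Ψ y := fun y => by
    have h2 := pd_vertical F k y
    unfold pd at h2
    rw [h2]
    ring
  have k2 : ∀ y, lineDeriv ℝ (fun y => G y * Ψ y) y (-Pi.single k 1) * F (y 2)
      = -(pd k G y * F (y 2) * Ψ y + G y * F (y 2) * pd k Ψ y) := fun y => by
    have h2 := pd_mul hG hΨ.smooth k y
    rw [lineDeriv_neg]
    unfold pd at h2 ⊢
    rw [h2]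
    ring
  simp_rw [k1, k2] at key
  rw [integral_neg, integral_add i1 i2] at key
  have k3 : ∫ y, (pd k G y * F (y 2) + G y * if k = 2 then deriv F (y 2) else 0) * Ψ y
      = (∫ y, pd k G y * F (y 2) * Ψ y)
        + ∫ y, G y * (if k = 2 then deriv F (y 2) else 0) * Ψ y := by
    rw [← integral_add i1 i3]
    exact integral_congr_ae (Eventually.of_forall fun y => by ring)
  rw [k3, key]
  ring

namespace RTData

variable {p : RTData}

/-- Lipschitz on each side of the interface. -/
def SideLip (p : RTData) (f : ℝ → ℝ) : Prop :=
  (∃ K, LipschitzOnWith K f (Ioo 0 p.hp)) ∧ ∃ K, LipschitzOnWith K f (Ioo p.hm 0)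

theorem disjoint_upper_lower : Disjoint p.upper p.lower :=
  Set.disjoint_left.2 fun _ h1 h2 => lt_asymm h1.1 h2.2

theorem isOpen_upper : IsOpen p.upper := isOpen_Ioo.preimage (f := fun y : Pt => y 2) (continuous_apply 2)

theorem isOpen_lower : IsOpen p.lower := isOpen_Ioo.preimage (f := fun y : Pt => y 2) (continuous_apply 2)

/-- Integration by parts on `Ω`. The profile may jump at the interface, as test functions vanish
there. -/
theorem setIntegral_dom_mul_pd {f : ℝ → ℝ} (hf : p.SideLip f) {G Ψ : Pt → ℝ}
    (hG : ContDiff ℝ ∞ G) (hΨ : IsTest p.dom Ψ) (k : Fin 3) :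
    ∫ y in p.dom, G y * f (y 2) * pd k Ψ y
      = -∫ y in p.dom,
        (pd k G y * f (y 2) + G y * if k = 2 then deriv f (y 2) else 0) * Ψ y := by
  obtain ⟨⟨K, hK⟩, L, hL⟩ := hf
  have hd := disjoint_upper_lower (p := p)
  have hu := isOpen_upper (p := p)
  have hl := isOpen_lower (p := p)
  have pdi : ∀ {U : Set Pt}, IsOpen U → EqOn (pd k (U.indicator Ψ)) (pd k Ψ) U := fun hU y hy =>
    pd_congr (by filter_upwards [hU.mem_nhds hy] with z hz using indicator_of_mem hz _) k
  obtain ⟨a1, a2, a3⟩ := setIntegral_strip_mul_pd hK hG (hΨ.indicator hu hl hd) k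
  obtain ⟨b1, b2, b3⟩ := setIntegral_strip_mul_pd hL hG
    (IsTest.indicator (by rw [union_comm]; exact hΨ) hl hu hd.symm) k
  have eu1 : EqOn (fun y => G y * f (y 2) * pd k (p.upper.indicator Ψ) y)
    (fun y => G y * f (y 2) * pd k Ψ y) p.upper := fun y hy => by simp only [pdi hu hy]
  have eu2 : EqOn (fun y => (pd k G y * f (y 2) + G y * if k = 2 then deriv f (y 2) else 0) *
      p.upper.indicator Ψ y) (fun y => (pd k G y * f (y 2) + G y *
      if k = 2 then deriv f (y 2) else 0) * Ψ y) p.upper := fun y hy => by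
    simp only [indicator_of_mem hy]
  have el1 : EqOn (fun y => G y * f (y 2) * pd k (p.lower.indicator Ψ) y)
    (fun y => G y * f (y 2) * pd k Ψ y) p.lower := fun y hy => by simp only [pdi hl hy]
  have el2 : EqOn (fun y => (pd k G y * f (y 2) + G y * if k = 2 then deriv f (y 2) else 0) *
      p.lower.indicator Ψ y) (fun y => (pd k G y * f (y 2) + G y *
      if k = 2 then deriv f (y 2) else 0) * Ψ y) p.lower := fun y hy => by
    simp only [indicator_of_mem hy]
  have mu := hu.measurableSet
  have ml := hl.measurableSet
  rw [dom, setIntegral_union hd ml (a1.congr_fun eu1 mu) (b1.congr_fun el1 ml),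
    setIntegral_union hd ml (a2.congr_fun eu2 mu) (b2.congr_fun el2 ml),
    ← setIntegral_congr_fun mu eu1, ← setIntegral_congr_fun mu eu2, ← setIntegral_congr_fun ml el1,
    ← setIntegral_congr_fun ml el2]
  change _ at a3 b3
  have a3' := a3
  have b3' := b3
  unfold upper lower at *
  rw [a3', b3']
  ring

/-- Functions that do not depend on the third coordinate. -/
def VertInv (G : Pt → ℝ) : Prop := ∀ (y : Pt) (t : ℝ), G (y + t • Pi.single 2 1) = G y

theorem VertInv.pd {G : Pt → ℝ} (h : VertInv G) (k : Fin 3) : VertInv (pd k G) := fun y t => by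
  rw [pd_eq_deriv, pd_eq_deriv]
  congr 1
  funext s
  rw [add_right_comm, h]

theorem VertInv.iterate_pd {G : Pt → ℝ} (h : VertInv G) (k : Fin 3) :
    ∀ a, VertInv ((_root_.pd k)^[a] G)
  | 0 => h
  | a + 1 => by
    rw [Function.iterate_succ_apply']
    exact (h.iterate_pd k a).pd k

theorem VertInv.pd_two {G : Pt → ℝ} (h : VertInv G) (y : Pt) : _root_.pd 2 G y = 0 := by
  rw [pd_eq_deriv]
  simp only [h y]
  exact deriv_const _ _

theorem integral_iterate_pd_horizontal {f : ℝ → ℝ} (hf : p.SideLip f) {k : Fin 3} (hk : k ≠ 2)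
    {Ψ : Pt → ℝ} (hΨ : IsTest p.dom Ψ) : ∀ (a : ℕ) {G : Pt → ℝ}, ContDiff ℝ ∞ G →
      ∫ y in p.dom, G y * f (y 2) * (pd k)^[a] Ψ y
        = (-1) ^ a * ∫ y in p.dom, (pd k)^[a] G y * f (y 2) * Ψ y
  | 0, G, _ => by simp
  | a + 1, G, hG => by
    have h := setIntegral_dom_mul_pd hf hG (hΨ.iterate_pd k a) k
    simp only [if_neg hk, mul_zero, add_zero] at h
    rw [Function.iterate_succ_apply', h, integral_iterate_pd_horizontal hf hk hΨ a (contDiff_pd hG k),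
      Function.iterate_succ_apply]
    ring

theorem integral_iterate_pd_vertical {G : Pt → ℝ} (hG : ContDiff ℝ ∞ G) (hG2 : VertInv G)
    {Ψ : Pt → ℝ} (hΨ : IsTest p.dom Ψ) : ∀ (a : ℕ) {f : ℝ → ℝ},
      (∀ j < a, p.SideLip (deriv^[j] f)) → ∫ y in p.dom, G y * f (y 2) * (pd 2)^[a] Ψ y
        = (-1) ^ a * ∫ y in p.dom, G y * deriv^[a] f (y 2) * Ψ y
  | 0, f, _ => by simp
  | a + 1, f, hf => by
    have h := setIntegral_dom_mul_pd (hf 0 a.succ_pos) hG (hΨ.iterate_pd 2 a) 2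
    simp only [hG2.pd_two, zero_mul, zero_add, if_true, Function.iterate_zero, id] at h
    rw [Function.iterate_succ_apply', h, integral_iterate_pd_vertical hG hG2 hΨ a fun j hj =>
      hf (j + 1) (Nat.succ_lt_succ hj), Function.iterate_succ_apply]
    ring

theorem SideLip.continuousOn {f : ℝ → ℝ} (hf : p.SideLip f) : ContinuousOn f p.heights := by
  obtain ⟨⟨K, hK⟩, L, hL⟩ := hf
  exact hK.continuousOn.union_of_isOpen hL.continuousOn isOpen_Ioo isOpen_Ioo

theorem SideLip.exists_deriv_bound {f : ℝ → ℝ} (hf : p.SideLip f) :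
    ∃ C, ∀ x ∈ p.heights, |deriv f x| ≤ C := by
  obtain ⟨⟨K, hK⟩, L, hL⟩ := hf
  refine ⟨max K L, fun x hx => ?_⟩
  rcases hx with hx | hx
  · exact (norm_deriv_le_of_lipschitzOn (Ioo_mem_nhds hx.1 hx.2) hK).trans (le_max_left _ _)
  · exact (norm_deriv_le_of_lipschitzOn (Ioo_mem_nhds hx.1 hx.2) hL).trans (le_max_right _ _)

theorem SideLip.exists_bound {f : ℝ → ℝ} (hf : p.SideLip f) :
    ∃ C, ∀ x ∈ p.heights, |f x| ≤ C := by
  obtain ⟨⟨K, hK⟩, L, hL⟩ := hf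
  have hb : ∀ (c d : ℝ) (K : NNReal), LipschitzOnWith K f (Ioo c d) →
      ∃ C, ∀ x ∈ Ioo c d, |f x| ≤ C := fun c d K hK => by
    obtain ⟨F, hF, hfF⟩ := hK.extend_real
    obtain ⟨C, hC⟩ := isCompact_Icc.exists_bound_of_continuousOn (s := Icc c d)
      hF.continuous.continuousOn
    exact ⟨C, fun x hx => by rw [hfF hx]; exact hC x (Ioo_subset_Icc_self hx)⟩
  obtain ⟨C, hC⟩ := hb _ _ K hK
  obtain ⟨D, hD⟩ := hb _ _ L hL
  refine ⟨max C D, fun x hx => ?_⟩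
  rcases hx with hx | hx
  · exact (hC x hx).trans (le_max_left _ _)
  · exact (hD x hx).trans (le_max_right _ _)

/-- The profiles whose derivatives up to order `k` are Lipschitz on each side. -/
def SideSmooth (p : RTData) (k : ℕ) (f : ℝ → ℝ) : Prop := ∀ j ≤ k, p.SideLip (deriv^[j] f)

theorem SideSmooth.exists_bound {k : ℕ} {f : ℝ → ℝ} (hf : p.SideSmooth k f) {j : ℕ}
    (hj : j ≤ k + 1) : ∃ C, ∀ x ∈ p.heights, |deriv^[j] f x| ≤ C := by
  cases j with
  | zero => exact (hf 0 (Nat.zero_le k)).exists_bound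
  | succ j =>
    simp only [Function.iterate_succ_apply']
    exact (hf j (Nat.succ_le_succ_iff.1 hj)).exists_deriv_bound

theorem SideSmooth.aestronglyMeasurable {k : ℕ} {f : ℝ → ℝ} (hf : p.SideSmooth k f) (j : ℕ) :
    AEStronglyMeasurable (deriv^[j] f) (volume.restrict p.heights) := by
  cases j with
  | zero =>
    exact (hf 0 (Nat.zero_le k)).continuousOn.aestronglyMeasurable isOpen_heights.measurableSet
  | succ j =>
    simp only [Function.iterate_succ_apply']
    exact (measurable_deriv _).aestronglyMeasurable

theorem quasiMeasurePreserving_height : Measure.QuasiMeasurePreserving (fun y : Pt => y 2)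
    (volume.restrict p.dom) (volume.restrict p.heights) :=
  (Measure.quasiMeasurePreserving_eval (fun _ : Fin 3 => (volume : Measure ℝ)) 2).restrict
    fun _ hy => hy

theorem SideSmooth.aestronglyMeasurable_mul {k : ℕ} {f : ℝ → ℝ} (hf : p.SideSmooth k f) (j : ℕ)
    {G : Pt → ℝ} (hG : Continuous G) :
    AEStronglyMeasurable (fun y => G y * deriv^[j] f (y 2)) (volume.restrict p.dom) :=
  hG.aestronglyMeasurable.mul
    ((hf.aestronglyMeasurable j).comp_quasiMeasurePreserving quasiMeasurePreserving_height)

theorem SideSmooth.locallyIntegrableOn {k : ℕ} {f : ℝ → ℝ} (hf : p.SideSmooth k f) {j : ℕ}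
    (hj : j ≤ k + 1) {G : Pt → ℝ} (hG : Continuous G) :
    LocallyIntegrableOn (fun y => G y * deriv^[j] f (y 2)) p.dom := by
  obtain ⟨C, hC⟩ := hf.exists_bound hj
  refine locallyIntegrableOn_of_locallyIntegrable_restrict ?_
  have h : LocallyIntegrable (fun y => G y * C) (volume.restrict p.dom) :=
    (hG.mul continuous_const).locallyIntegrable
  refine h.mono (hf.aestronglyMeasurable_mul j hG) ?_
  filter_upwards [ae_restrict_mem isOpen_dom.measurableSet] with y hy
  rw [norm_mul, norm_mul]
  exact mul_le_mul_of_nonneg_left ((hC _ (mem_dom.1 hy)).trans (le_abs_self C)) (norm_nonneg _)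

/-- The weak derivatives, up to order `k + 1` in the third variable, of a product of a smooth
function of the horizontal variables and of a profile whose derivatives up to order `k` are
Lipschitz. -/
theorem SideSmooth.hasWeakDeriv {k : ℕ} {f : ℝ → ℝ} (hf : p.SideSmooth k f) {G : Pt → ℝ}
    (hG : ContDiff ℝ ∞ G) (hG2 : VertInv G) {α : Fin 3 → ℕ} (hα : α 2 ≤ k + 1) :
    HasWeakDeriv p.dom α (fun y => G y * f (y 2))
      (fun y => multiDeriv ![α 0, α 1, 0] G y * deriv^[α 2] f (y 2)) := by
  have h1 := contDiff_iterate_pd hG 0 (α 0)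
  have hc : ContDiff ℝ ∞ (multiDeriv ![α 0, α 1, 0] G) :=
    contDiff_iterate_pd (contDiff_iterate_pd hG 1 (α 1)) 0 (α 0)
  refine ⟨hf.locallyIntegrableOn (Nat.zero_le _) hG.continuous,
    hf.locallyIntegrableOn hα hc.continuous, fun Ψ hs hcs hsub => ?_⟩
  have hΨ : IsTest p.dom Ψ := ⟨hs, hcs, hsub⟩
  have hf0 : p.SideLip f := hf 0 (Nat.zero_le k)
  unfold multiDeriv
  beta_reduce
  rw [integral_iterate_pd_horizontal hf0 (by decide) ((hΨ.iterate_pd 2 _).iterate_pd 1 _) _ hG,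
    integral_iterate_pd_horizontal hf0 (by decide) (hΨ.iterate_pd 2 _) _ h1,
    integral_iterate_pd_vertical (contDiff_iterate_pd h1 1 _)
      ((hG2.iterate_pd 0 _).iterate_pd 1 _) hΨ _ fun j hj => hf j (by omega)]
  rw [Fin.sum_univ_three, pow_add, pow_add, ← mul_assoc, ← mul_assoc, iterate_pd_comm hG]
  rfl

/-- Weak derivatives are unique. -/
theorem ae_eq_weakDeriv {U : Set Pt} (hU : IsOpen U) {α : Fin 3 → ℕ} {f g : Pt → ℝ}
    (h : HasWeakDeriv U α f g) : weakDeriv U α f =ᵐ[volume.restrict U] g := by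
  have hex : ∃ g, HasWeakDeriv U α f g := ⟨g, h⟩
  have hw : HasWeakDeriv U α f (weakDeriv U α f) := by
    rw [weakDeriv, dif_pos hex]
    exact hex.choose_spec
  rw [Filter.EventuallyEq, ae_restrict_iff' hU.measurableSet]
  have hint : ∀ {g : Pt → ℝ}, LocallyIntegrableOn g U → ∀ {Ψ : Pt → ℝ}, IsTest U Ψ →
      Integrable fun y => g y * Ψ y := fun {g} hg {Ψ} hΨ => by
    have h1 := (hg.integrableOn_compact_subset hΨ.subset hΨ.compact).mul_continuousOn
      hΨ.smooth.continuous.continuousOn hΨ.compact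
    refine (integrableOn_iff_integrable_of_support_subset fun y hy => ?_).1 h1
    exact subset_tsupport Ψ (right_ne_zero_of_mul hy)
  have key := hU.ae_eq_zero_of_integral_contDiff_smul_eq_zero (μ := volume)
    (hw.2.1.sub h.2.1) fun Ψ hs hcs hsub => by
      have hΨ : IsTest U Ψ := ⟨hs, hcs, hsub⟩
      have e1 := hw.2.2 Ψ hs hcs hsub
      have e2 := h.2.2 Ψ hs hcs hsub
      rw [e1] at e2
      have e3 := mul_left_cancel₀ (pow_ne_zero _ (by norm_num)) e2
      rw [setIntegral_eq_integral_of_forall_compl_eq_zero fun y hy => by rw [hΨ.eq_zero hy, mul_zero],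
        setIntegral_eq_integral_of_forall_compl_eq_zero fun y hy => by
          rw [hΨ.eq_zero hy, mul_zero]] at e3
      have e4 := integral_sub (hint hw.2.1 hΨ) (hint h.2.1 hΨ)
      rw [e3, sub_self] at e4
      rw [← e4]
      exact integral_congr_ae (Eventually.of_forall fun y => by
        simp only [smul_eq_mul, Pi.sub_apply]
        ring)
  filter_upwards [key] with y hy hyU
  exact sub_eq_zero.1 (hy hyU)

end RTData

/-! ### Families of functions with uniformly bounded derivatives -/

/-- Smooth families all of whose derivatives are bounded, uniformly in the parameter. -/
structure BddSmooth {ι E : Type*} [NormedAddCommGroup E] [NormedSpace ℝ E] (F : ι → E → ℝ) :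
    Prop where
  contDiff : ∀ i, ContDiff ℝ ∞ (F i)
  bound : ∀ m : ℕ, ∃ C, ∀ i y, ‖iteratedFDeriv ℝ m (F i) y‖ ≤ C

namespace BddSmooth

variable {ι E : Type*} [NormedAddCommGroup E] [NormedSpace ℝ E] {F H : ι → E → ℝ}

theorem abs_le (h : BddSmooth F) : ∃ C, ∀ i y, |F i y| ≤ C := by
  obtain ⟨C, hC⟩ := h.bound 0
  exact ⟨C, fun i y => by simpa using hC i y⟩

theorem mul (hF : BddSmooth F) (hH : BddSmooth H) : BddSmooth fun i y => F i y * H i y := by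
  refine ⟨fun i => (hF.contDiff i).mul (hH.contDiff i), fun m => ?_⟩
  choose C hC using hF.bound
  choose D hD using hH.bound
  refine ⟨∑ j ∈ Finset.range (m + 1), (m.choose j : ℝ) * |C j| * |D (m - j)|, fun i y => ?_⟩
  refine (norm_iteratedFDeriv_mul_le (hF.contDiff i) (hH.contDiff i) y
    (by exact_mod_cast le_top)).trans (Finset.sum_le_sum fun j _ => ?_)
  have h1 := (hC j i y).trans (le_abs_self _)
  have h2 := (hD (m - j) i y).trans (le_abs_self _)
  gcongr

theorem comp_affine {κ : Type*} {A : ι → ℝ → ℝ} (hA : BddSmooth A) (ℓ : E →L[ℝ] ℝ) (r : κ → ι)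
    (τ : κ → ℝ) : BddSmooth fun (j : κ) (y : E) => A (r j) (ℓ y + τ j) := by
  have hs : ∀ j, ContDiff ℝ ∞ fun t => A (r j) (t + τ j) := fun j =>
    (hA.contDiff (r j)).comp (contDiff_id.add contDiff_const)
  refine ⟨fun j => (hs j).comp ℓ.contDiff, fun m => ?_⟩
  obtain ⟨C, hC⟩ := hA.bound m
  refine ⟨|C| * ∏ _k : Fin m, ‖ℓ‖, fun j y => ?_⟩
  have h1 := ℓ.iteratedFDeriv_comp_right (hs j) y (i := m) (by exact_mod_cast le_top)
  change ‖iteratedFDeriv ℝ m ((fun t => A (r j) (t + τ j)) ∘ ℓ) y‖ ≤ _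
  rw [h1]
  refine (ContinuousMultilinearMap.norm_compContinuousLinearMap_le _ _).trans ?_
  gcongr
  rw [iteratedFDeriv_comp_add_right]
  exact (hC _ _).trans (le_abs_self C)

theorem pd {F : ι → Pt → ℝ} (h : BddSmooth F) (k : Fin 3) : BddSmooth fun i => pd k (F i) := by
  refine ⟨fun i => contDiff_pd (h.contDiff i) k, fun m => ?_⟩
  obtain ⟨C, hC⟩ := h.bound (m + 1)
  refine ⟨‖(Pi.single k 1 : Pt)‖ * C, fun i y => ?_⟩
  have hs := h.contDiff i
  rw [pd_eq_fderiv (hs.differentiable (by simp))]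
  refine (norm_iteratedFDeriv_clm_apply_const
    (hs.fderiv_right (m := m) (by exact_mod_cast le_top)).contDiffAt le_rfl).trans ?_
  rw [norm_iteratedFDeriv_fderiv]
  exact mul_le_mul_of_nonneg_left (hC i y) (norm_nonneg _)

theorem iterate_pd {F : ι → Pt → ℝ} (h : BddSmooth F) (k : Fin 3) :
    ∀ a, BddSmooth fun i => (_root_.pd k)^[a] (F i)
  | 0 => h
  | a + 1 => by
    simp only [Function.iterate_succ_apply']
    exact (iterate_pd h k a).pd k

theorem multiDeriv {F : ι → Pt → ℝ} (h : BddSmooth F) (α : Fin 3 → ℕ) :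
    BddSmooth fun i => multiDeriv α (F i) :=
  ((h.iterate_pd 2 _).iterate_pd 1 _).iterate_pd 0 _

theorem sin_cos : BddSmooth ![Real.sin, Real.cos] := by
  have hs : ∀ i, ContDiff ℝ ∞ ((![Real.sin, Real.cos] : Fin 2 → ℝ → ℝ) i) := by
    intro i
    fin_cases i
    exacts [Real.contDiff_sin, Real.contDiff_cos]
  refine ⟨hs, fun m => ⟨1, fun i y => ?_⟩⟩
  rw [norm_iteratedFDeriv_eq_norm_iteratedDeriv]
  fin_cases i
  · exact Real.abs_iteratedDeriv_sin_le_one m y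
  · exact Real.abs_iteratedDeriv_cos_le_one m y

/-- A smooth function with compactly supported derivative has bounded derivatives. -/
theorem of_compact_deriv {A : ℝ → ℝ} (hA : ContDiff ℝ ∞ A) {C : ℝ} (hC : ∀ t, |A t| ≤ C)
    (hd : HasCompactSupport (deriv A)) : BddSmooth fun _ : Unit => A := by
  refine ⟨fun _ => hA, fun m => ?_⟩
  have hm : ∀ m, HasCompactSupport (iteratedDeriv (m + 1) A) := fun m => by
    induction m with
    | zero => rwa [zero_add, iteratedDeriv_one]
    | succ m ih => rw [iteratedDeriv_succ]; exact ih.deriv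
  simp only [norm_iteratedFDeriv_eq_norm_iteratedDeriv]
  cases m with
  | zero => exact ⟨C, fun _ y => by simpa using hC y⟩
  | succ m =>
    obtain ⟨D, hD⟩ := (hm m).exists_bound_of_continuous
      (hA.continuous_iteratedDeriv (m + 1) (by exact_mod_cast le_top))
    exact ⟨D, fun _ y => hD y⟩

end BddSmooth

/-! ### The cut-off functions -/

/-- The one-sided cut-off profile: `1` up to `t = 1`, and `χ` beyond. -/
def halfCut (χ : ℝ → ℝ) (t : ℝ) : ℝ := if t ≤ 1 then 1 else χ t

namespace IsCutoff

variable {χ : ℝ → ℝ}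

theorem halfCut_eq (h : IsCutoff χ) {t : ℝ} (ht : -1 < t) : halfCut χ t = χ t := by
  unfold halfCut
  split_ifs with h1
  · exact (h.eq_one t (abs_le.2 ⟨ht.le, h1⟩)).symm
  · rfl

theorem contDiff_halfCut (h : IsCutoff χ) : ContDiff ℝ ∞ (halfCut χ) := by
  refine contDiff_iff_contDiffAt.2 fun t => ?_
  rcases lt_or_ge (-1) t with ht | ht
  · exact h.smooth.contDiffAt.congr_of_eventuallyEq
      (by filter_upwards [Ioi_mem_nhds ht] with s hs using h.halfCut_eq hs)
  · refine (contDiffAt_const (c := (1 : ℝ))).congr_of_eventuallyEq ?_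
    filter_upwards [Iio_mem_nhds (lt_of_le_of_lt ht (by norm_num : (-1 : ℝ) < 1))] with s hs
    exact if_pos (le_of_lt hs)

theorem abs_halfCut_le (h : IsCutoff χ) (t : ℝ) : |halfCut χ t| ≤ 1 := by
  unfold halfCut
  split_ifs
  · simp
  · exact abs_le.2 ⟨by linarith [h.nonneg t], h.le_one t⟩

theorem bddSmooth_halfCut (h : IsCutoff χ) : BddSmooth fun _ : Unit => halfCut χ := by
  refine BddSmooth.of_compact_deriv h.contDiff_halfCut h.abs_halfCut_le
    (HasCompactSupport.intro (isCompact_Icc (a := (1 : ℝ)) (b := 2)) fun t ht => ?_)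
  rcases lt_or_ge t 1 with h1 | h1
  · have e : halfCut χ =ᶠ[𝓝 t] fun _ => 1 := by
      filter_upwards [Iio_mem_nhds h1] with s hs using if_pos (le_of_lt hs)
    rw [e.deriv_eq, deriv_const]
  · have h2 : 2 < t := lt_of_not_ge fun h2 => ht ⟨h1, h2⟩
    have e : halfCut χ =ᶠ[𝓝 t] fun _ => 0 := by
      filter_upwards [Ioi_mem_nhds h2] with s hs
      have hs : 2 < s := hs
      rw [h.halfCut_eq (by linarith), h.eq_zero s (hs.le.trans (le_abs_self s))]
    rw [e.deriv_eq, deriv_const]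

/-- The cut-off functions as products of two smooth translates, which avoids the corner of `|r|` at
`0`. For `r ≥ 0` the second factor is `1` because `2 - n ≤ 1`. -/
theorem cut_eq (h : IsCutoff χ) {n : ℝ} (hn : 1 ≤ n) (r : ℝ) :
    cut χ n r = halfCut χ (r + (2 - n)) * halfCut χ (-r + (2 - n)) := by
  have key : cut χ n r = halfCut χ (|r| + (2 - n)) := by
    unfold cut
    split_ifs with h1 h2
    · exact (if_pos (by linarith)).symm
    · rw [h.halfCut_eq (by linarith)]
      congr 1
      ring
    · push Not at h2
      rw [h.halfCut_eq (by linarith), h.eq_zero _ (le_trans (by linarith) (le_abs_self _))]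
  rw [key]
  rcases le_total 0 r with hr | hr
  · rw [abs_of_nonneg hr, show halfCut χ (-r + (2 - n)) = 1 from if_pos (by linarith), mul_one]
  · rw [abs_of_nonpos hr, show halfCut χ (r + (2 - n)) = 1 from if_pos (by linarith), one_mul]

theorem _root_.cut_eq_one {n r : ℝ} (hr : |r| < n - 1) : cut χ n r = 1 := if_pos hr.le

theorem _root_.cut_eq_zero {n r : ℝ} (hr : n < |r|) : cut χ n r = 0 := by
  rw [cut, if_neg (by linarith), if_neg (by linarith)]

theorem bddSmooth_cut2 (h : IsCutoff χ) : BddSmooth fun n : Ici (1 : ℝ) => cut2 χ n := by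
  have e : (fun n : Ici (1 : ℝ) => cut2 χ n) = fun (n : Ici (1 : ℝ)) (y : Pt) =>
      (halfCut χ ((ContinuousLinearMap.proj 0 : Pt →L[ℝ] ℝ) y + (2 - n))
        * halfCut χ ((-ContinuousLinearMap.proj 0 : Pt →L[ℝ] ℝ) y + (2 - n)))
      * (halfCut χ ((ContinuousLinearMap.proj 1 : Pt →L[ℝ] ℝ) y + (2 - n))
        * halfCut χ ((-ContinuousLinearMap.proj 1 : Pt →L[ℝ] ℝ) y + (2 - n))) := by
    funext n y
    rw [cut2, h.cut_eq n.2, h.cut_eq n.2]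
    simp
  rw [e]
  have hb := fun ℓ : Pt →L[ℝ] ℝ => h.bddSmooth_halfCut.comp_affine ℓ
    (fun _ : Ici (1 : ℝ) => ()) fun n => 2 - n
  exact ((hb _).mul (hb _)).mul ((hb _).mul (hb _))

end IsCutoff

/-! ### Plane waves -/

/-- The phase shifts that turn the horizontal profiles into sines. -/
def shift (i : Fin 3) : ℝ := ![0, 0, Real.pi / 2] i

theorem wave_eq_sin (i : Fin 3) (z : ℝ) : wave i z = Real.sin (z + shift i) := by
  fin_cases i
  · change Real.sin z = Real.sin (z + 0)
    rw [add_zero]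
  · change Real.sin z = Real.sin (z + 0)
    rw [add_zero]
  · exact (Real.sin_add_pi_div_two z).symm

theorem bddSmooth_wave {ι : Type*} (ξ : EuclideanSpace ℝ (Fin 2)) (i : Fin 3) :
    BddSmooth fun (_ : ι) y => wave i (phase ξ y) := by
  have e : (fun (_ : ι) y => wave i (phase ξ y)) = fun (_ : ι) y => (![Real.sin, Real.cos] : Fin 2 → ℝ → ℝ) 0
      ((ξ 0 • ContinuousLinearMap.proj 0 + ξ 1 • ContinuousLinearMap.proj 1 : Pt →L[ℝ] ℝ) y
        + shift i) := by
    funext _ y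
    rw [wave_eq_sin]
    simp [phase, mul_comm]
  rw [e]
  exact BddSmooth.sin_cos.comp_affine _ (fun _ => 0) fun _ => shift i

theorem hasDerivAt_sin_shift (δ z : ℝ) :
    HasDerivAt (fun z => Real.sin (z + δ)) (Real.sin (z + (δ + Real.pi / 2))) z := by
  rw [← add_assoc, Real.sin_add_pi_div_two]
  exact (Real.hasDerivAt_sin (z + δ)).comp_add_const z δ

theorem multiDeriv_horizontal (a b : ℕ) (F : Pt → ℝ) :
    multiDeriv ![a, b, 0] F = (pd 0)^[a] ((pd 1)^[b] F) := rfl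

theorem iterate_pd_zero_sin (ξ : EuclideanSpace ℝ (Fin 2)) (a : ℕ) (c δ : ℝ) : ∃ δ',
    (pd 0)^[a] (fun y => c * Real.sin (phase ξ y + δ))
      = fun y => ξ 0 ^ a * c * Real.sin (phase ξ y + δ') := by
  induction a generalizing c δ with
  | zero => exact ⟨δ, by simp⟩
  | succ a ih =>
    obtain ⟨δ', h⟩ := ih (c * ξ 0) (δ + Real.pi / 2)
    refine ⟨δ', ?_⟩
    have e : pd 0 (fun y => c * Real.sin (phase ξ y + δ))
        = fun y => c * ξ 0 * Real.sin (phase ξ y + (δ + Real.pi / 2)) := funext fun y => by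
      rw [pd_zero_sep (f := fun _ => c) (T := fun z => Real.sin (z + δ))
        (fun z => hasDerivAt_sin_shift δ z)]
      ring
    rw [Function.iterate_succ_apply, e, h]
    funext y
    ring

theorem iterate_pd_one_sin (ξ : EuclideanSpace ℝ (Fin 2)) (a : ℕ) (c δ : ℝ) : ∃ δ',
    (pd 1)^[a] (fun y => c * Real.sin (phase ξ y + δ))
      = fun y => ξ 1 ^ a * c * Real.sin (phase ξ y + δ') := by
  induction a generalizing c δ with
  | zero => exact ⟨δ, by simp⟩
  | succ a ih =>
    obtain ⟨δ', h⟩ := ih (c * ξ 1) (δ + Real.pi / 2)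
    refine ⟨δ', ?_⟩
    have e : pd 1 (fun y => c * Real.sin (phase ξ y + δ))
        = fun y => c * ξ 1 * Real.sin (phase ξ y + (δ + Real.pi / 2)) := funext fun y => by
      rw [pd_one_sep (f := fun _ => c) (T := fun z => Real.sin (z + δ))
        (fun z => hasDerivAt_sin_shift δ z)]
      ring
    rw [Function.iterate_succ_apply, e, h]
    funext y
    ring

/-- Horizontal derivatives of the plane waves are shifted plane waves. -/
theorem multiDeriv_wave (ξ : EuclideanSpace ℝ (Fin 2)) (i : Fin 3) (a b : ℕ) : ∃ δ,
    multiDeriv ![a, b, 0] (fun y => wave i (phase ξ y))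
      = fun y => ξ 0 ^ a * ξ 1 ^ b * Real.sin (phase ξ y + δ) := by
  have e : (fun y => wave i (phase ξ y)) = fun y => 1 * Real.sin (phase ξ y + shift i) := by
    funext y
    rw [wave_eq_sin, one_mul]
  obtain ⟨δ₁, h1⟩ := iterate_pd_one_sin ξ b 1 (shift i)
  obtain ⟨δ₂, h2⟩ := iterate_pd_zero_sin ξ a (ξ 1 ^ b * 1) δ₁
  refine ⟨δ₂, ?_⟩
  rw [multiDeriv_horizontal]
  rw [e, h1, h2]
  funext y
  ring

theorem EqOn.iterate_pd {U : Set Pt} (hU : IsOpen U) (k : Fin 3) : ∀ (a : ℕ) {F H : Pt → ℝ},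
    EqOn F H U → EqOn ((pd k)^[a] F) ((pd k)^[a] H) U
  | 0, _, _, h => h
  | a + 1, _, _, h => by
    rw [Function.iterate_succ_apply, Function.iterate_succ_apply]
    exact EqOn.iterate_pd hU k a fun y hy => pd_congr (h.eventuallyEq_of_mem (hU.mem_nhds hy)) k

theorem EqOn.multiDeriv {U : Set Pt} (hU : IsOpen U) (α : Fin 3 → ℕ) {F H : Pt → ℝ}
    (h : EqOn F H U) : EqOn (multiDeriv α F) (multiDeriv α H) U :=
  EqOn.iterate_pd hU 0 _ (EqOn.iterate_pd hU 1 _ (EqOn.iterate_pd hU 2 _ h))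

theorem iterate_pd_const_zero (k : Fin 3) : ∀ a, (pd k)^[a] (fun _ => (0 : ℝ)) = fun _ => 0
  | 0 => rfl
  | a + 1 => by
    have e : pd k (fun _ => (0 : ℝ)) = fun _ => 0 := funext fun y => by
      rw [pd_eq_deriv]; exact deriv_const _ _
    rw [Function.iterate_succ_apply, e, iterate_pd_const_zero k a]

theorem multiDeriv_zero (α : Fin 3 → ℕ) : multiDeriv α (fun _ => (0 : ℝ)) = fun _ => 0 := by
  simp only [multiDeriv, iterate_pd_const_zero]

theorem pd_const (k : Fin 3) (c : ℝ) : pd k (fun _ => c) = fun _ => 0 :=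
  funext fun y => by rw [pd_eq_deriv]; exact deriv_const _ _

/-- Horizontal derivatives of positive order of constants vanish. -/
theorem multiDeriv_const {a b : ℕ} (h : 1 ≤ a + b) (c : ℝ) :
    multiDeriv ![a, b, 0] (fun _ => c) = fun _ => 0 := by
  rw [multiDeriv_horizontal]
  cases b with
  | succ b => rw [Function.iterate_succ_apply, pd_const, iterate_pd_const_zero, iterate_pd_const_zero]
  | zero =>
    cases a with
    | zero => omega
    | succ a =>
      rw [Function.iterate_zero, id, Function.iterate_succ_apply, pd_const, iterate_pd_const_zero]

/-! ### Plateau families -/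

/-- Families of functions of the horizontal variables that are bounded, agree with the plane wave
`c sin(y_h · ξ + δ)` on the square `|y₁|, |y₂| < n - 1` and vanish outside of the square
`|y₁|, |y₂| ≤ n`. -/
structure Plateau (ξ : EuclideanSpace ℝ (Fin 2)) (c δ C : ℝ) (h : ℝ → Pt → ℝ) : Prop where
  continuous : ∀ n, 1 ≤ n → Continuous (h n)
  vertInv : ∀ n, 1 ≤ n → RTData.VertInv (h n)
  bound : ∀ n, 1 ≤ n → ∀ y, |h n y| ≤ C
  inner : ∀ n, 1 ≤ n → ∀ y : Pt, |y 0| < n - 1 → |y 1| < n - 1 → h n y = c * Real.sin (phase ξ y + δ)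
  outer : ∀ n, 1 ≤ n → ∀ y : Pt, n < |y 0| ∨ n < |y 1| → h n y = 0

theorem isOpen_inner (n : ℝ) : IsOpen {y : Pt | |y 0| < n ∧ |y 1| < n} :=
  (isOpen_lt (continuous_apply 0).abs continuous_const).inter
    (isOpen_lt (continuous_apply 1).abs continuous_const)

theorem isOpen_outer (n : ℝ) : IsOpen {y : Pt | n < |y 0| ∨ n < |y 1|} :=
  (isOpen_lt continuous_const (continuous_apply 0).abs).union
    (isOpen_lt continuous_const (continuous_apply 1).abs)

theorem cut2_inner {χ : ℝ → ℝ} {n : ℝ} {y : Pt} (h0 : |y 0| < n - 1) (h1 : |y 1| < n - 1) :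
    cut2 χ n y = 1 := by rw [cut2, cut_eq_one h0, cut_eq_one h1, one_mul]

theorem cut2_outer {χ : ℝ → ℝ} {n : ℝ} {y : Pt} (h : n < |y 0| ∨ n < |y 1|) : cut2 χ n y = 0 := by
  rcases h with h | h
  · rw [cut2, cut_eq_zero h, zero_mul]
  · rw [cut2, cut_eq_zero h, mul_zero]

theorem vertInv_cut2 (χ : ℝ → ℝ) (n : ℝ) : RTData.VertInv (cut2 χ n) := fun y t => by simp [cut2]

theorem vertInv_wave (ξ : EuclideanSpace ℝ (Fin 2)) (i : Fin 3) :
    RTData.VertInv fun y => wave i (phase ξ y) := fun y t => by simp [phase]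

theorem RTData.VertInv.mul {F H : Pt → ℝ} (hF : RTData.VertInv F) (hH : RTData.VertInv H) :
    RTData.VertInv fun y => F y * H y := fun y t => by
  beta_reduce
  rw [hF, hH]

theorem RTData.VertInv.multiDeriv {F : Pt → ℝ} (hF : RTData.VertInv F) (α : Fin 3 → ℕ) :
    RTData.VertInv (multiDeriv α F) := ((hF.iterate_pd 2 _).iterate_pd 1 _).iterate_pd 0 _

/-- The horizontal derivatives of the truncated plane waves. -/
theorem IsCutoff.plateau_multiDeriv {χ : ℝ → ℝ} (hχ : IsCutoff χ)
    {ξ : EuclideanSpace ℝ (Fin 2)} {i : Fin 3} {a b : ℕ} {c δ : ℝ}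
    (hT : _root_.multiDeriv ![a, b, 0] (fun y => wave i (phase ξ y))
      = fun y => c * Real.sin (phase ξ y + δ)) : ∃ C,
    Plateau ξ c δ C fun n => multiDeriv ![a, b, 0] fun y => cut2 χ n y * wave i (phase ξ y) := by
  have hB := (hχ.bddSmooth_cut2.mul (bddSmooth_wave ξ i)).multiDeriv ![a, b, 0]
  obtain ⟨C, hC⟩ := hB.abs_le
  refine ⟨C, fun n hn => (hB.contDiff ⟨n, hn⟩).continuous,
    fun n _ => ((vertInv_cut2 χ n).mul (vertInv_wave ξ i)).multiDeriv _,
    fun n hn y => hC ⟨n, hn⟩ y, fun n _ y h0 h1 => ?_, fun n _ y hy => ?_⟩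
  · rw [← congrFun hT y]
    refine EqOn.multiDeriv (isOpen_inner (n - 1)) _ (fun z hz => ?_) ⟨h0, h1⟩
    simp only [cut2_inner hz.1 hz.2, one_mul]
  · refine (EqOn.multiDeriv (isOpen_outer n) _ (H := fun _ => 0) (fun z hz => ?_) hy).trans
      (congrFun (multiDeriv_zero _) y)
    simp only [cut2_outer hz, zero_mul]

/-- The derivatives of the cut-off functions times plane waves. -/
theorem IsCutoff.plateau_cut_mul {χ : ℝ → ℝ} (hχ : IsCutoff χ) (ξ : EuclideanSpace ℝ (Fin 2))
    (i : Fin 3) {a b : ℕ} (hab : 1 ≤ a + b) : ∃ C,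
    Plateau ξ 0 0 C fun n y => multiDeriv ![a, b, 0] (cut2 χ n) y * wave i (phase ξ y) := by
  have hB := (hχ.bddSmooth_cut2.multiDeriv ![a, b, 0]).mul (bddSmooth_wave ξ i)
  obtain ⟨C, hC⟩ := hB.abs_le
  refine ⟨C, fun n hn => (hB.contDiff ⟨n, hn⟩).continuous,
    fun n _ => ((vertInv_cut2 χ n).multiDeriv _).mul (vertInv_wave ξ i),
    fun n hn y => hC ⟨n, hn⟩ y, fun n _ y h0 h1 => ?_, fun n _ y hy => ?_⟩
  · have := (EqOn.multiDeriv (isOpen_inner (n - 1)) ![a, b, 0] (F := cut2 χ n) (H := fun _ => 1)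
      (fun z hz => cut2_inner hz.1 hz.2) ⟨h0, h1⟩).trans (congrFun (multiDeriv_const hab 1) y)
    rw [this, zero_mul, zero_mul]
  · have := (EqOn.multiDeriv (isOpen_outer n) ![a, b, 0] (F := cut2 χ n) (H := fun _ => 0)
      (fun z hz => cut2_outer hz) hy).trans (congrFun (multiDeriv_zero _) y)
    rw [this, zero_mul]

/-! ### Mean values over large squares -/

/-- The square `[-n,n]²`. -/
def square (n : ℝ) : Set (ℝ × ℝ) := Icc (-n) n ×ˢ Icc (-n) n

/-- The point of the interface with horizontal coordinates `q`. -/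
def flat (q : ℝ × ℝ) : Pt := ![q.1, q.2, 0]

theorem measurableSet_square (n : ℝ) : MeasurableSet (square n) :=
  measurableSet_Icc.prod measurableSet_Icc

theorem isCompact_square (n : ℝ) : IsCompact (square n) := isCompact_Icc.prod isCompact_Icc

theorem continuous_flat : Continuous flat := by
  unfold flat
  refine continuous_pi fun i => ?_
  fin_cases i
  · exact continuous_fst
  · exact continuous_snd
  · exact continuous_const

/-- Oscillating integrals over `[-n,n]`. -/
def osc (κ δ n : ℝ) : ℝ := ∫ t in Icc (-n) n, Real.sin (κ * t + δ)

theorem abs_osc_le (κ δ : ℝ) {n : ℝ} (hn : 0 < n) : |osc κ δ n / n| ≤ 2 := by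
  have h := norm_setIntegral_le_of_norm_le_const (μ := volume) (s := Icc (-n) n)
    (f := fun t => Real.sin (κ * t + δ)) (C := 1) isCompact_Icc.measure_lt_top
    fun t _ => Real.abs_sin_le_one _
  rw [Real.volume_real_Icc_of_le (by linarith)] at h
  rw [abs_div, abs_of_pos hn, div_le_iff₀ hn]
  rw [Real.norm_eq_abs] at h
  unfold osc
  linarith

theorem tendsto_osc {κ : ℝ} (hκ : κ ≠ 0) (δ : ℝ) :
    Tendsto (fun n => osc κ δ n / n) atTop (𝓝 0) := by
  have hb : ∀ n : ℝ, 0 < n → |osc κ δ n| ≤ 2 / |κ| := fun n hn => by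
    have hd : ∀ t ∈ uIcc (-n) n, HasDerivAt (fun t => -(Real.cos (κ * t + δ)) / κ)
        (Real.sin (κ * t + δ)) t := fun t _ => by
      have h1 : HasDerivAt (fun t => κ * t + δ) κ t := by
        simpa using ((hasDerivAt_id t).const_mul κ).add_const δ
      have h2 := (((Real.hasDerivAt_cos (κ * t + δ)).comp t h1).neg).div_const κ
      have e : -(-Real.sin (κ * t + δ) * κ) / κ = Real.sin (κ * t + δ) := by field_simp
      rw [e] at h2
      exact h2
    have h := intervalIntegral.integral_eq_sub_of_hasDerivAt hd
      ((by fun_prop : Continuous fun t => Real.sin (κ * t + δ)).intervalIntegrable _ _)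
    rw [osc, integral_Icc_eq_integral_Ioc, ← intervalIntegral.integral_of_le (by linarith), h,
      ← sub_div, abs_div]
    gcongr
    have c1 := Real.abs_cos_le_one (κ * n + δ)
    have c2 := Real.abs_cos_le_one (κ * -n + δ)
    rw [abs_le] at c1 c2 ⊢
    constructor <;> linarith
  refine squeeze_zero_norm' (a := fun n => 2 / |κ| / n) ?_ (tendsto_const_nhds.div_atTop tendsto_id)
  filter_upwards [eventually_gt_atTop 0] with n hn
  rw [norm_div, Real.norm_eq_abs, Real.norm_of_nonneg hn.le]
  gcongr
  exact hb n hn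

theorem tendsto_osc_mul {κ κ' : ℝ} (h : κ ≠ 0 ∨ κ' ≠ 0) (δ δ' : ℝ) :
    Tendsto (fun n => osc κ δ n * osc κ' δ' n / n ^ 2) atTop (𝓝 0) := by
  have hb : ∀ κ δ, IsBoundedUnder (· ≤ ·) atTop fun n => ‖osc κ δ n / n‖ := fun κ δ =>
    isBoundedUnder_of_eventually_le (a := 2) ((eventually_gt_atTop 0).mono fun n hn =>
      abs_osc_le κ δ hn)
  have e : (fun n => osc κ δ n * osc κ' δ' n / n ^ 2)
      = fun n => osc κ δ n / n * (osc κ' δ' n / n) := by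
    funext n
    rw [div_mul_div_comm, sq]
  rw [e]
  rcases h with h | h
  · exact (tendsto_osc h δ).zero_mul_isBoundedUnder_le (hb κ' δ')
  · exact isBoundedUnder_le_mul_tendsto_zero (hb κ δ) (tendsto_osc h δ')

theorem volume_real_square {n : ℝ} (hn : 0 ≤ n) : volume.real (square n) = 4 * n ^ 2 := by
  rw [square, Measure.volume_eq_prod, measureReal_prod_prod, Real.volume_real_Icc_of_le (by linarith)]
  ring

theorem integral_square_sin_sq (ξ : EuclideanSpace ℝ (Fin 2)) (δ : ℝ) {n : ℝ} (hn : 0 ≤ n) :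
    ∫ q in square n, Real.sin (phase ξ (flat q) + δ) ^ 2
      = 2 * n ^ 2 - (osc (2 * ξ 0) (Real.pi / 2) n * osc (2 * ξ 1) (2 * δ + Real.pi / 2) n
        - osc (2 * ξ 0) 0 n * osc (2 * ξ 1) (2 * δ) n) / 2 := by
  set s : ℝ → ℝ → ℝ → ℝ := fun κ δ t => Real.sin (κ * t + δ) with hs
  have e : ∀ q : ℝ × ℝ, Real.sin (phase ξ (flat q) + δ) ^ 2
      = 1 / 2 - (s (2 * ξ 0) (Real.pi / 2) q.1 * s (2 * ξ 1) (2 * δ + Real.pi / 2) q.2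
        - s (2 * ξ 0) 0 q.1 * s (2 * ξ 1) (2 * δ) q.2) / 2 := fun q => by
    have e1 : 2 * (phase ξ (flat q) + δ) = 2 * ξ 0 * q.1 + (2 * ξ 1 * q.2 + 2 * δ) := by
      simp only [phase, flat, Matrix.cons_val]; ring
    rw [Real.sin_sq_eq_half_sub, e1, Real.cos_add]
    simp only [hs, ← add_assoc, add_zero, Real.sin_add_pi_div_two]
  have hc : ∀ κ δ κ' δ', IntegrableOn (fun q : ℝ × ℝ => s κ δ q.1 * s κ' δ' q.2) (square n) := by
    intro κ δ κ' δ'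
    exact (by fun_prop : Continuous fun q : ℝ × ℝ => s κ δ q.1 * s κ' δ' q.2).continuousOn.integrableOn_compact
      (isCompact_square n)
  have hm : ∀ κ δ κ' δ', ∫ q in square n, s κ δ q.1 * s κ' δ' q.2 = osc κ δ n * osc κ' δ' n := by
    intro κ δ κ' δ'
    exact setIntegral_prod_mul (s κ δ) (s κ' δ') _ _
  have h1 : IntegrableOn (fun _ : ℝ × ℝ => (1 / 2 : ℝ)) (square n) :=
    continuousOn_const.integrableOn_compact (isCompact_square n)
  have h2 : IntegrableOn (fun q : ℝ × ℝ =>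
      (s (2 * ξ 0) (Real.pi / 2) q.1 * s (2 * ξ 1) (2 * δ + Real.pi / 2) q.2
        - s (2 * ξ 0) 0 q.1 * s (2 * ξ 1) (2 * δ) q.2) / 2) (square n) :=
    ((hc _ _ _ _).sub (hc _ _ _ _)).div_const 2
  simp_rw [e]
  rw [integral_sub h1 h2, setIntegral_const, integral_div, integral_sub (hc _ _ _ _) (hc _ _ _ _), hm, hm,
    volume_real_square hn, smul_eq_mul]
  ring

/-- The mean value of the square of a plane wave is `1/2`; the square `[-n,n]²` has area `4n²`. -/
theorem tendsto_mean_sin_sq {ξ : EuclideanSpace ℝ (Fin 2)} (hξ : ξ ≠ 0) (δ : ℝ) :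
    Tendsto (fun n => (∫ q in square n, Real.sin (phase ξ (flat q) + δ) ^ 2) / n ^ 2) atTop
      (𝓝 2) := by
  have h : 2 * ξ 0 ≠ 0 ∨ 2 * ξ 1 ≠ 0 := by
    by_contra hne
    push Not at hne
    refine hξ (PiLp.ext fun i => ?_)
    fin_cases i
    · simpa using hne.1
    · simpa using hne.2
  have h1 := ((tendsto_osc_mul h (Real.pi / 2) (2 * δ + Real.pi / 2)).sub
    (tendsto_osc_mul h 0 (2 * δ))).div_const 2
  have h2 := (tendsto_const_nhds (x := (2 : ℝ)) (f := atTop)).sub h1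
  simp only [sub_zero, zero_div] at h2
  refine h2.congr' ?_
  filter_upwards [eventually_gt_atTop 0] with n hn
  rw [integral_square_sin_sq ξ δ hn.le]
  field_simp

namespace Plateau

variable {ξ : EuclideanSpace ℝ (Fin 2)} {c δ C : ℝ} {h : ℝ → Pt → ℝ}

/-- A plateau family differs from its plane wave on a set of area at most `8n` only. -/
theorem abs_integral_sub_le (hP : Plateau ξ c δ C h) {n : ℝ} (hn : 1 ≤ n) :
    |(∫ q, h n (flat q) ^ 2) - c ^ 2 * ∫ q in square n, Real.sin (phase ξ (flat q) + δ) ^ 2|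
      ≤ 8 * n * (C ^ 2 + c ^ 2) := by
  have hF : Continuous fun q => h n (flat q) ^ 2 := ((hP.continuous n hn).comp continuous_flat).pow 2
  have hS : Continuous fun q => c ^ 2 * Real.sin (phase ξ (flat q) + δ) ^ 2 := by
    have h1 : Continuous fun q => phase ξ (flat q) :=
      (contDiff_phase ξ (k := 0)).continuous.comp continuous_flat
    fun_prop
  have hout : ∀ q, q ∉ square n → h n (flat q) ^ 2 = 0 := fun q hq => by
    rw [hP.outer n hn, zero_pow two_ne_zero]
    by_contra hcon
    push Not at hcon
    exact hq ⟨abs_le.1 hcon.1, abs_le.1 hcon.2⟩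
  set Q : Set (ℝ × ℝ) := Ioo (-(n - 1)) (n - 1) ×ˢ Ioo (-(n - 1)) (n - 1) with hQ
  have hQm : MeasurableSet Q := measurableSet_Ioo.prod measurableSet_Ioo
  have hQs : Q ⊆ square n := by
    refine prod_mono ?_ ?_ <;> exact Ioo_subset_Icc_self.trans (Icc_subset_Icc (by linarith) (by linarith))
  have hin : ∀ q ∈ Q, h n (flat q) ^ 2 - c ^ 2 * Real.sin (phase ξ (flat q) + δ) ^ 2 = 0 :=
    fun q hq => by
      rw [hP.inner n hn (flat q) (abs_lt.2 hq.1) (abs_lt.2 hq.2)]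
      ring
  have hvol : volume.real (square n \ Q) ≤ 8 * n := by
    rw [measureReal_sdiff hQs hQm (isCompact_square n).measure_lt_top.ne,
      volume_real_square (by linarith), hQ, Measure.volume_eq_prod, measureReal_prod_prod,
      Real.volume_real_Ioo_of_le (by linarith)]
    nlinarith
  rw [← integral_const_mul, ← setIntegral_eq_integral_of_forall_compl_eq_zero hout,
    ← integral_sub (hF.continuousOn.integrableOn_compact (isCompact_square n))
      (hS.continuousOn.integrableOn_compact (isCompact_square n)),
    setIntegral_eq_of_subset_of_forall_sdiff_eq_zero (measurableSet_square n) sdiff_subset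
      (fun q hq => hin q (by_contra fun hq' => hq.2 ⟨hq.1, hq'⟩))]
  have hle := norm_setIntegral_le_of_norm_le_const (μ := volume) (s := square n \ Q)
    (f := fun q => h n (flat q) ^ 2 - c ^ 2 * Real.sin (phase ξ (flat q) + δ) ^ 2)
    (C := C ^ 2 + c ^ 2) ((measure_mono sdiff_subset).trans_lt (isCompact_square n).measure_lt_top)
    fun q _ => by
      have h1 : h n (flat q) ^ 2 ≤ C ^ 2 := sq_le_sq' (abs_le.1 (hP.bound n hn _)).1
        (abs_le.1 (hP.bound n hn _)).2
      have h2 : c ^ 2 * Real.sin (phase ξ (flat q) + δ) ^ 2 ≤ c ^ 2 :=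
        mul_le_of_le_one_right (sq_nonneg c) (Real.sin_sq_le_one _)
      have h3 : 0 ≤ c ^ 2 * Real.sin (phase ξ (flat q) + δ) ^ 2 := by positivity
      rw [Real.norm_eq_abs, abs_le]
      constructor <;> nlinarith [sq_nonneg (h n (flat q))]
  refine hle.trans ?_
  rw [mul_comm]
  exact mul_le_mul_of_nonneg_right hvol (by positivity)

theorem tendsto_integral (hP : Plateau ξ c δ C h) (hξ : ξ ≠ 0) :
    Tendsto (fun n => (∫ q, h n (flat q) ^ 2) / n ^ 2) atTop (𝓝 (2 * c ^ 2)) := by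
  have h1 := (tendsto_mean_sin_sq hξ δ).const_mul (c ^ 2)
  have h2 : Tendsto (fun n => (∫ q, h n (flat q) ^ 2) / n ^ 2
      - c ^ 2 * ((∫ q in square n, Real.sin (phase ξ (flat q) + δ) ^ 2) / n ^ 2)) atTop (𝓝 0) := by
    refine squeeze_zero_norm' (a := fun n => 8 * (C ^ 2 + c ^ 2) / n) ?_
      (tendsto_const_nhds.div_atTop tendsto_id)
    filter_upwards [eventually_ge_atTop 1] with n hn
    have hn0 : 0 < n := by linarith
    rw [← mul_div_assoc, ← sub_div, norm_div, Real.norm_of_nonneg (sq_nonneg n), Real.norm_eq_abs,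
      div_le_div_iff₀ (by positivity) hn0]
    have h3 := mul_le_mul_of_nonneg_right (hP.abs_integral_sub_le hn) hn0.le
    refine h3.trans (le_of_eq (by ring))
  have h3 := h2.add h1
  simp only [sub_add_cancel, zero_add] at h3
  rwa [mul_comm (c ^ 2)] at h3

end Plateau


/-! ### Separated integrals over `Ω` -/

namespace RTData

variable {p : RTData}

theorem VertInv.eq_flat {H : Pt → ℝ} (hH : VertInv H) (y : Pt) : H y = H (flat (y 0, y 1)) := by
  rw [← hH (flat (y 0, y 1)) (y 2)]
  congr 1
  funext i
  fin_cases i <;> simp [flat]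

theorem integral_separated (F : ℝ × ℝ → ℝ) (w : ℝ → ℝ) :
    ∫ y : Pt, F (y 0, y 1) * w (y 2) = (∫ q, F q) * ∫ x, w x := by
  have h1 := (volume_preserving_piFinSuccAbove (fun _ : Fin 3 => ℝ) 2).integral_comp'
    (g := fun z : ℝ × (Fin 2 → ℝ) => w z.1 * F (z.2 0, z.2 1))
  have h2 := (volume_preserving_finTwoArrow ℝ).integral_comp' (g := F)
  rw [Measure.volume_eq_prod, integral_prod_mul w (fun z : Fin 2 → ℝ => F (z 0, z 1))] at h1
  rw [← h2, mul_comm]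
  refine Eq.trans ?_ h1
  refine integral_congr_ae (Eventually.of_forall fun y => ?_)
  simp only [mul_comm (w _)]
  rfl

theorem integral_dom_separated {H : Pt → ℝ} (hH : VertInv H) (w : ℝ → ℝ) :
    ∫ y in p.dom, H y * w (y 2) = (∫ q, H (flat q)) * ∫ x in p.heights, w x := by
  rw [← integral_indicator isOpen_dom.measurableSet, ← integral_indicator isOpen_heights.measurableSet,
    ← integral_separated]
  refine integral_congr_ae (Eventually.of_forall fun y => ?_)
  simp only [← hH.eq_flat y]
  by_cases hy : y ∈ p.dom
  · rw [indicator_of_mem hy, indicator_of_mem (mem_dom.1 hy)]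
  · rw [indicator_of_notMem hy, indicator_of_notMem (fun h => hy (mem_dom.2 h)), mul_zero]

theorem integral_dom_sq {H : Pt → ℝ} (hH : VertInv H) (v : ℝ → ℝ) :
    ∫ y in p.dom, (H y * v (y 2)) ^ 2
      = (∫ q, H (flat q) ^ 2) * ∫ x in p.heights, v x ^ 2 := by
  simp_rw [mul_pow]
  exact integral_dom_separated (H := fun y => H y ^ 2) (fun y t => by beta_reduce; rw [hH])
    fun x => v x ^ 2

variable {ξ : EuclideanSpace ℝ (Fin 2)} {c δ C : ℝ} {h : ℝ → Pt → ℝ}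

theorem tendsto_integral_dom_sq (hP : Plateau ξ c δ C h) (hξ : ξ ≠ 0) (v : ℝ → ℝ) :
    Tendsto (fun n => (∫ y in p.dom, (h n y * v (y 2)) ^ 2) / n ^ 2) atTop
      (𝓝 (2 * c ^ 2 * ∫ x in p.heights, v x ^ 2)) := by
  refine ((hP.tendsto_integral hξ).mul_const _).congr' ?_
  filter_upwards [eventually_ge_atTop 1] with n hn
  rw [integral_dom_sq (hP.vertInv n hn)]
  ring

theorem integral_dom_sq_le (hP : Plateau ξ 0 0 C h) (v : ℝ → ℝ) {n : ℝ} (hn : 1 ≤ n) :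
    ∫ y in p.dom, (h n y * v (y 2)) ^ 2 ≤ 8 * C ^ 2 * (∫ x in p.heights, v x ^ 2) * n := by
  rw [integral_dom_sq (hP.vertInv n hn)]
  have h1 := hP.abs_integral_sub_le hn
  rw [zero_pow two_ne_zero, zero_mul, sub_zero, add_zero] at h1
  have h2 := mul_le_mul_of_nonneg_right ((le_abs_self _).trans h1)
    (setIntegral_nonneg isOpen_heights.measurableSet fun x _ => sq_nonneg (v x) :
      0 ≤ ∫ x in p.heights, v x ^ 2)
  refine h2.trans (le_of_eq (by ring))

/-- Bounded functions on bounded subsets of `Ω` are square integrable. -/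
theorem SideSmooth.memLp_box {k : ℕ} {f : ℝ → ℝ} (hf : p.SideSmooth k f) {j : ℕ} (hj : j ≤ k + 1)
    {G : Pt → ℝ} (hG : Continuous G) {C : ℝ} (hC : ∀ y, |G y| ≤ C) {V : Set Pt} {a b : Pt}
    (hV : V ⊆ p.dom) (hVm : MeasurableSet V) (hab : V ⊆ Icc a b) :
    MemLp (fun y => G y * deriv^[j] f (y 2)) 2 (volume.restrict V) := by
  obtain ⟨D, hD⟩ := hf.exists_bound hj
  have : IsFiniteMeasure (volume.restrict V) :=
    ⟨by rw [Measure.restrict_apply_univ]; exact (measure_mono hab).trans_lt isCompact_Icc.measure_lt_top⟩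
  refine MemLp.of_bound ((hf.aestronglyMeasurable_mul j hG).mono_measure
    (Measure.restrict_mono hV le_rfl)) (C * D) ?_
  filter_upwards [ae_restrict_mem hVm] with y hy
  rw [norm_mul, Real.norm_eq_abs, Real.norm_eq_abs]
  exact mul_le_mul (hC y) (hD _ (mem_dom.1 (hV hy))) (abs_nonneg _) ((abs_nonneg _).trans (hC y))

theorem SideSmooth.memLp_plateau {k : ℕ} {f : ℝ → ℝ} (hf : p.SideSmooth k f) {j : ℕ}
    (hj : j ≤ k + 1) (hP : Plateau ξ c δ C h) {n : ℝ} (hn : 1 ≤ n) :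
    MemLp (fun y => h n y * deriv^[j] f (y 2)) 2 (volume.restrict p.dom) := by
  set B : Set Pt := {y | |y 0| ≤ n ∧ |y 1| ≤ n} with hB
  have hBm : MeasurableSet B := ((isClosed_le (continuous_apply 0).abs continuous_const).inter
    (isClosed_le (continuous_apply 1).abs continuous_const)).measurableSet
  have hd := isOpen_dom (p := p)
  have e : (fun y => h n y * deriv^[j] f (y 2)) = B.indicator fun y => h n y * deriv^[j] f (y 2) := by
    funext y
    by_cases hy : y ∈ B
    · rw [indicator_of_mem hy]
    · rw [indicator_of_notMem hy, hP.outer n hn y, zero_mul]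
      by_contra hcon
      push Not at hcon
      exact hy hcon
  rw [e, memLp_indicator_iff_restrict hBm, Measure.restrict_restrict hBm]
  refine hf.memLp_box hj (hP.continuous n hn) (hP.bound n hn) inter_subset_right
    (hBm.inter hd.measurableSet) (a := ![-n, -n, min p.hm 0]) (b := ![n, n, max p.hp 0]) ?_
  rintro y ⟨⟨h0, h1⟩, hy⟩
  have h2 : min p.hm 0 ≤ y 2 ∧ y 2 ≤ max p.hp 0 := by
    rcases hy with hy | hy
    · exact ⟨(min_le_right _ _).trans hy.1.le, hy.2.le.trans (le_max_left _ _)⟩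
    · exact ⟨(min_le_left _ _).trans hy.1.le, hy.2.le.trans (le_max_right _ _)⟩
  rw [abs_le] at h0 h1
  constructor
  · intro i
    fin_cases i
    exacts [h0.1, h1.1, h2.1]
  · intro i
    fin_cases i
    exacts [h0.2, h1.2, h2.2]

theorem Valid.integral_heights (hv : p.Valid) (w : ℝ → ℝ) :
    ∫ x in p.heights, w x = ∫ x in Ioo p.hm p.hp, w x := by
  have e : p.heights = Ioo p.hm p.hp \ {0} := by
    ext x
    have h1 := hv.hm_neg
    have h2 := hv.hp_pos
    simp only [heights, mem_union, mem_Ioo, Set.mem_sdiff, mem_singleton_iff]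
    constructor
    · rintro (⟨a, b⟩ | ⟨a, b⟩)
      · exact ⟨⟨by linarith, b⟩, a.ne'⟩
      · exact ⟨⟨a, by linarith⟩, b.ne⟩
    · rintro ⟨⟨a, b⟩, h⟩
      rcases lt_or_gt_of_ne h with h | h
      · exact Or.inr ⟨a, h⟩
      · exact Or.inl ⟨h, b⟩
  rw [e]
  exact setIntegral_congr_set (sdiff_null_ae_eq_self (measure_singleton 0))

theorem Valid.integral_sq_pos (hv : p.Valid) {f : ℝ → ℝ}
    (hf : ContinuousOn f (Icc p.hm p.hp)) {x : ℝ} (hx : x ∈ Ioo p.hm p.hp) (hfx : f x ≠ 0) :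
    0 < ∫ x in p.heights, f x ^ 2 := by
  rw [hv.integral_heights, setIntegral_pos_iff_support_of_nonneg_ae
    (Eventually.of_forall fun x => sq_nonneg (f x))
    ((hf.pow 2).integrableOn_Icc.mono_set Ioo_subset_Icc_self)]
  have hU : IsOpen (Ioo p.hm p.hp ∩ f ⁻¹' {0}ᶜ) :=
    (hf.mono Ioo_subset_Icc_self).isOpen_inter_preimage isOpen_Ioo isOpen_compl_singleton
  refine (hU.measure_pos volume ⟨x, hx, hfx⟩).trans_le (measure_mono fun y hy => ⟨?_, hy.1⟩)
  exact pow_ne_zero 2 hy.2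

end RTData

theorem tendsto_sqrt_div {I : ℝ → ℝ} {L : ℝ} (h : Tendsto (fun n => I n / n ^ 2) atTop (𝓝 L)) :
    Tendsto (fun n => Real.sqrt (I n) / n) atTop (𝓝 (Real.sqrt L)) := by
  refine ((Real.continuous_sqrt.tendsto L).comp h).congr' ?_
  filter_upwards [eventually_gt_atTop 0] with n hn
  simp only [Function.comp]
  rw [Real.sqrt_div' _ (sq_nonneg n), Real.sqrt_sq hn.le]

/-! ### The cut-off estimates -/

namespace RTData

variable {p : RTData} {ξ : EuclideanSpace ℝ (Fin 2)} {u : Fin 3 → ℝ → ℝ} {s : ℝ}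

theorem le_of_mem_multiIdx {k : ℕ} {α : Fin 3 → ℕ} (h : α ∈ multiIdx k) (i : Fin 3) : α i ≤ k := by
  have h1 := Fintype.mem_piFinset.1 (Finset.mem_filter.1 h).1 i
  exact Nat.lt_succ_iff.1 (Finset.mem_range.1 h1)

theorem modeField_eq (a : ℝ) (i : Fin 3) (y : Pt) :
    modeField a ξ u y i = wave i (phase ξ y) * (a * u i (y 2)) := by
  rw [modeField]
  ring

theorem bounds_of_mem_dom {y : Pt} (hy : y ∈ p.dom) : min p.hm 0 ≤ y 2 ∧ y 2 ≤ max p.hp 0 := by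
  rcases hy with hy | hy
  · exact ⟨(min_le_right _ _).trans hy.1.le, hy.2.le.trans (le_max_left _ _)⟩
  · exact ⟨(min_le_left _ _).trans hy.1.le, hy.2.le.trans (le_max_right _ _)⟩

namespace ClassicalMode

theorem sideSmooth (h : p.ClassicalMode ξ s u) (a : ℝ) (i : Fin 3) :
    p.SideSmooth 3 fun x => a * u i x := fun j hj =>
  ⟨((h.upper i).const_mul a).lipschitz_iterate_deriv j hj,
    ((h.lower i).const_mul a).lipschitz_iterate_deriv j hj⟩

theorem memH_cell (h : p.ClassicalMode ξ s u) (a L₁ L₂ : ℝ) (i : Fin 3) :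
    MemH 4 p.dom (p.cell L₁ L₂) fun y => modeField a ξ u y i := fun α hα => by
  have hα2 : α 2 ≤ 3 + 1 := le_of_mem_multiIdx hα 2
  have hB := bddSmooth_wave (ι := Unit) ξ i
  obtain ⟨C, hC⟩ := (hB.multiDeriv ![α 0, α 1, 0]).abs_le
  simp only [modeField_eq]
  refine ⟨_, (h.sideSmooth a i).hasWeakDeriv (hB.contDiff ()) (vertInv_wave ξ i) hα2,
    (h.sideSmooth a i).memLp_box hα2 ((hB.multiDeriv _).contDiff ()).continuous (hC ())
      (a := ![0, 0, min p.hm 0]) (b := ![2 * Real.pi * L₁, 2 * Real.pi * L₂, max p.hp 0])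
      (fun y hy => hy.1) ?_ fun y hy => ?_⟩
  · exact isOpen_dom.measurableSet.inter
      (((measurable_pi_apply 0) measurableSet_Ioo).inter ((measurable_pi_apply 1) measurableSet_Ioo))
  · have h2 := bounds_of_mem_dom hy.1
    constructor
    · intro i
      fin_cases i
      exacts [hy.2.1.1.le, hy.2.2.1.le, h2.1]
    · intro i
      fin_cases i
      exacts [hy.2.1.2.le, hy.2.2.2.le, h2.2]

section Cut

variable {χ : ℝ → ℝ}

/-- The weak derivatives of the truncated mode. -/
theorem hasWeakDeriv_cut (h : p.ClassicalMode ξ s u) (hχ : IsCutoff χ) {n : ℝ} (hn : 1 ≤ n)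
    (i : Fin 3) {α : Fin 3 → ℕ} (hα : α 2 ≤ 4) :
    HasWeakDeriv p.dom α (fun y => cut2 χ n y * modeField 2 ξ u y i) fun y =>
      multiDeriv ![α 0, α 1, 0] (fun y => cut2 χ n y * wave i (phase ξ y)) y
        * deriv^[α 2] (fun x => 2 * u i x) (y 2) := by
  simp only [modeField_eq, ← mul_assoc]
  have hB := hχ.bddSmooth_cut2.mul (bddSmooth_wave ξ i)
  have := (h.sideSmooth 2 i).hasWeakDeriv (hB.contDiff ⟨n, hn⟩)
    ((vertInv_cut2 χ n).mul (vertInv_wave ξ i)) (α := α) hα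
  simpa only [← mul_assoc] using this

theorem memH_cut (h : p.ClassicalMode ξ s u) (hχ : IsCutoff χ) {n : ℝ} (hn : 1 ≤ n) (i : Fin 3) :
    MemH 4 p.dom p.dom fun y => cut2 χ n y * modeField 2 ξ u y i := fun α hα => by
  have hα2 := le_of_mem_multiIdx hα 2
  obtain ⟨δ, hδ⟩ := multiDeriv_wave ξ i (α 0) (α 1)
  obtain ⟨C, hP⟩ := hχ.plateau_multiDeriv hδ
  exact ⟨_, h.hasWeakDeriv_cut hχ hn i hα2, (h.sideSmooth 2 i).memLp_plateau hα2 hP hn⟩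

/-- The squared norms of the weak derivatives of the truncated modes grow like the area of the
square of truncation. -/
theorem tendsto_weakDeriv_sq (h : p.ClassicalMode ξ s u) (hξ : ξ ≠ 0) (hχ : IsCutoff χ)
    (i : Fin 3) {α : Fin 3 → ℕ} (hα : α 2 ≤ 4) :
    Tendsto (fun n => (∫ y in p.dom,
        (weakDeriv p.dom α (fun y => cut2 χ n y * modeField 2 ξ u y i) y) ^ 2) / n ^ 2) atTop
      (𝓝 (2 * (ξ 0 ^ α 0 * ξ 1 ^ α 1) ^ 2
        * ∫ x in p.heights, deriv^[α 2] (fun x => 2 * u i x) x ^ 2)) := by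
  obtain ⟨δ, hδ⟩ := multiDeriv_wave ξ i (α 0) (α 1)
  obtain ⟨C, hP⟩ := hχ.plateau_multiDeriv hδ
  refine (tendsto_integral_dom_sq hP hξ (deriv^[α 2] fun x => 2 * u i x)).congr' ?_
  filter_upwards [eventually_ge_atTop 1] with n hn
  congr 1
  refine integral_congr_ae ?_
  filter_upwards [ae_eq_weakDeriv isOpen_dom (h.hasWeakDeriv_cut hχ hn i hα)] with y hy
  rw [hy]

theorem plateau_wave (hχ : IsCutoff χ) (i : Fin 3) : ∃ C,
    Plateau ξ 1 (shift i) C fun n y => cut2 χ n y * wave i (phase ξ y) :=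
  hχ.plateau_multiDeriv (a := 0) (b := 0) (funext fun y => by
    rw [one_mul]; exact wave_eq_sin i (phase ξ y))

theorem memLp_cut (h : p.ClassicalMode ξ s u) (hχ : IsCutoff χ) {n : ℝ} (hn : 1 ≤ n) (i : Fin 3) :
    MemLp (fun y => cut2 χ n y * modeField 2 ξ u y i) 2 (volume.restrict p.dom) := by
  obtain ⟨C, hP⟩ := plateau_wave (ξ := ξ) hχ i
  have := (h.sideSmooth 2 i).memLp_plateau (Nat.zero_le _) hP hn
  simp only [modeField_eq, ← mul_assoc, Function.iterate_zero, id] at this ⊢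
  exact this

theorem tendsto_cut_sq (hξ : ξ ≠ 0) (hχ : IsCutoff χ) (i : Fin 3) :
    Tendsto (fun n => (∫ y in p.dom, (cut2 χ n y * modeField 2 ξ u y i) ^ 2) / n ^ 2) atTop
      (𝓝 (2 * ∫ x in p.heights, (2 * u i x) ^ 2)) := by
  obtain ⟨C, hP⟩ := plateau_wave (ξ := ξ) hχ i
  have := tendsto_integral_dom_sq (p := p) hP hξ fun x => 2 * u i x
  simp only [modeField_eq, ← mul_assoc, one_pow, mul_one] at this ⊢
  exact this

theorem tendsto_trace_sq (hξ : ξ ≠ 0) (hχ : IsCutoff χ) :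
    Tendsto (fun n => (∫ q : ℝ × ℝ, (cut2 χ n (flat q) * modeField 2 ξ u (flat q) 2) ^ 2) / n ^ 2)
      atTop (𝓝 (2 * (2 * u 2 0) ^ 2)) := by
  obtain ⟨C, hP⟩ := plateau_wave (ξ := ξ) hχ 2
  have := (hP.tendsto_integral hξ).mul_const ((2 * u 2 0) ^ 2)
  rw [one_pow, mul_one] at this
  refine this.congr fun n => ?_
  rw [div_mul_eq_mul_div, ← integral_mul_const]
  congr 1
  refine integral_congr_ae (Eventually.of_forall fun q => ?_)
  simp only [modeField_eq, flat, Matrix.cons_val]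
  ring

theorem weakDeriv_vertical (h : p.ClassicalMode ξ s u) (i : Fin 3) {j : ℕ} (hj : j ≤ 4) :
    weakDeriv p.dom ![0, 0, j] (fun y => modeField 2 ξ u y i) =ᵐ[volume.restrict p.dom]
      fun y => wave i (phase ξ y) * deriv^[j] (fun x => 2 * u i x) (y 2) := by
  simp only [modeField_eq]
  exact ae_eq_weakDeriv isOpen_dom ((h.sideSmooth 2 i).hasWeakDeriv
    ((bddSmooth_wave (ι := Unit) ξ i).contDiff ()) (vertInv_wave ξ i) (α := ![0, 0, j]) hj)

/-- Where a derivative falls on the cut-off function, only the frame between the two squares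
contributes, whose area is of order `n`. -/
theorem commutator_bound (h : p.ClassicalMode ξ s u) (hχ : IsCutoff χ) {β : Fin 3 → ℕ}
    (hβ : β 2 ≤ 4) (hβ1 : 1 ≤ β 0 + β 1) :
    (∀ n : ℝ, 1 ≤ n → ∀ i, MemLp (fun y => multiDeriv ![β 0, β 1, 0] (cut2 χ n) y *
        weakDeriv p.dom ![0, 0, β 2] (fun z => modeField 2 ξ u z i) y) 2 (volume.restrict p.dom)) ∧
    ∃ B, 0 ≤ B ∧ ∀ n : ℝ, 1 ≤ n → (l2Norm p.dom fun y (i : Fin 3) =>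
      multiDeriv ![β 0, β 1, 0] (cut2 χ n) y *
        weakDeriv p.dom ![0, 0, β 2] (fun z => modeField 2 ξ u z i) y) ^ 2 ≤ B * n := by
  choose C hP using fun i => hχ.plateau_cut_mul ξ i hβ1
  have hae : ∀ n i, (fun y => multiDeriv ![β 0, β 1, 0] (cut2 χ n) y * wave i (phase ξ y)
      * deriv^[β 2] (fun x => 2 * u i x) (y 2)) =ᵐ[volume.restrict p.dom]
      fun y => multiDeriv ![β 0, β 1, 0] (cut2 χ n) y *
        weakDeriv p.dom ![0, 0, β 2] (fun z => modeField 2 ξ u z i) y := fun n i => by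
    filter_upwards [h.weakDeriv_vertical i hβ] with y hy
    rw [hy, mul_assoc]
  have hL : ∀ n : ℝ, 1 ≤ n → ∀ i, MemLp (fun y => multiDeriv ![β 0, β 1, 0] (cut2 χ n) y *
      weakDeriv p.dom ![0, 0, β 2] (fun z => modeField 2 ξ u z i) y) 2
      (volume.restrict p.dom) := fun n hn i =>
    ((h.sideSmooth 2 i).memLp_plateau hβ (hP i) hn).ae_eq (hae n i)
  refine ⟨hL, ∑ i, 8 * C i ^ 2 * ∫ x in p.heights, deriv^[β 2] (fun x => 2 * u i x) x ^ 2,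
    Finset.sum_nonneg fun i _ => mul_nonneg (by positivity)
      (setIntegral_nonneg isOpen_heights.measurableSet fun x _ => sq_nonneg _), fun n hn => ?_⟩
  rw [l2Norm, Real.sq_sqrt (setIntegral_nonneg isOpen_dom.measurableSet fun y _ =>
    Finset.sum_nonneg fun i _ => sq_nonneg _), integral_finsetSum _ fun i _ => (hL n hn i).integrable_sq,
    Finset.sum_mul]
  refine Finset.sum_le_sum fun i _ => ?_
  refine le_trans (le_of_eq ?_) (integral_dom_sq_le (hP i) (deriv^[β 2] fun x => 2 * u i x) hn)
  refine integral_congr_ae ?_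
  filter_upwards [hae n i] with y hy
  rw [hy]

end Cut

/-- The cut-off estimates. The squares of the limits are sums of terms `2c² ∫ v²`, where `c` is the
amplitude of a horizontal derivative of a plane wave and `v` a vertical derivative of the mode; they
do not depend on `χ`. -/
theorem cutoff_estimates (h : p.ClassicalMode ξ s u) (hv : p.Valid) (hξ : ξ ≠ 0)
    (ht : ∃ x ∈ Ioo p.hm p.hp, u 0 x ≠ 0 ∨ u 1 x ≠ 0) (hn : u 2 0 ≠ 0) :
    ∃ b₃ b₄ b₅ b₆ : ℝ, 0 < b₃ ∧ 0 < b₄ ∧ 0 < b₅ ∧ 0 < b₆ ∧ ∀ χ : ℝ → ℝ, IsCutoff χ →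
      (∃ b₂ : ℝ, 0 ≤ b₂ ∧ ∀ n : ℝ, 1 ≤ n →
        (∀ β ∈ multiIdx 4, 1 ≤ β 0 + β 1 → ∀ i, MemLp (fun y =>
          multiDeriv ![β 0, β 1, 0] (cut2 χ n) y *
            weakDeriv p.dom ![0, 0, β 2] (fun z => modeField 2 ξ u z i) y) 2
          (volume.restrict p.dom)) ∧
        (∑ β ∈ (multiIdx 4).filter (fun β => 1 ≤ β 0 + β 1),
          (l2Norm p.dom (fun y (i : Fin 3) => multiDeriv ![β 0, β 1, 0] (cut2 χ n) y *
            weakDeriv p.dom ![0, 0, β 2] (fun z => modeField 2 ξ u z i) y)) ^ 2) / n ≤ b₂) ∧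
      (∀ n : ℝ, 1 ≤ n → ∀ i, MemH 4 p.dom p.dom (fun y => cut2 χ n y * modeField 2 ξ u y i)) ∧
      Tendsto (fun n : ℝ => hNorm 4 p.dom (fun y i => cut2 χ n y * modeField 2 ξ u y i) / n)
        atTop (𝓝 b₃) ∧
      Tendsto (fun n : ℝ => l2Norm p.dom (fun y => ![cut2 χ n y * modeField 2 ξ u y 0,
        cut2 χ n y * modeField 2 ξ u y 1]) / n) atTop (𝓝 b₄) ∧
      Tendsto (fun n : ℝ => l2Norm p.dom (fun y => ![cut2 χ n y * modeField 2 ξ u y 2]) / n)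
        atTop (𝓝 b₅) ∧
      Tendsto (fun n : ℝ => l2Norm univ (fun q : ℝ × ℝ => ![cut2 χ n ![q.1, q.2, 0] *
        modeField 2 ξ u ![q.1, q.2, 0] 2]) / n) atTop (𝓝 b₆) := by
  have hnn : ∀ f : ℝ → ℝ, 0 ≤ ∫ x in p.heights, f x ^ 2 := fun f =>
    setIntegral_nonneg isOpen_heights.measurableSet fun x _ => sq_nonneg _
  have hpos : ∀ i, ∀ x ∈ Ioo p.hm p.hp, u i x ≠ 0 → 0 < ∫ x in p.heights, (2 * u i x) ^ 2 :=
    fun i x hx hux => hv.integral_sq_pos (continuousOn_const.mul (h.continuousOn i)) hx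
      (mul_ne_zero two_ne_zero hux)
  have h2 : 0 < ∫ x in p.heights, (2 * u 2 x) ^ 2 := hpos 2 0 ⟨hv.hm_neg, hv.hp_pos⟩ hn
  have h01 : 0 < 2 * (∫ x in p.heights, (2 * u 0 x) ^ 2)
      + 2 * ∫ x in p.heights, (2 * u 1 x) ^ 2 := by
    have n0 := hnn fun x => 2 * u 0 x
    have n1 := hnn fun x => 2 * u 1 x
    obtain ⟨x, hx, hux | hux⟩ := ht
    · linarith [hpos 0 x hx hux]
    · linarith [hpos 1 x hx hux]
  set b : Fin 3 → (Fin 3 → ℕ) → ℝ := fun i α => 2 * (ξ 0 ^ α 0 * ξ 1 ^ α 1) ^ 2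
    * ∫ x in p.heights, deriv^[α 2] (fun x => 2 * u i x) x ^ 2 with hb
  have hbn : ∀ i α, 0 ≤ b i α := fun i α => mul_nonneg (by positivity) (hnn _)
  have h3 : 0 < ∑ i, ∑ α ∈ multiIdx 4, b i α := by
    have hm : (0 : Fin 3 → ℕ) ∈ multiIdx 4 :=
      Finset.mem_filter.2 ⟨Fintype.mem_piFinset.2 fun i => by simp, by simp⟩
    have h4 : 0 < b 2 0 := by
      simp only [hb, Pi.zero_apply, pow_zero, mul_one, one_pow, Function.iterate_zero, id]
      linarith
    exact h4.trans_le ((Finset.single_le_sum (f := b 2) (fun α _ => hbn 2 α) hm).trans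
      (Finset.single_le_sum (f := fun i => ∑ α ∈ multiIdx 4, b i α)
        (fun i _ => Finset.sum_nonneg fun α _ => hbn i α) (Finset.mem_univ 2)))
  refine ⟨_, _, _, _, Real.sqrt_pos.2 h3, Real.sqrt_pos.2 h01,
    Real.sqrt_pos.2 (mul_pos two_pos h2),
    Real.sqrt_pos.2 (by positivity : (0 : ℝ) < 2 * (2 * u 2 0) ^ 2), fun χ hχ =>
    ⟨?_, fun n hn i => h.memH_cut hχ hn i, ?_, ?_, ?_, ?_⟩⟩
  · have hB : ∀ β : Fin 3 → ℕ, ∃ B, 0 ≤ B ∧ (β ∈ multiIdx 4 → 1 ≤ β 0 + β 1 → ∀ n : ℝ, 1 ≤ n →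
        (l2Norm p.dom fun y (i : Fin 3) => multiDeriv ![β 0, β 1, 0] (cut2 χ n) y *
          weakDeriv p.dom ![0, 0, β 2] (fun z => modeField 2 ξ u z i) y) ^ 2 ≤ B * n) := fun β => by
      by_cases hβ : β ∈ multiIdx 4 ∧ 1 ≤ β 0 + β 1
      · obtain ⟨B, h1, h2⟩ := (h.commutator_bound hχ (le_of_mem_multiIdx hβ.1 2) hβ.2).2
        exact ⟨B, h1, fun _ _ => h2⟩
      · exact ⟨0, le_rfl, fun h1 h2 => (hβ ⟨h1, h2⟩).elim⟩
    choose B hB0 hB using hB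
    refine ⟨∑ β ∈ (multiIdx 4).filter (fun β => 1 ≤ β 0 + β 1), B β,
      Finset.sum_nonneg fun β _ => hB0 β, fun n hn => ⟨fun β hβ hβ1 =>
        (h.commutator_bound hχ (le_of_mem_multiIdx hβ 2) hβ1).1 n hn, ?_⟩⟩
    rw [div_le_iff₀ (by linarith), Finset.sum_mul]
    exact Finset.sum_le_sum fun β hβ => hB β (Finset.mem_filter.1 hβ).1 (Finset.mem_filter.1 hβ).2 n hn
  · refine tendsto_sqrt_div ?_
    simp only [Finset.sum_div]
    exact tendsto_finsetSum _ fun i _ => tendsto_finsetSum _ fun α hα =>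
      h.tendsto_weakDeriv_sq hξ hχ i (le_of_mem_multiIdx hα 2)
  · refine tendsto_sqrt_div (((tendsto_cut_sq hξ hχ 0).add (tendsto_cut_sq hξ hχ 1)).congr' ?_)
    filter_upwards [eventually_ge_atTop 1] with n hn
    simp only [Fin.sum_univ_two, Matrix.cons_val]
    rw [integral_add (h.memLp_cut hχ hn 0).integrable_sq (h.memLp_cut hχ hn 1).integrable_sq, add_div]
  · refine tendsto_sqrt_div ((tendsto_cut_sq hξ hχ 2).congr fun n => ?_)
    simp only [Finset.univ_unique, Finset.sum_singleton, Fin.default_eq_zero, Matrix.cons_val]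
  · refine tendsto_sqrt_div ((tendsto_trace_sq hξ hχ).congr fun n => ?_)
    simp only [Finset.univ_unique, Finset.sum_singleton, Fin.default_eq_zero, Matrix.cons_val,
      Measure.restrict_univ]
    rfl

end ClassicalMode

end RTData

end

theorem proposition2p2 (p : RTData) (hvalid : p.Valid) :
    -- the growth rate is well defined at every subcritical frequency
    (∀ ξ ∈ p.subcritical, ∃! s, p.IsGrowthRate ξ s) ∧
    -- (1) the supremum of the growth rates is finite and almost attained
    BddAbove (p.lam '' p.subcritical) ∧
    (∃ ξ ∈ p.subcritical, p.lam ξ ∈ Set.Ioc (2 * p.supRate / 3) p.supRate) ∧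
    ∀ ξ ∈ p.subcritical, p.lam ξ ∈ Set.Ioc (2 * p.supRate / 3) p.supRate →
      (∃ φ θ ψ, p.IsMode ξ φ θ ψ) ∧
      ∀ φ θ ψ, p.IsMode ξ φ θ ψ →
        -- (2) the combined mode is real and gives a growing solution
        (∀ y i, (uTildeC ξ φ θ ψ y i).im = 0) ∧
        0 < p.lam ξ ∧
        p.IsPeriodicSolution (periodLen ξ 0) (periodLen ξ 1)
          (fun y => (p.lam ξ)⁻¹ • uTilde ξ φ θ ψ y) (uTilde ξ φ θ ψ)
          (fun t y => Real.exp (p.lam ξ * t) • (p.lam ξ)⁻¹ • uTilde ξ φ θ ψ y)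
          (fun t y => Real.exp (p.lam ξ * t) • uTilde ξ φ θ ψ y) ∧
        -- (3) uniform cut-off estimates
        ∃ b₃ b₄ b₅ b₆ : ℝ, 0 < b₃ ∧ 0 < b₄ ∧ 0 < b₅ ∧ 0 < b₆ ∧
          ∀ χ : ℝ → ℝ, IsCutoff χ →
            (∃ b₂ : ℝ, 0 ≤ b₂ ∧ ∀ n : ℝ, 1 ≤ n →
              (∀ β ∈ multiIdx 4, 1 ≤ β 0 + β 1 → ∀ i, MeasureTheory.MemLp (fun y =>
                multiDeriv ![β 0, β 1, 0] (cut2 χ n) y *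
                  weakDeriv p.dom ![0, 0, β 2] (fun z => uTilde ξ φ θ ψ z i) y) 2
                (MeasureTheory.volume.restrict p.dom)) ∧
              (∑ β ∈ (multiIdx 4).filter (fun β => 1 ≤ β 0 + β 1),
                (l2Norm p.dom (fun y (i : Fin 3) =>
                  multiDeriv ![β 0, β 1, 0] (cut2 χ n) y *
                    weakDeriv p.dom ![0, 0, β 2] (fun z => uTilde ξ φ θ ψ z i) y)) ^ 2) / n
                ≤ b₂) ∧
            (∀ n : ℝ, 1 ≤ n → ∀ i,
              MemH 4 p.dom p.dom (fun y => cut2 χ n y * uTilde ξ φ θ ψ y i)) ∧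
            Filter.Tendsto (fun n : ℝ =>
                hNorm 4 p.dom (fun y i => cut2 χ n y * uTilde ξ φ θ ψ y i) / n)
              Filter.atTop (nhds b₃) ∧
            Filter.Tendsto (fun n : ℝ =>
                l2Norm p.dom (fun y => ![cut2 χ n y * uTilde ξ φ θ ψ y 0,
                  cut2 χ n y * uTilde ξ φ θ ψ y 1]) / n)
              Filter.atTop (nhds b₄) ∧
            Filter.Tendsto (fun n : ℝ =>
                l2Norm p.dom (fun y => ![cut2 χ n y * uTilde ξ φ θ ψ y 2]) / n)
              Filter.atTop (nhds b₅) ∧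
            Filter.Tendsto (fun n : ℝ =>
                l2Norm Set.univ (fun q : ℝ × ℝ => ![cut2 χ n ![q.1, q.2, 0] *
                  uTilde ξ φ θ ψ ![q.1, q.2, 0] 2]) / n)
              Filter.atTop (nhds b₆) := by
  refine ⟨fun ξ hξ => ?_, hvalid.bddAbove_lam, hvalid.exists_near_supRate, fun ξ hξ _ => ?_⟩
  · obtain ⟨s, hs⟩ := hvalid.exists_isGrowthRate hξ
    exact ⟨s, hs, fun t ht => hvalid.isGrowthRate_unique ht hs⟩
  refine ⟨hvalid.exists_isMode hξ, fun φ θ ψ hmode => ?_⟩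
  have hm : p.IsMode ξ ((![φ, θ, ψ] : Fin 3 → ℝ → ℝ) 0) ((![φ, θ, ψ] : Fin 3 → ℝ → ℝ) 1)
      ((![φ, θ, ψ] : Fin 3 → ℝ → ℝ) 2) := hmode
  have hc := hvalid.classicalMode hξ hm
  have hu : uTilde ξ φ θ ψ = modeField 2 ξ ![φ, θ, ψ] := uTilde_eq ξ ![φ, θ, ψ]
  have hξ0 : ξ ≠ 0 := norm_pos_iff.1 hξ.1
  rw [hu]
  refine ⟨fun y i => ?_, hvalid.lam_pos hξ, hvalid.isPeriodicSolution hc (hvalid.lam_pos hξ)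
    fun a i => hc.memH_cell a _ _ i, hc.cutoff_estimates hvalid hξ0
      (hvalid.tang_ne_zero hξ hm) (hvalid.trace_ne_zero hξ hm)⟩
  exact (congrArg Complex.im (uTildeC_eq ξ ![φ, θ, ψ] y i)).trans (Complex.ofReal_im _)
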